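/- **Setting.** Let $\alpha:(0,\infty)\to[0,\infty)$ be a $C^1$ function (the potential) with $\int_0^1 r^4\alpha(r)\,dr<\infty$ and at most polynomial growth as $r\to\infty$ (for example $\alpha(r)=r^\gamma$ with $\gamma>-5$). Put $a_{ij}(y)=\alpha(|y|)\,(|y|^2\delta_{ij}-y_iy_j)$ for $y\in\mathbb R^3$. The homogeneous Landau equation with potential $\alpha$ is $$\partial_t f=q(f),\qquad q(f)(v)=\partial_{i}\int_{\mathbb R^3}a_{ij}(v-w)\bigl(f(w)\,\partial_jf(v)-f(v)\,\partial_jf(w)\bigr)\,dw .$$ Let $f=f(t,v)>0$ be a smooth solution on $(0,T)\times\mathbb R^3$ such that, locally uniformly in $t\in(0,T)$, every $v$-derivative of $f$ decays faster than any power of $|v|$, and the first and second $v$-derivatives of $\ln f$ grow at most polynomially in $|v|$. Let $$i(f)=\int_{\mathbb R^3}\frac{|\nabla f|^2}{f}\,dv$$ be the Fisher information. For $t\in(0,T)$ write $F=f\otimes f$, i.e. $F(v,w)=f(t,v)f(t,w)$, and $$\bar F(z,r,\sigma)=F(z+r\sigma,\,z-r\sigma),\qquad (z,r,\sigma)\in\mathbb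 R^3\times(0,\infty)\times\mathbb S^2 .$$ Let $\beta(r)=4\,\alpha(2r)$; this is the coefficient for which the lifted operator $(\partial_{v_i}-\partial_{w_i})\,a_{ij}(v-w)\,(\partial_{v_j}-\partial_{w_j})$ equals $\beta(r)\Delta_\sigma$ in the coordinates $(z,r,\sigma)$. For a function $g$ on $\mathbb S^2$ let $\Gamma_2(g)=|\nabla_\sigma^2g|^2+|\nabla_\sigma g|^2$, with the Riemannian gradient and Hessian of the unit sphere, and let $d\sigma$ be the surface measure. **Theorem.** For every $t\in(0,T)$: $i(f(t))$ is finite, $s\mapsto i(f(s))$ is differentiable at $t$, the first integral below converges absolutely, and $$\frac{d}{dt}\,i(f)\;\le\;4\left(-\int \beta(r)\,\Gamma_2(\ln\bar F)\,\bar F\,d\sigma\,dr\,dz\;+\;\int \bigl((\sqrt{\beta})'(r)\bigr)^2\,|\nabla_\sigma\ln\bar F|^2\,\bar F\,r^2\,d\sigma\,dr\,dz\right),$$ where the integrals are over $\mathbb R^3\times(0,\infty)\times\mathbb S^2$ and the second one, whose integrand is nonnegative, may be $+\infty$. (At points where $\sqrt\beta$ is not differentiable, which can only be zeros of $\beta$,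 read $(\sqrt\beta)'=0$.) -/

import Mathlib

open MeasureTheory Set
open scoped ENNReal ContDiff Gradient

noncomputable section

namespace Landau

/-- Velocity space with its Euclidean norm. -/
abbrev E3 : Type := EuclideanSpace ℝ (Fin 3)

/-- The unit sphere of velocity space. -/
abbrev S2 : Type := Metric.sphere (0 : E3) 1

/-! ### The homogeneous Landau equation -/

/-- Admissible potentials `α : (0,∞) → [0,∞)`: continuously differentiable, with
`∫₀¹ r⁴ α(r) dr < ∞`, and at most polynomially growing at infinity. Only the values of `α` on
`(0,∞)` matter. Every power `r ^ γ` with `γ > -5` is admissible. -/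
structure IsPotential (α : ℝ → ℝ) : Prop where
  nonneg : ∀ r, 0 < r → 0 ≤ α r
  contDiffOn : ContDiffOn ℝ 1 α (Ioi 0)
  integrableOn : IntegrableOn (fun r => r ^ 4 * α r) (Ioc 0 1)
  growth : ∃ (C : ℝ) (m : ℕ), ∀ r, 1 ≤ r → α r ≤ C * r ^ m

/-- The matrix `a(y) = α(|y|) (|y|² Id - y ⊗ y)`, applied to a vector `ξ`. -/
def landauMatrix (α : ℝ → ℝ) (y ξ : E3) : E3 :=
  α ‖y‖ • (‖y‖ ^ 2 • ξ - inner ℝ y ξ • y)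

/-- The flux `v ↦ ∫ a(v-w) (f(w) ∇f(v) - f(v) ∇f(w)) dw`. -/
def landauFlux (α : ℝ → ℝ) (f : E3 → ℝ) (v : E3) : E3 :=
  ∫ w, landauMatrix α (v - w) (f w • ∇ f v - f v • ∇ f w)

/-- The divergence `∑ᵢ ∂ᵢ Xᵢ` of a vector field. -/
def divergence (X : E3 → E3) (v : E3) : ℝ :=
  ∑ i : Fin 3, fderiv ℝ X v (EuclideanSpace.single i 1) i

/-- The Landau collision operator
`q(f)(v) = ∂ᵢ ∫ aᵢⱼ(v-w) (f(w) ∂ⱼf(v) - f(v) ∂ⱼf(w)) dw`. -/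
def landauOperator (α : ℝ → ℝ) (f : E3 → ℝ) (v : E3) : ℝ :=
  divergence (landauFlux α f) v

/-- Smooth positive solutions `f(t,v)` of `∂ₜ f = q(f)` on `(0,T) × ℝ³` such that, locally
uniformly in time, all velocity derivatives of `f` decay faster than any power of `|v|`, and the
first two velocity derivatives of `ln f` grow at most polynomially. -/
structure IsSmoothSolution (α : ℝ → ℝ) (T : ℝ) (f : ℝ → E3 → ℝ) : Prop where
  smooth : ContDiffOn ℝ ∞ (fun p : ℝ × E3 => f p.1 p.2) (Ioo 0 T ×ˢ univ)
  pos : ∀ t ∈ Ioo 0 T, ∀ v, 0 < f t v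
  equation : ∀ t ∈ Ioo 0 T, ∀ v,
    HasDerivAt (fun s => f s v) (landauOperator α (f t) v) t
  decay : ∀ a b : ℝ, 0 < a → b < T → ∀ k n : ℕ, ∃ C : ℝ, ∀ t ∈ Icc a b, ∀ v,
    ‖v‖ ^ k * ‖iteratedFDeriv ℝ n (f t) v‖ ≤ C
  log_growth : ∀ a b : ℝ, 0 < a → b < T → ∃ (C : ℝ) (N : ℕ), ∀ t ∈ Icc a b, ∀ v,
    ‖iteratedFDeriv ℝ 1 (fun w => Real.log (f t w)) v‖
      + ‖iteratedFDeriv ℝ 2 (fun w => Real.log (f t w)) v‖ ≤ C * (1 + ‖v‖) ^ N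

/-! ### The Fisher information -/

/-- The integrand `|∇f|² / f` of the Fisher information. -/
def fisherDensity (f : E3 → ℝ) (v : E3) : ℝ := ‖∇ f v‖ ^ 2 / f v

/-- The Fisher information `i(f) = ∫ |∇f|² / f dv`. -/
def fisherInfo (f : E3 → ℝ) : ℝ := ∫ v, fisherDensity f v

/-! ### Calculus on the unit sphere

A function `g` on the sphere is handled through its extension `x ↦ g(x/|x|)`, constant along rays
(so only the values of `g` on the unit sphere matter). At a point `σ` of the sphere, the gradient
of the extension is the spherical gradient of `g`, and the restriction of the second derivative of
the extension to tangent vectors is the Riemannian Hessian of `g`. -/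

/-- The extension of `g` that is constant along rays. -/
def radialExt (g : E3 → ℝ) (x : E3) : ℝ := g (‖x‖⁻¹ • x)

/-- The spherical gradient `∇_σ g` at `σ`. -/
def sphGrad (g : E3 → ℝ) (σ : S2) : E3 := ∇ (radialExt g) (σ : E3)

/-- The orthogonal projection of `ξ` onto the tangent plane of the sphere at `σ`. -/
def tangentProj (σ : S2) (ξ : E3) : E3 := ξ - inner ℝ (σ : E3) ξ • (σ : E3)

/-- The spherical Hessian `∇²_σ g` at `σ`, as a bilinear form extended by zero in the normal
direction. -/
def sphHess (g : E3 → ℝ) (σ : S2) (ξ η : E3) : ℝ :=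
  iteratedFDeriv ℝ 2 (radialExt g) (σ : E3) ![tangentProj σ ξ, tangentProj σ η]

/-- The squared Hilbert-Schmidt norm `|∇²_σ g|²` at `σ`. -/
def sphHessNormSq (g : E3 → ℝ) (σ : S2) : ℝ :=
  ∑ i : Fin 3, ∑ j : Fin 3,
    sphHess g σ (EuclideanSpace.single i 1) (EuclideanSpace.single j 1) ^ 2

/-- `Γ₂(g) = |∇²_σ g|² + |∇_σ g|²`, the iterated carré du champ of the spherical Laplacian. -/
def Gamma2 (g : E3 → ℝ) (σ : S2) : ℝ := sphHessNormSq g σ + ‖sphGrad g σ‖ ^ 2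

/-! ### The lifted density in the coordinates `(z, r, σ)` -/

/-- The tensor product `(f ⊗ f)(v,w) = f(v) f(w)`. -/
def tensorSq (f : E3 → ℝ) (v w : E3) : ℝ := f v * f w

/-- `F̄(z,r,σ) = F(z + rσ, z - rσ)`. -/
def bar (F : E3 → E3 → ℝ) (z : E3) (r : ℝ) (σ : E3) : ℝ := F (z + r • σ) (z - r • σ)

/-- The function `β(r) = 4 α(2r)`. Since `|v - w| = 2r` and `∂_v - ∂_w` is the gradient in
`rσ = (v-w)/2`, the lifted operator `(∂_{vᵢ} - ∂_{wᵢ}) aᵢⱼ(v-w) (∂_{vⱼ} - ∂_{wⱼ})` is `β(r) Δ_σ`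
in the coordinates `(z,r,σ)`. -/
def liftedPotential (α : ℝ → ℝ) (r : ℝ) : ℝ := 4 * α (2 * r)

/-- The measure `dσ dr dz` on `ℝ³ × (0,∞) × S²`, with `dσ` the surface measure. -/
def coordMeasure : Measure (E3 × ℝ × S2) :=
  (volume : Measure E3).prod
    (((volume : Measure ℝ).restrict (Ioi 0)).prod (volume : Measure E3).toSphere)

/-- The integrand `β Γ₂(ln F̄) F̄`. -/
def gammaDensity (β : ℝ → ℝ) (F : E3 → E3 → ℝ) (p : E3 × ℝ × S2) : ℝ :=
  β p.2.1 * Gamma2 (fun σ => Real.log (bar F p.1 p.2.1 σ)) p.2.2 * bar F p.1 p.2.1 p.2.2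

/-- The integrand `((√β)')² |∇_σ ln F̄|² F̄ r²`. -/
def radialDensity (β : ℝ → ℝ) (F : E3 → E3 → ℝ) (p : E3 × ℝ × S2) : ℝ :=
  deriv (fun r => √(β r)) p.2.1 ^ 2
    * ‖sphGrad (fun σ => Real.log (bar F p.1 p.2.1 σ)) p.2.2‖ ^ 2
    * bar F p.1 p.2.1 p.2.2 * p.2.1 ^ 2

end Landau

end

/-!
The derivative of the Fisher information along the Landau flow is
`-∫ h(v) q(f)(v) dv` with `h = 2 Δ ln f + |∇ ln f|²`
(`IsSmoothSolution.hasDerivAt_fisherInfo`, `IsTame.integral_fisherRate`). The collision operator is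
a marginal of the lifted operator: with `F(v,w) = f(v) f(w)`, `v = z + y`, `w = z - y` and
`y = rσ`, one has `q(f)(v) = 8 ∫ β(|y|) (Δ_σ F)(v - y, y) dy`
(`IsTame.landauOperator_eq_lap`), because the two operators differ by derivatives of rotations,
which have mean zero on every sphere. Symmetrizing in the two velocities, the derivative becomes

`-2 ∫ β r² (2 Δ ln F + |∇ ln F|²) Δ_σ F dσ dr dz`,

with `Δ` and `∇` in all six variables `(z, y)` (`IsTame.integral_fisherRate_eq`).

These `Δ` and `|∇|²` split into the directions `∂_z`, `r∂_r` and the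
rotations `L_k`, `Δ_σ = ∑ L_k²` (`termZ_add_termX_add_termL`). All these fields commute with `Δ_σ`.
For a field `V` commuting with `Δ_σ` and `a = V ln F`, the integrand
`(2 V² ln F + (V ln F)²) Δ_σ F` equals `2 V(a Δ_σ F) + (a² Δ_σ F - 2 a Δ_σ(a F))`
(`bracket_mul_lap`), and the last bracket integrates to `2 ∫ |∇_σ a|² F` over a sphere
(`integral_sphere_carre`). Hence:

* the `z`-directions have a favourable sign (`IsTame.slice_termZ_nonneg`);
* the rotations give exactly `2 ∫ Γ₂(ln F) F`, since `Γ₂` is the sum of the squares of all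
  `L_l L_k ln F` (`integral_sphere_bochner`, `Gamma2_eq`);
* in the radial direction an integration by parts moves the exact derivative onto `β`; the term
  with `β'` is absorbed by Young's inequality, and what is left is `((√β)')² |∇_σ ln F|² F r²`
  (`IsWeight.young`, `radial_le`). The boundary terms at `r = 0` vanish along suitable radii because
  `∫₀¹ r⁴ β dr` is finite.

Third derivatives of `ln F` are never estimated: they occur only in `Δ_σ (V F)`, a Schwartz
function. The symmetry `y ↦ -y` makes derivatives of `ln F` in `y` vanish at `y = 0`, which supplies
the four powers of `r` needed against the singularity of `β` (`IsTame.logF_bound`).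
-/

noncomputable section

namespace Landau

section

/-! ### Derivatives along vector fields -/

section Der

variable {H : Type*} [NormedAddCommGroup H] [NormedSpace ℝ H]

/-- The derivative `V G` of a function `G` along a vector field `V`. -/
def der (V : H → H) (G : H → ℝ) (p : H) : ℝ := fderiv ℝ G p (V p)

variable {V W : H → H} {G K : H → ℝ}

lemma contDiff_der (hV : ContDiff ℝ ∞ V) (hG : ContDiff ℝ ∞ G) : ContDiff ℝ ∞ (der V G) :=
  (hG.fderiv_right (m := ∞) (by simp)).clm_apply hV

lemma _root_.ContDiff.diffAt {E' F' : Type*} [NormedAddCommGroup E'] [NormedSpace ℝ E']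
    [NormedAddCommGroup F'] [NormedSpace ℝ F'] {G : E' → F'} (hG : ContDiff ℝ ∞ G) (p : E') :
    DifferentiableAt ℝ G p :=
  hG.contDiffAt.differentiableAt (by simp)

lemma der_mul (hG : ContDiff ℝ ∞ G) (hK : ContDiff ℝ ∞ K) :
    der V (fun p => G p * K p) = fun p => der V G p * K p + G p * der V K p := by
  funext p
  simp only [der]
  rw [fderiv_fun_mul (hG.diffAt p) (hK.diffAt p)]
  simp [smul_eq_mul]; ring

lemma der_sub (hG : ContDiff ℝ ∞ G) (hK : ContDiff ℝ ∞ K) :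
    der V (fun p => G p - K p) = fun p => der V G p - der V K p := by
  funext p
  simp only [der]
  rw [fderiv_fun_sub (hG.diffAt p) (hK.diffAt p)]
  simp

lemma der_sum {ι : Type*} (s : Finset ι) {G : ι → H → ℝ} (hG : ∀ i, ContDiff ℝ ∞ (G i)) :
    der V (fun p => ∑ i ∈ s, G i p) = fun p => ∑ i ∈ s, der V (G i) p := by
  funext p
  simp only [der]
  rw [fderiv_fun_sum (fun i _ => (hG i).diffAt p)]
  simp

lemma der_const_mul (c : ℝ) (hG : ContDiff ℝ ∞ G) :
    der V (fun p => c * G p) = fun p => c * der V G p := by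
  funext p
  simp only [der]
  rw [fderiv_const_mul (hG.diffAt p)]
  simp

lemma fderiv_der (hV : ContDiff ℝ ∞ V) (hG : ContDiff ℝ ∞ G) (p x : H) :
    fderiv ℝ (der V G) p x
      = fderiv ℝ (fderiv ℝ G) p x (V p) + fderiv ℝ G p (fderiv ℝ V p x) := by
  have h : HasFDerivAt (der V G) _ p :=
    ((hG.fderiv_right (m := ∞) (by simp)).diffAt p).hasFDerivAt.clm_apply (hV.diffAt p).hasFDerivAt
  rw [h.fderiv]
  simp [add_comm]

/-- The commutator of two vector fields, acting on functions, is their Lie bracket. -/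
lemma der_comm_apply (hV : ContDiff ℝ ∞ V) (hW : ContDiff ℝ ∞ W) (hG : ContDiff ℝ ∞ G) (p : H) :
    der V (der W G) p = der W (der V G) p
      + fderiv ℝ G p (fderiv ℝ W p (V p) - fderiv ℝ V p (W p)) := by
  have hs : IsSymmSndFDerivAt ℝ G p :=
    (hG.contDiffAt (x := p)).isSymmSndFDerivAt (by
      simpa using WithTop.coe_le_coe.2 (le_top : (2 : ℕ∞) ≤ ⊤))
  simp only [der.eq_1 V (der W G), der.eq_1 W (der V G), fderiv_der hV hG, fderiv_der hW hG,
    map_sub]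
  rw [hs.eq (V p) (W p)]
  ring

lemma der_comm (hV : ContDiff ℝ ∞ V) (hW : ContDiff ℝ ∞ W) (hG : ContDiff ℝ ∞ G)
    (h : ∀ p, fderiv ℝ W p (V p) = fderiv ℝ V p (W p)) :
    der V (der W G) = der W (der V G) := by
  funext p
  rw [der_comm_apply hV hW hG, h]
  simp

end Der

/-! ### Infinitesimal rotations of `ℝ³` -/

/-- The `j`-th vector of the standard basis. -/
abbrev bv (j : Fin 3) : E3 := EuclideanSpace.single j 1

/-- The generator `y ↦ e_k × y` of the rotations about the `k`-th axis. -/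
def J (k : Fin 3) : E3 →L[ℝ] E3 :=
  (EuclideanSpace.proj (k + 1) : E3 →L[ℝ] ℝ).smulRight (bv (k + 2))
    - (EuclideanSpace.proj (k + 2) : E3 →L[ℝ] ℝ).smulRight (bv (k + 1))

lemma J_apply (k : Fin 3) (y : E3) : J k y = y (k + 1) • bv (k + 2) - y (k + 2) • bv (k + 1) := by
  simp [J]

lemma E3_eq_sum (y : E3) : y = ∑ i, y i • bv i := by
  ext j; fin_cases j <;> simp [Fin.sum_univ_three]

lemma map_E3 (φ : E3 →L[ℝ] ℝ) (y : E3) : φ y = ∑ i, y i * φ (bv i) := by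
  conv_lhs => rw [E3_eq_sum y]
  simp [map_sum]

lemma map_J (φ : E3 →L[ℝ] ℝ) (k : Fin 3) (y : E3) :
    φ (J k y) = y (k + 1) * φ (bv (k + 2)) - y (k + 2) * φ (bv (k + 1)) := by
  simp [J_apply]

lemma normSq_E3 (y : E3) : ‖y‖ ^ 2 = ∑ i, y i ^ 2 := by
  simp [EuclideanSpace.norm_sq_eq]

lemma inner_E3 (x y : E3) : inner ℝ x y = ∑ i, x i * y i := by
  simp [PiLp.inner_apply, mul_comm]

lemma inner_J (k : Fin 3) (y : E3) : inner ℝ y (J k y) = 0 := by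
  rw [inner_E3, J_apply]
  fin_cases k <;> simp [Fin.sum_univ_three] <;> ring

lemma sum_map_J_sq (φ : E3 →L[ℝ] ℝ) (y : E3) :
    ∑ k, φ (J k y) ^ 2 = ‖y‖ ^ 2 * (∑ i, φ (bv i) ^ 2) - φ y ^ 2 := by
  rw [map_E3 φ y, normSq_E3]
  simp only [map_J, Fin.sum_univ_three, Fin.reduceAdd, Fin.isValue, zero_add]
  ring

lemma map₂_E3 (B : E3 →L[ℝ] E3 →L[ℝ] ℝ) (x y : E3) :
    B x y = ∑ i, ∑ j, x i * y j * B (bv i) (bv j) := by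
  conv_lhs => rw [E3_eq_sum x, E3_eq_sum y]
  simp only [Fin.sum_univ_three, map_add, map_smul, add_apply, smul_apply, smul_eq_mul]
  ring

lemma sum_map₂_J (B : E3 →L[ℝ] E3 →L[ℝ] ℝ) (y : E3) :
    ∑ k, B (J k y) (J k y) = ‖y‖ ^ 2 * (∑ i, B (bv i) (bv i)) - B y y := by
  rw [map₂_E3 B y y, normSq_E3]
  simp only [J_apply, map_sub, map_smul, sub_apply,
    smul_apply, smul_eq_mul, Fin.sum_univ_three, Fin.reduceAdd, Fin.isValue,
    zero_add]
  ring

lemma J_J (k l : Fin 3) (y : E3) :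
    J k (J l y) = y k • bv l - (if k = l then (1 : ℝ) else 0) • y := by
  rw [J_apply, J_apply]
  fin_cases k <;> fin_cases l <;> ext j <;> fin_cases j <;> simp

lemma sum_J_J (y : E3) : ∑ k, J k (J k y) = (-2 : ℝ) • y := by
  simp only [J_J, if_true]
  rw [Finset.sum_sub_distrib, ← E3_eq_sum]
  simp only [Finset.sum_const, Finset.card_univ, Fintype.card_fin]
  module

/-! ### The vector fields on pairs -/

/-- Pairs `(z, y)`, standing for the pair of velocities `v = z + y`, `w = z - y`. -/
abbrev PS : Type := E3 × E3

/-- The constant field `∂_{z_i}`. -/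
def fZ (i : Fin 3) : PS → PS := fun _ => (bv i, 0)
/-- The rotation field `(e_k × y)·∂_y`. -/
def fL (k : Fin 3) : PS → PS := fun p => (0, J k p.2)
/-- The Euler field `y·∂_y`, which is `r ∂_r` in polar coordinates `y = rσ`. -/
def fX : PS → PS := fun p => (0, p.2)

lemma contDiff_fZ (i : Fin 3) : ContDiff ℝ ∞ (fZ i) := contDiff_const
lemma contDiff_fL (k : Fin 3) : ContDiff ℝ ∞ (fL k) :=
  contDiff_const.prodMk ((J k).contDiff.comp contDiff_snd)
lemma contDiff_fX : ContDiff ℝ ∞ fX := contDiff_const.prodMk contDiff_snd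

lemma fderiv_fZ (i : Fin 3) (p x : PS) : fderiv ℝ (fZ i) p x = 0 := by
  have h : HasFDerivAt (fZ i) (0 : PS →L[ℝ] PS) p := hasFDerivAt_const _ _
  rw [h.fderiv]; rfl
lemma fderiv_fL (k : Fin 3) (p x : PS) : fderiv ℝ (fL k) p x = (0, J k x.2) := by
  have h : HasFDerivAt (fL k)
      ((0 : PS →L[ℝ] E3).prod ((J k).comp (ContinuousLinearMap.snd ℝ E3 E3))) p :=
    (hasFDerivAt_const _ _).prodMk ((J k).hasFDerivAt.comp p hasFDerivAt_snd)
  rw [h.fderiv]; simp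
lemma fderiv_fX (p x : PS) : fderiv ℝ fX p x = (0, x.2) := by
  have h : HasFDerivAt fX ((0 : PS →L[ℝ] E3).prod (ContinuousLinearMap.snd ℝ E3 E3)) p :=
    (hasFDerivAt_const _ _).prodMk hasFDerivAt_snd
  rw [h.fderiv]; simp

/-- The spherical Laplacian in the variable `y`, as the sum of the squares of the rotations. -/
def lap (G : PS → ℝ) (p : PS) : ℝ := ∑ k, der (fL k) (der (fL k) G) p

variable {G : PS → ℝ}

lemma contDiff_lap (hG : ContDiff ℝ ∞ G) : ContDiff ℝ ∞ (lap G) :=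
  ContDiff.sum fun k _ => contDiff_der (contDiff_fL k) (contDiff_der (contDiff_fL k) hG)

lemma der_lap_of_comm {V : PS → PS} (hV : ContDiff ℝ ∞ V) (hG : ContDiff ℝ ∞ G)
    (h : ∀ k p, fderiv ℝ (fL k) p (V p) = fderiv ℝ V p (fL k p)) :
    der V (lap G) = lap (der V G) := by
  have h1 : der V (lap G) = fun p => ∑ k, der V (der (fL k) (der (fL k) G)) p :=
    der_sum _ fun k => contDiff_der (contDiff_fL k) (contDiff_der (contDiff_fL k) hG)
  rw [h1]
  funext p
  refine Finset.sum_congr rfl fun k _ => ?_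
  rw [der_comm hV (contDiff_fL k) (contDiff_der (contDiff_fL k) hG) (h k),
    der_comm hV (contDiff_fL k) hG (h k)]

lemma der_fZ_lap (i : Fin 3) (hG : ContDiff ℝ ∞ G) : der (fZ i) (lap G) = lap (der (fZ i) G) :=
  der_lap_of_comm (contDiff_fZ i) hG fun k p => by
    rw [fderiv_fL, fderiv_fZ]; simp [fZ]

lemma der_fX_lap (hG : ContDiff ℝ ∞ G) : der fX (lap G) = lap (der fX G) :=
  der_lap_of_comm contDiff_fX hG fun k p => by
    rw [fderiv_fL, fderiv_fX]; simp [fX, fL]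

/-- `[L_l, L_k]`, written with the generators; it is again a rotation or zero. -/
lemma der_fL_comm (l k : Fin 3) (hG : ContDiff ℝ ∞ G) (p : PS) :
    der (fL l) (der (fL k) G) p = der (fL k) (der (fL l) G) p
      + p.2 k * fderiv ℝ G p (0, bv l) - p.2 l * fderiv ℝ G p (0, bv k) := by
  rw [der_comm_apply (contDiff_fL l) (contDiff_fL k) hG, fderiv_fL, fderiv_fL]
  have : ((0, J k (fL l p).2) - (0, J l (fL k p).2) : PS)
      = p.2 k • (0, bv l) - p.2 l • (0, bv k) := by
    simp only [fL, J_J, eq_comm (a := l)]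
    ext1 <;> simp
  rw [this, map_sub, map_smul, map_smul, smul_eq_mul, smul_eq_mul]
  ring

lemma der_fL_apply (k : Fin 3) (p : PS) :
    der (fL k) G p = p.2 (k + 1) * fderiv ℝ G p (0, bv (k + 2))
      - p.2 (k + 2) * fderiv ℝ G p (0, bv (k + 1)) := by
  have : fL k p = p.2 (k + 1) • (0, bv (k + 2)) - p.2 (k + 2) • (0, bv (k + 1)) := by
    simp only [fL, J_apply]
    ext1 <;> simp
  rw [der, this, map_sub, map_smul, map_smul, smul_eq_mul, smul_eq_mul]

lemma der_fL_bracket (l : Fin 3) (hG : ContDiff ℝ ∞ G) :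
    der (fL (l + 1)) (der (fL (l + 2)) G)
      = fun p => der (fL (l + 2)) (der (fL (l + 1)) G) p - der (fL l) G p := by
  funext p
  rw [der_fL_comm _ _ hG, der_fL_apply l]; ring

lemma der_fL_lap (l : Fin 3) (hG : ContDiff ℝ ∞ G) : der (fL l) (lap G) = lap (der (fL l) G) := by
  have h1 : der (fL l) (lap G) = fun p => ∑ k, der (fL l) (der (fL k) (der (fL k) G)) p :=
    der_sum _ fun k => contDiff_der (contDiff_fL k) (contDiff_der (contDiff_fL k) hG)
  rw [h1]
  funext p
  simp only [lap]
  -- `[L_l, L_k²] = [L_l, L_k] L_k + L_k [L_l, L_k]`, and these cancel in the sum over `k`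
  have hc : ∀ k, ContDiff ℝ ∞ (der (fL k) G) := fun k => contDiff_der (contDiff_fL k) hG
  have hcc : ∀ k m, ContDiff ℝ ∞ (der (fL k) (der (fL m) G)) :=
    fun k m => contDiff_der (contDiff_fL k) (hc m)
  have b : ∀ (K : PS → ℝ), ContDiff ℝ ∞ K → ∀ q,
      der (fL 1) (der (fL 2) K) q = der (fL 2) (der (fL 1) K) q - der (fL 0) K q ∧
      der (fL 2) (der (fL 0) K) q = der (fL 0) (der (fL 2) K) q - der (fL 1) K q ∧
      der (fL 0) (der (fL 1) K) q = der (fL 1) (der (fL 0) K) q - der (fL 2) K q := by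
    intro K hK q
    exact ⟨congrFun (der_fL_bracket 0 hK) q, congrFun (der_fL_bracket 1 hK) q,
      congrFun (der_fL_bracket 2 hK) q⟩
  have e12 : der (fL 1) (der (fL 2) G) = fun q => der (fL 2) (der (fL 1) G) q - der (fL 0) G q :=
    der_fL_bracket 0 hG
  have e20 : der (fL 2) (der (fL 0) G) = fun q => der (fL 0) (der (fL 2) G) q - der (fL 1) G q :=
    der_fL_bracket 1 hG
  have e01 : der (fL 0) (der (fL 1) G) = fun q => der (fL 1) (der (fL 0) G) q - der (fL 2) G q :=
    der_fL_bracket 2 hG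
  have d12 := fun V => der_sub (V := V) (hcc 2 1) (hc 0)
  have d20 := fun V => der_sub (V := V) (hcc 0 2) (hc 1)
  have d01 := fun V => der_sub (V := V) (hcc 1 0) (hc 2)
  simp only [Fin.sum_univ_three]
  obtain rfl | rfl | rfl : l = 0 ∨ l = 1 ∨ l = 2 := by fin_cases l <;> simp
  · have a1 := (b _ (hc 1) p).2.2
    have a2 := (b _ (hc 2) p).2.1
    have a3 := congrFun (d01 (fL 1)) p
    have a4 := congrFun (d20 (fL 2)) p
    rw [← e01] at a3; rw [← e20] at a4
    have a5 := (b _ hG p).1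
    linarith
  · have a1 := (b _ (hc 2) p).1
    have a2 := (b _ (hc 0) p).2.2
    have a3 := congrFun (d12 (fL 2)) p
    have a4 := congrFun (d01 (fL 0)) p
    rw [← e12] at a3; rw [← e01] at a4
    have a5 := (b _ hG p).2.1
    linarith
  · have a1 := (b _ (hc 0) p).2.1
    have a2 := (b _ (hc 1) p).1
    have a3 := congrFun (d20 (fL 0)) p
    have a4 := congrFun (d12 (fL 1)) p
    rw [← e20] at a3; rw [← e12] at a4
    have a5 := (b _ hG p).2.2
    linarith

end

section

/-! ### Polar coordinates -/

/-- The measure `dr dσ` on `(0,∞) × S²`. -/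
def polarMeasure : Measure (ℝ × S2) :=
  ((volume : Measure ℝ).restrict (Ioi 0)).prod (volume : Measure E3).toSphere

instance : SFinite polarMeasure := by unfold polarMeasure; infer_instance

lemma map_val_volumeIoiPow :
    Measure.map Subtype.val (Measure.volumeIoiPow 2)
      = ((volume : Measure ℝ).restrict (Ioi 0)).withDensity fun r => ENNReal.ofReal (r ^ 2) := by
  ext s hs
  rw [Measure.map_apply measurable_subtype_coe hs, Measure.volumeIoiPow,
    withDensity_apply _ (measurable_subtype_coe hs), withDensity_apply _ hs,
    Measure.restrict_restrict hs,
    setLIntegral_subtype measurableSet_Ioi _ fun a : ℝ ↦ ENNReal.ofReal (a ^ 2),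
    Subtype.image_preimage_coe, Set.inter_comm]

/-- Lebesgue measure is `r² dr dσ` in polar coordinates. -/
lemma map_polar :
    Measure.map (fun q : ℝ × S2 => q.1 • (q.2 : E3))
      (polarMeasure.withDensity fun q => ENNReal.ofReal (q.1 ^ 2)) = volume := by
  have hpos : (0 : ℝ) ≤ 1 := zero_le_one
  have h1 := (volume : Measure E3).measurePreserving_homeomorphUnitSphereProd
  have hdim : Module.finrank ℝ E3 - 1 = 2 := by simp
  rw [hdim] at h1
  have h2 : Measure.map (fun q : S2 × Ioi (0 : ℝ) => (q.2 : ℝ) • (q.1 : E3))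
      ((volume : Measure E3).toSphere.prod (Measure.volumeIoiPow 2)) = volume := by
    have h3 : MeasurePreserving (homeomorphUnitSphereProd E3).symm
        ((volume : Measure E3).toSphere.prod (Measure.volumeIoiPow 2))
        ((volume : Measure E3).comap (↑)) :=
      MeasurePreserving.symm (homeomorphUnitSphereProd E3).toMeasurableEquiv h1
    have h4 : Measure.map (Subtype.val : ({0}ᶜ : Set E3) → E3) ((volume : Measure E3).comap (↑))
        = volume := by
      rw [map_comap_subtype_coe (measurableSet_singleton _).compl,
        restrict_compl_singleton]
    rw [← h3.map_eq, Measure.map_map measurable_subtype_coe h3.measurable] at h4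
    exact h4
  have h5 : Measure.map (fun q : S2 × Ioi (0 : ℝ) => ((q.2 : ℝ), q.1))
      ((volume : Measure E3).toSphere.prod (Measure.volumeIoiPow 2))
      = polarMeasure.withDensity fun q => ENNReal.ofReal (q.1 ^ 2) := by
    have h6 : (fun q : S2 × Ioi (0 : ℝ) => ((q.2 : ℝ), q.1))
        = Prod.map Subtype.val id ∘ Prod.swap := rfl
    rw [h6, ← Measure.map_map (measurable_subtype_coe.prodMap measurable_id) measurable_swap,
      Measure.prod_swap, ← Measure.map_prod_map _ _ measurable_subtype_coe measurable_id,
      map_val_volumeIoiPow, Measure.map_id, polarMeasure,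
      prod_withDensity_left (by fun_prop)]
  rw [← h5, Measure.map_map (by fun_prop) (by fun_prop)]
  exact h2

/-- Lebesgue measure on pairs is `r² dz dr dσ` in the coordinates `(z, r, σ)`. -/
lemma map_polar_prod :
    Measure.map (fun q : E3 × ℝ × S2 => (q.1, q.2.1 • (q.2.2 : E3)))
      (coordMeasure.withDensity fun q => ENNReal.ofReal (q.2.1 ^ 2))
      = (volume : Measure PS) := by
  have h : coordMeasure.withDensity (fun q => ENNReal.ofReal (q.2.1 ^ 2))
      = (volume : Measure E3).prod
        (polarMeasure.withDensity fun q => ENNReal.ofReal (q.1 ^ 2)) := by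
    rw [prod_withDensity_right (by fun_prop)]
    rfl
  have h2 : (fun q : E3 × ℝ × S2 => (q.1, q.2.1 • (q.2.2 : E3)))
      = Prod.map id (fun q : ℝ × S2 => q.1 • (q.2 : E3)) := rfl
  have hm : Measurable (fun q : ℝ × S2 => q.1 • (q.2 : E3)) := by fun_prop
  have : SFinite (polarMeasure.withDensity fun q => ENNReal.ofReal (q.1 ^ 2)) := inferInstance
  rw [h, h2, ← Measure.map_prod_map _ _ measurable_id hm, map_polar, Measure.map_id]
  rfl

lemma integral_polar (g : E3 → ℝ) (hg : AEStronglyMeasurable g volume) :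
    ∫ y, g y = ∫ q, q.1 ^ 2 * g (q.1 • (q.2 : E3)) ∂polarMeasure := by
  conv_lhs => rw [← map_polar]
  rw [integral_map (by fun_prop) (by rwa [map_polar])]
  have : (fun q : ℝ × S2 => ENNReal.ofReal (q.1 ^ 2)) = fun q => ((q.1 ^ 2).toNNReal : ℝ≥0∞) := rfl
  rw [this, integral_withDensity_eq_integral_smul (by fun_prop)]
  refine integral_congr_ae (Filter.Eventually.of_forall fun q => ?_)
  simp only [NNReal.smul_def, smul_eq_mul]
  rw [Real.coe_toNNReal _ (sq_nonneg _)]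

lemma integral_polar_prod (g : PS → ℝ) (hg : AEStronglyMeasurable g volume) :
    ∫ p, g p = ∫ q, q.2.1 ^ 2 * g (q.1, q.2.1 • (q.2.2 : E3)) ∂coordMeasure := by
  conv_lhs => rw [← map_polar_prod]
  rw [integral_map (by fun_prop) (by rwa [map_polar_prod])]
  have : (fun q : E3 × ℝ × S2 => ENNReal.ofReal (q.2.1 ^ 2))
    = fun q => ((q.2.1 ^ 2).toNNReal : ℝ≥0∞) := rfl
  rw [this, integral_withDensity_eq_integral_smul (by fun_prop)]
  refine integral_congr_ae (Filter.Eventually.of_forall fun q => ?_)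
  simp only [NNReal.smul_def, smul_eq_mul]
  rw [Real.coe_toNNReal _ (sq_nonneg _)]

/-! ### Integration by parts on spheres -/

lemma fderiv_norm_J (k : Fin 3) {x : E3} (hx : x ≠ 0) :
    fderiv ℝ (fun y : E3 => ‖y‖) x (J k x) = 0 := by
  have hd : DifferentiableAt ℝ (fun y : E3 => ‖y‖) x :=
    (contDiffAt_norm ℝ hx (n := 1)).differentiableAt (by simp)
  have h1 : fderiv ℝ (fun y : E3 => ‖y‖ ^ 2) x (J k x) = 0 := by
    rw [(hasStrictFDerivAt_norm_sq x).hasFDerivAt.fderiv]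
    simp [inner_J]
  rw [fderiv_fun_pow 2 hd] at h1
  simp only [Nat.add_one_sub_one, pow_one, smul_apply, smul_eq_mul, nsmul_eq_mul] at h1
  have : ‖x‖ ≠ 0 := norm_ne_zero_iff.2 hx
  simpa [this] using h1

/-- The map `y ↦ r y / |y|` commutes with infinitesimal rotations. -/
lemma differentiableAt_radial (r : ℝ) {x : E3} (hx : x ≠ 0) :
    DifferentiableAt ℝ (fun y : E3 => (r * ‖y‖⁻¹) • y) x ∧ ∀ k,
    fderiv ℝ (fun y : E3 => (r * ‖y‖⁻¹) • y) x (J k x) = J k ((r * ‖x‖⁻¹) • x) := by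
  have hd : DifferentiableAt ℝ (fun y : E3 => ‖y‖) x :=
    (contDiffAt_norm ℝ hx (n := 1)).differentiableAt (by simp)
  have hn : ‖x‖ ≠ 0 := norm_ne_zero_iff.2 hx
  have hd2 : DifferentiableAt ℝ (fun y : E3 => r * ‖y‖⁻¹) x := (hd.inv hn).const_mul r
  refine ⟨hd2.smul differentiableAt_id, fun k => ?_⟩
  have h3 : fderiv ℝ (fun y : E3 => r * ‖y‖⁻¹) x (J k x) = 0 := by
    have := (((hasDerivAt_inv hn).comp_hasFDerivAt x hd.hasFDerivAt).const_mul r).fderiv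
    simp only [Function.comp_def] at this
    rw [this]
    simp [fderiv_norm_J k hx]
  rw [fderiv_fun_smul hd2 differentiableAt_fun_id]
  simp [h3]

/-- Extending a function on a sphere along rays commutes with rotations. -/
lemma fderiv_comp_radial {g : E3 → ℝ} (hg : ContDiff ℝ ∞ g) (r : ℝ) {x : E3} (hx : x ≠ 0)
    (k : Fin 3) :
    fderiv ℝ (fun y => g ((r * ‖y‖⁻¹) • y)) x (J k x)
      = fderiv ℝ g ((r * ‖x‖⁻¹) • x) (J k ((r * ‖x‖⁻¹) • x)) := by
  obtain ⟨h1, h2⟩ := differentiableAt_radial r hx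
  have := fderiv_comp (g := g) x (hg.diffAt _) h1
  rw [Function.comp_def] at this
  rw [this, ContinuousLinearMap.comp_apply, h2]

/-- Rotations have zero average over space. -/
lemma integral_fderiv_J_eq_zero {G : E3 → ℝ} (hG : ContDiff ℝ 1 G) (hs : HasCompactSupport G)
    (k : Fin 3) : ∫ y, fderiv ℝ G y (J k y) = 0 := by
  have hc : Continuous (fun y => fderiv ℝ G y) := hG.continuous_fderiv (by simp)
  have hI : ∀ (a b : Fin 3), Integrable (fun y : E3 => y a * fderiv ℝ G y (bv b)) := fun a b => by
    refine Continuous.integrable_of_hasCompactSupport (by fun_prop) ?_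
    exact (hs.fderiv_apply (𝕜 := ℝ) (bv b)).mul_left
  have h0 : ∀ a b : Fin 3, a ≠ b → ∫ y : E3, y a * fderiv ℝ G y (bv b) = 0 := fun a b hab => by
    have hfd : ∀ y, fderiv ℝ (fun y : E3 => y a) y = (EuclideanSpace.proj a : E3 →L[ℝ] ℝ) :=
      fun y => (EuclideanSpace.proj a : E3 →L[ℝ] ℝ).hasFDerivAt.fderiv
    have := integral_mul_fderiv_eq_neg_fderiv_mul_of_integrable (μ := (volume : Measure E3))
      (f := fun y : E3 => y a) (g := G) (v := bv b) ?_ (hI a b) ?_ ?_ ?_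
    · rw [this]; simp [hfd, hab]
    · simp [hfd, hab]
    · exact Continuous.integrable_of_hasCompactSupport (by fun_prop) hs.mul_left
    · intro x _
      exact (EuclideanSpace.proj a : E3 →L[ℝ] ℝ).differentiableAt
    · intro x _
      exact hG.differentiable (by simp) x
  simp only [map_J]
  rw [integral_sub (hI _ _) (hI _ _), h0 _ _ (by fin_cases k <;> decide),
    h0 _ _ (by fin_cases k <;> decide), sub_zero]

/-- Rotations have zero average over each sphere. -/
lemma integral_sphere_fderiv_J {g : E3 → ℝ} (hg : ContDiff ℝ ∞ g) (r : ℝ) (k : Fin 3) :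
    ∫ σ : S2, fderiv ℝ g (r • (σ : E3)) (J k (r • (σ : E3))) ∂(volume : Measure E3).toSphere
      = 0 := by
  -- apply the identity in space to `χ(|y|) g(r y/|y|)` with a bump function `χ`
  let χ : ContDiffBump (2 : ℝ) := ⟨1/2, 1, by norm_num, by norm_num⟩
  let m : E3 → ℝ := fun y => fderiv ℝ g y (J k y)
  let G : E3 → ℝ := fun y => χ ‖y‖ * g ((r * ‖y‖⁻¹) • y)
  have hχ0 : ∀ s : ℝ, s ≤ 1 → χ s = 0 := fun s hs => by
    apply χ.zero_of_le_dist
    change (1 : ℝ) ≤ _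
    rw [Real.dist_eq, abs_of_nonpos] <;> linarith
  have hnear : ∀ᶠ y in nhds (0 : E3), ‖y‖ < 1 :=
    (continuous_norm.tendsto' (0 : E3) 0 (by simp)).eventually (gt_mem_nhds one_pos)
  have hG0 : G =ᶠ[nhds 0] fun _ => 0 := hnear.mono fun y hy => by simp [G, hχ0 _ hy.le]
  have hGs : ContDiff ℝ 1 G := by
    rw [contDiff_iff_contDiffAt]
    intro x
    by_cases hx : x = 0
    · subst hx; exact contDiffAt_const.congr_of_eventuallyEq hG0
    · have hN : ContDiffAt ℝ 1 (fun y : E3 => ‖y‖) x := contDiffAt_norm ℝ hx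
      have h1 : ContDiffAt ℝ 1 (fun y : E3 => (r * ‖y‖⁻¹) • y) x :=
        (contDiffAt_const.mul (hN.inv (norm_ne_zero_iff.2 hx))).smul contDiffAt_id
      exact (χ.contDiff.contDiffAt.comp x hN).mul
        ((hg.of_le (by simp)).contDiffAt.comp x h1)
  have hcs : HasCompactSupport G := by
    refine HasCompactSupport.intro (isCompact_closedBall (0 : E3) 3) fun y hy => ?_
    have : χ ‖y‖ = 0 := by
      apply χ.zero_of_le_dist
      change (1 : ℝ) ≤ _
      simp only [Metric.mem_closedBall, dist_zero_right, not_le] at hy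
      rw [Real.dist_eq, abs_of_nonneg] <;> linarith
    simp [G, this]
  have hder : ∀ y, fderiv ℝ G y (J k y) = χ ‖y‖ * m ((r * ‖y‖⁻¹) • y) := by
    intro y
    by_cases hy : y = 0
    · subst hy; rw [hG0.fderiv_eq]; simp [hχ0]
    · have hN : DifferentiableAt ℝ (fun y : E3 => ‖y‖) y :=
        (contDiffAt_norm ℝ hy (n := 1)).differentiableAt (by simp)
      have hχd : DifferentiableAt ℝ χ ‖y‖ := (χ.contDiff (n := 1)).differentiable (by simp) _
      have h1 : DifferentiableAt ℝ (fun y : E3 => χ ‖y‖) y := hχd.comp y hN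
      have h2 : DifferentiableAt ℝ (fun y : E3 => g ((r * ‖y‖⁻¹) • y)) y :=
        (hg.diffAt _).comp y (differentiableAt_radial r hy).1
      have h3 : fderiv ℝ (fun y : E3 => χ ‖y‖) y (J k y) = 0 := by
        have := fderiv_comp (g := χ) y hχd hN
        rw [Function.comp_def] at this
        rw [this, ContinuousLinearMap.comp_apply, fderiv_norm_J k hy, map_zero]
      simp only [G]
      rw [fderiv_fun_mul h1 h2]
      simp only [add_apply, smul_apply, smul_eq_mul, h3, mul_zero, add_zero,
        fderiv_comp_radial hg r hy]
      rfl
  have hmc : Continuous m := by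
    have := (hg.fderiv_right (m := ∞) (by simp)).continuous
    fun_prop
  have key := integral_fderiv_J_eq_zero hGs hcs k
  rw [integral_polar _ (by
    have := hGs.continuous_fderiv (by simp)
    exact (by fun_prop : Continuous fun y => fderiv ℝ G y (J k y)).aestronglyMeasurable)] at key
  simp only [hder] at key
  have h1 : ∫ q, q.1 ^ 2 * (χ ‖q.1 • (q.2 : E3)‖
        * m ((r * ‖q.1 • (q.2 : E3)‖⁻¹) • q.1 • (q.2 : E3))) ∂polarMeasure
      = ∫ q, (q.1 ^ 2 * χ q.1) * m (r • (q.2 : E3)) ∂polarMeasure := by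
    have hpm : polarMeasure = ((volume : Measure ℝ).prod (volume : Measure E3).toSphere).restrict
        (Ioi 0 ×ˢ univ) := by
      rw [← Measure.prod_restrict, Measure.restrict_univ]; rfl
    rw [hpm]
    refine setIntegral_congr_fun (measurableSet_Ioi.prod MeasurableSet.univ) fun q hq => ?_
    have hq1 : 0 < q.1 := hq.1
    have hn : ‖q.1 • (q.2 : E3)‖ = q.1 := by simp [norm_smul, abs_of_pos hq1]
    simp only [hn, smul_smul, mul_assoc, inv_mul_cancel₀ hq1.ne', mul_one]
  rw [h1, polarMeasure, integral_prod_mul (fun s : ℝ => s ^ 2 * χ s)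
    (fun σ : S2 => m (r • (σ : E3)))] at key
  refine (mul_eq_zero.1 key).resolve_left (ne_of_gt ?_)
  have hcont : Continuous (fun s : ℝ => s ^ 2 * χ s) := by
    have := (χ.contDiff (n := 0)).continuous
    fun_prop
  rw [setIntegral_eq_integral_of_forall_compl_eq_zero fun s hs => by
    rw [hχ0 s (by simp at hs; linarith), mul_zero]]
  refine hcont.integral_pos_of_hasCompactSupport_nonneg_nonzero (x := 2) ?_ ?_ ?_
  · exact χ.hasCompactSupport.mul_left
  · intro s; exact mul_nonneg (sq_nonneg _) χ.nonneg
  · rw [χ.one_of_mem_closedBall (by simp [χ])]; norm_num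

end

section

/-! ### Rotation derivatives on spheres -/

/-- The surface measure of the unit sphere. -/
abbrev sphereMeasure : Measure S2 := (volume : Measure E3).toSphere

lemma integrable_sphere {g : S2 → ℝ} (hg : Continuous g) : Integrable g sphereMeasure :=
  hg.integrable_of_hasCompactSupport (HasCompactSupport.of_compactSpace g)

lemma continuous_slice {G : PS → ℝ} (hG : Continuous G) (z : E3) (r : ℝ) :
    Continuous fun σ : S2 => G (z, r • (σ : E3)) := by fun_prop

/-- The derivative of `U` along the rotation about the `k`-th axis. -/
abbrev rot (k : Fin 3) (U : E3 → ℝ) : E3 → ℝ := der (fun y => J k y) U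

/-- Rotation derivatives in the variable `y` with `z` frozen. -/
lemma rot_slice {G : PS → ℝ} (hG : ContDiff ℝ ∞ G) (z : E3) (k : Fin 3) :
    rot k (fun y => G (z, y)) = fun y => der (fL k) G (z, y) := by
  funext y
  have h : HasFDerivAt (fun y => G (z, y))
      ((fderiv ℝ G (z, y)).comp ((0 : E3 →L[ℝ] E3).prod (ContinuousLinearMap.id ℝ E3))) y :=
    (hG.diffAt _).hasFDerivAt.comp _ ((hasFDerivAt_const _ _).prodMk (hasFDerivAt_id _))
  simp only [rot, der, h.fderiv]
  rfl

section

variable {G a F u : PS → ℝ}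

lemma integral_sphere_der_fL (hG : ContDiff ℝ ∞ G) (z : E3) (r : ℝ) (k : Fin 3) :
    ∫ σ : S2, der (fL k) G (z, r • (σ : E3)) ∂sphereMeasure = 0 := by
  have hg : ContDiff ℝ ∞ (fun y => G (z, y)) := hG.comp (contDiff_const.prodMk contDiff_id)
  rw [← integral_sphere_fderiv_J hg r k]
  exact integral_congr_ae (Filter.Eventually.of_forall fun σ =>
    (congrFun (rot_slice hG z k) (r • (σ : E3))).symm)

/-- `∫ (a² Δ_σ F - 2 a Δ_σ(a F)) = 2 ∫ |∇_σ a|² F` over a sphere: the integration by parts applied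
with `a = V ln F` for each direction `V` commuting with `Δ_σ`. -/
lemma integral_sphere_carre (ha : ContDiff ℝ ∞ a) (hF : ContDiff ℝ ∞ F) (z : E3) (r : ℝ) :
    ∫ σ : S2, (fun p => a p ^ 2 * lap F p - 2 * a p * lap (fun q => a q * F q) p)
        (z, r • (σ : E3)) ∂sphereMeasure
      = 2 * ∫ σ : S2, (fun p => F p * ∑ k, der (fL k) a p ^ 2) (z, r • (σ : E3))
          ∂sphereMeasure := by
  have haF := ha.mul hF
  have c1 := fun k => contDiff_der (contDiff_fL k) ha
  have c2 := fun k => contDiff_der (contDiff_fL k) hF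
  have c3 := fun k => contDiff_der (contDiff_fL k) haF
  let K : Fin 3 → PS → ℝ := fun k p =>
    (a p * a p) * der (fL k) F p - 2 * (a p * der (fL k) (fun q => a q * F q) p)
  have hK : ∀ k, ContDiff ℝ ∞ (K k) := fun k =>
    ((ha.mul ha).mul (c2 k)).sub (contDiff_const.mul (ha.mul (c3 k)))
  have hpt : ∀ p, a p ^ 2 * lap F p - 2 * a p * lap (fun q => a q * F q) p
      = (∑ k, der (fL k) (K k) p) + 2 * (F p * ∑ k, der (fL k) a p ^ 2) := by
    intro p
    simp only [lap, Finset.mul_sum, ← Finset.sum_sub_distrib, ← Finset.sum_add_distrib]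
    refine Finset.sum_congr rfl fun k _ => ?_
    simp only [K]
    rw [der_sub ((ha.mul ha).mul (c2 k)) (contDiff_const.mul (ha.mul (c3 k))),
      der_mul (ha.mul ha) (c2 k), der_mul ha ha, der_const_mul 2 (ha.mul (c3 k)),
      der_mul ha (c3 k)]
    simp only
    rw [congrFun (der_mul (V := fL k) ha hF) p]
    ring
  have hcs : ∀ k, Continuous (der (fL k) (K k)) := fun k =>
    (contDiff_der (contDiff_fL k) (hK k)).continuous
  simp only [hpt]
  rw [integral_add, integral_finsetSum, integral_const_mul]
  · simp [integral_sphere_der_fL (hK _)]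
  · exact fun k _ => integrable_sphere (continuous_slice (hcs k) z r)
  · exact integrable_finsetSum _ fun k _ => integrable_sphere (continuous_slice (hcs k) z r)
  · have h1 := ha.continuous
    have h2 := hF.continuous
    have h3 := fun k => (c1 k).continuous
    exact integrable_sphere (continuous_slice
      (G := fun p => 2 * (F p * ∑ k, der (fL k) a p ^ 2)) (by fun_prop) z r)

lemma der_exp {V : PS → PS} (hu : ContDiff ℝ ∞ u) :
    der V (fun p => Real.exp (u p)) = fun p => der V u p * Real.exp (u p) := by
  funext p
  simp only [der]
  rw [fderiv_exp (hu.diffAt p)]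
  simp; ring

lemma lap_exp (hu : ContDiff ℝ ∞ u) (p : PS) :
    lap (fun q => Real.exp (u q)) p
      = Real.exp (u p) * ∑ k, (der (fL k) (der (fL k) u) p + der (fL k) u p ^ 2) := by
  simp only [lap, Finset.mul_sum]
  refine Finset.sum_congr rfl fun k _ => ?_
  rw [der_exp hu, der_mul (contDiff_der (contDiff_fL k) hu) hu.exp, der_exp hu]
  ring

/-- For a direction `V` commuting with the spherical Laplacian, the integrand of the derivative of
the Fisher information in that direction is, up to an exact `V`-derivative, the integrand of
`integral_sphere_carre`. -/
lemma bracket_mul_lap {V : PS → PS} (hV : ContDiff ℝ ∞ V) (hu : ContDiff ℝ ∞ u)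
    (hc : der V (lap fun q => Real.exp (u q)) = lap (der V fun q => Real.exp (u q))) (p : PS) :
    (2 * der V (der V u) p + der V u p ^ 2) * lap (fun q => Real.exp (u q)) p
      = 2 * der V (fun q => der V u q * lap (fun q => Real.exp (u q)) q) p
        + (der V u p ^ 2 * lap (fun q => Real.exp (u q)) p
          - 2 * der V u p * lap (fun q => der V u q * Real.exp (u q)) p) := by
  rw [der_mul (contDiff_der hV hu) (contDiff_lap hu.exp), hc, der_exp hu]
  ring

/-- The Bochner identity on a sphere: for `F = exp u`,
`∫ (2 Δu + |∇u|²) ΔF = 2 ∫ Γ₂(u) F`, with `Γ₂` written through rotations. -/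
lemma integral_sphere_bochner (hu : ContDiff ℝ ∞ u) (z : E3) (r : ℝ) :
    ∫ σ : S2, (fun p => (∑ l, (2 * der (fL l) (der (fL l) u) p + der (fL l) u p ^ 2))
        * lap (fun q => Real.exp (u q)) p) (z, r • (σ : E3)) ∂sphereMeasure
      = 2 * ∫ σ : S2, (fun p => Real.exp (u p) * ∑ l, ∑ k, der (fL k) (der (fL l) u) p ^ 2)
        (z, r • (σ : E3)) ∂sphereMeasure := by
  have c1 := fun k => contDiff_der (contDiff_fL k) hu
  have c2 := fun k l => contDiff_der (contDiff_fL k) (c1 l)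
  have cl := contDiff_lap hu.exp
  have cl2 := fun k => contDiff_lap ((c1 k).mul hu.exp)
  have c3 := fun l => contDiff_der (contDiff_fL l) ((c1 l).mul cl)
  simp only [Finset.sum_mul, Finset.mul_sum]
  rw [integral_finsetSum _ fun l _ => integrable_sphere (continuous_slice
      (((contDiff_const.mul (c2 l l)).add ((c1 l).pow 2)).mul cl).continuous z r),
    integral_finsetSum _ fun l _ => integrable_sphere (continuous_slice
      (ContDiff.sum fun k _ => hu.exp.mul ((c2 k l).pow 2)).continuous z r), Finset.mul_sum]
  refine Finset.sum_congr rfl fun l _ => ?_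
  have := integral_sphere_carre (c1 l) hu.exp z r
  simp only [Finset.mul_sum] at this
  rw [← this]
  simp only [bracket_mul_lap (contDiff_fL l) hu (der_fL_lap l hu.exp)]
  rw [integral_add, integral_const_mul, integral_sphere_der_fL ((c1 l).mul cl)]
  · simp
  · exact integrable_sphere (continuous_slice (contDiff_const.mul (c3 l)).continuous z r)
  · exact integrable_sphere (continuous_slice
      ((((c1 l).pow 2).mul cl).sub ((contDiff_const.mul (c1 l)).mul (cl2 l))).continuous z r)

/-! ### The Laplacian in polar form -/

/-- `r² Δ_{z,y} = r² Δ_z + (r∂_r)² + r∂_r + Δ_σ`, applied to `u`. -/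
lemma polar_laplacian (hu : ContDiff ℝ ∞ u) (p : PS) :
    ‖p.2‖ ^ 2 * (∑ i, der (fZ i) (der (fZ i) u) p)
        + (der fX (der fX u) p + der fX u p) + ∑ k, der (fL k) (der (fL k) u) p
      = ‖p.2‖ ^ 2 * ∑ i, (fderiv ℝ (fderiv ℝ u) p (bv i, 0) (bv i, 0)
          + fderiv ℝ (fderiv ℝ u) p (0, bv i) (0, bv i)) := by
  let ι : E3 →L[ℝ] PS := ContinuousLinearMap.inr ℝ E3 E3
  let B : E3 →L[ℝ] E3 →L[ℝ] ℝ := ((fderiv ℝ (fderiv ℝ u) p).bilinearComp ι ι)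
  let φ : E3 →L[ℝ] ℝ := (fderiv ℝ u p).comp ι
  have hZ : ∀ i, der (fZ i) (der (fZ i) u) p = fderiv ℝ (fderiv ℝ u) p (bv i, 0) (bv i, 0) := by
    intro i
    rw [der, fderiv_der (contDiff_fZ i) hu, fderiv_fZ]; simp [fZ]
  have hX : der fX (der fX u) p = B p.2 p.2 + φ p.2 := by
    rw [der, fderiv_der contDiff_fX hu, fderiv_fX]; simp [fX, B, φ, ι]
  have hX1 : der fX u p = φ p.2 := by simp [der, fX, φ, ι]
  have hL : ∀ k, der (fL k) (der (fL k) u) p = B (J k p.2) (J k p.2) + φ (J k (J k p.2)) := by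
    intro k
    rw [der, fderiv_der (contDiff_fL k) hu, fderiv_fL]; simp [fL, B, φ, ι]
  simp only [hZ, hX, hX1, hL, Finset.sum_add_distrib]
  rw [sum_map₂_J, ← map_sum, sum_J_J]
  simp only [map_smul, smul_eq_mul, B, ι, ContinuousLinearMap.bilinearComp_apply,
    ContinuousLinearMap.inr_apply]
  ring

/-- `r² |∇_{z,y} u|² = r² |∇_z u|² + (r∂_r u)² + |∇_σ u|²`. -/
lemma polar_gradient (p : PS) :
    ‖p.2‖ ^ 2 * (∑ i, der (fZ i) u p ^ 2) + der fX u p ^ 2 + ∑ k, der (fL k) u p ^ 2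
      = ‖p.2‖ ^ 2 * ∑ i, (fderiv ℝ u p (bv i, 0) ^ 2 + fderiv ℝ u p (0, bv i) ^ 2) := by
  let φ : E3 →L[ℝ] ℝ := (fderiv ℝ u p).comp (ContinuousLinearMap.inr ℝ E3 E3)
  have hX1 : der fX u p = φ p.2 := by simp [der, fX, φ]
  have hL : ∀ k, der (fL k) u p = φ (J k p.2) := by intro k; simp [der, fL, φ]
  simp only [hX1, hL, Finset.sum_add_distrib, sum_map_J_sq]
  simp only [der, fZ, φ, ContinuousLinearMap.comp_apply, ContinuousLinearMap.inr_apply]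
  ring

/-- The part of `r² (2 Δu + |∇u|²) Δ_σ exp u`, with `Δ` and `∇` in all six variables, that comes
from the derivatives in the centre `z`. -/
def termZ (u : PS → ℝ) (p : PS) : ℝ :=
  ‖p.2‖ ^ 2 * (∑ i, (2 * der (fZ i) (der (fZ i) u) p + der (fZ i) u p ^ 2))
    * lap (fun q => Real.exp (u q)) p

/-- The radial part of `r² (2 Δu + |∇u|²) Δ_σ exp u`; recall that `fX` is `r ∂_r`. -/
def termX (u : PS → ℝ) (p : PS) : ℝ :=
  (2 * der fX (der fX u) p + 2 * der fX u p + der fX u p ^ 2) * lap (fun q => Real.exp (u q)) p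

/-- The angular part of `r² (2 Δu + |∇u|²) Δ_σ exp u`. -/
def termL (u : PS → ℝ) (p : PS) : ℝ :=
  (∑ l, (2 * der (fL l) (der (fL l) u) p + der (fL l) u p ^ 2)) * lap (fun q => Real.exp (u q)) p

lemma termZ_add_termX_add_termL (hu : ContDiff ℝ ∞ u) (p : PS) :
    termZ u p + termX u p + termL u p = ‖p.2‖ ^ 2 *
      (∑ i, (2 * (fderiv ℝ (fderiv ℝ u) p (bv i, 0) (bv i, 0)
          + fderiv ℝ (fderiv ℝ u) p (0, bv i) (0, bv i))
        + (fderiv ℝ u p (bv i, 0) ^ 2 + fderiv ℝ u p (0, bv i) ^ 2)))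
        * lap (fun q => Real.exp (u q)) p := by
  have h1 := polar_laplacian hu p
  have h2 := polar_gradient (u := u) p
  simp only [termZ, termX, termL]
  rw [Finset.sum_add_distrib, Finset.sum_add_distrib, Finset.sum_add_distrib, ← Finset.mul_sum,
    ← Finset.mul_sum, ← Finset.mul_sum]
  linear_combination (2 * lap (fun q => Real.exp (u q)) p) * h1
    + lap (fun q => Real.exp (u q)) p * h2

end

/-! ### Spherical gradient and Hessian through rotations -/

section Sphere

variable {U : E3 → ℝ}

lemma norm_S2 (σ : S2) : ‖(σ : E3)‖ = 1 := by simp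

lemma S2_ne_zero (σ : S2) : (σ : E3) ≠ 0 := by
  intro h; have := norm_S2 σ; rw [h] at this; simp at this

lemma radialExt_eq (U : E3 → ℝ) (r : ℝ) :
    radialExt (fun σ => U (r • σ)) = fun x => U ((r * ‖x‖⁻¹) • x) := by
  funext x; simp [radialExt, smul_smul]

lemma contDiffAt_radialExt (hU : ContDiff ℝ ∞ U) (r : ℝ) {x : E3} (hx : x ≠ 0) :
    ContDiffAt ℝ ∞ (radialExt fun σ => U (r • σ)) x := by
  rw [radialExt_eq]
  have hN : ContDiffAt ℝ ∞ (fun y : E3 => ‖y‖) x := contDiffAt_norm ℝ hx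
  exact hU.contDiffAt.comp x
    ((contDiffAt_const.mul (hN.inv (norm_ne_zero_iff.2 hx))).smul contDiffAt_id)

lemma fderiv_radialExt_J (hU : ContDiff ℝ ∞ U) (r : ℝ) {x : E3} (hx : x ≠ 0) (k : Fin 3) :
    fderiv ℝ (radialExt fun σ => U (r • σ)) x (J k x) = rot k U ((r * ‖x‖⁻¹) • x) := by
  rw [radialExt_eq, fderiv_comp_radial hU r hx]; rfl

lemma fderiv_radialExt_self (hU : ContDiff ℝ ∞ U) (r : ℝ) (σ : S2) :
    fderiv ℝ (radialExt fun σ => U (r • σ)) (σ : E3) (σ : E3) = 0 := by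
  have hd := (contDiffAt_radialExt hU r (S2_ne_zero σ)).differentiableAt (by simp)
  have h1 : HasDerivAt (fun t : ℝ => t • (σ : E3)) (σ : E3) 1 := by
    simpa using (hasDerivAt_id (1 : ℝ)).smul_const (σ : E3)
  have hd' : HasFDerivAt (radialExt fun σ => U (r • σ))
      (fderiv ℝ (radialExt fun σ => U (r • σ)) (σ : E3)) ((1 : ℝ) • (σ : E3)) := by
    rw [one_smul]; exact hd.hasFDerivAt
  have h2 := hd'.comp_hasDerivAt (1 : ℝ) h1
  have h3 : (radialExt (fun σ => U (r • σ)) ∘ fun t : ℝ => t • (σ : E3))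
      =ᶠ[nhds 1] fun _ => U (r • (σ : E3)) := by
    filter_upwards [lt_mem_nhds (one_pos : (0 : ℝ) < 1)] with t ht
    simp [radialExt, norm_smul, abs_of_pos ht, smul_smul, ht.ne']
  exact h2.unique ((hasDerivAt_const (1 : ℝ) (U (r • (σ : E3)))).congr_of_eventuallyEq h3)

/-- Second rotation derivatives are the spherical Hessian plus a first-order term, which comes from
`J l (J k σ)` having a tangential part. -/
lemma fderiv_fderiv_radialExt_J (hU : ContDiff ℝ ∞ U) (r : ℝ) (σ : S2) (l k : Fin 3) :
    rot l (rot k U) (r • (σ : E3))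
      = fderiv ℝ (fderiv ℝ (radialExt fun σ => U (r • σ))) (σ : E3) (J l σ) (J k σ)
        + (σ : E3) k * fderiv ℝ (radialExt fun σ => U (r • σ)) (σ : E3) (bv l) := by
  set G := radialExt fun σ => U (r • σ) with hG
  have hσ := S2_ne_zero σ
  have hrk : ContDiff ℝ ∞ (rot k U) := contDiff_der (J k).contDiff hU
  have h1 : (fun x => fderiv ℝ G x (J k x)) =ᶠ[nhds (σ : E3)]
      fun x => rot k U ((r * ‖x‖⁻¹) • x) := by
    filter_upwards [isOpen_ne.mem_nhds hσ] with x hx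
    exact fderiv_radialExt_J hU r hx k
  have h2 := fderiv_comp_radial hrk r hσ l
  rw [← h1.fderiv_eq] at h2
  have h3 : HasFDerivAt (fun x => fderiv ℝ G x (J k x)) _ (σ : E3) :=
    (((contDiffAt_radialExt hU r hσ).fderiv_right (m := ∞) (by simp)).differentiableAt
      (by simp)).hasFDerivAt.clm_apply (J k).hasFDerivAt
  rw [h3.fderiv] at h2
  simp only [norm_S2, inv_one, mul_one] at h2
  rw [rot, der, ← h2]
  simp only [add_apply, ContinuousLinearMap.comp_apply, ContinuousLinearMap.flip_apply]
  rw [J_J, map_sub, map_smul, map_smul, hG, fderiv_radialExt_self hU]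
  simp [add_comm]

/-- The vectors `J k σ` and the projected basis vectors are both tight frames of the tangent
plane. -/
lemma sum_map_J_sq_sphere (φ : E3 →L[ℝ] ℝ) (σ : S2) :
    ∑ k, φ (J k σ) ^ 2 = ∑ i, φ (tangentProj σ (bv i)) ^ 2 := by
  rw [sum_map_J_sq, norm_S2]
  have h1 := normSq_E3 (σ : E3)
  rw [norm_S2] at h1
  have h2 := map_E3 φ (σ : E3)
  simp only [tangentProj, map_sub, map_smul, smul_eq_mul, EuclideanSpace.inner_single_right]
  simp only [Fin.sum_univ_three, one_mul, Fin.isValue, conj_trivial] at h1 h2 ⊢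
  linear_combination (φ (σ : E3) ^ 2) * h1 - 2 * φ (σ : E3) * h2

lemma sum_mul_J (y : E3) : ∑ k, y k • J k y = 0 := by
  ext j
  simp only [J_apply, Fin.sum_univ_three]
  fin_cases j <;> simp <;> ring

/-- The squared length of the spherical gradient, through rotations and through the standard
basis. -/
lemma norm_sphGrad_sq (hU : ContDiff ℝ ∞ U) (r : ℝ) (σ : S2) :
    ‖sphGrad (fun σ => U (r • σ)) σ‖ ^ 2 = ∑ k, rot k U (r • (σ : E3)) ^ 2 ∧
    ‖sphGrad (fun σ => U (r • σ)) σ‖ ^ 2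
      = ∑ i, fderiv ℝ (radialExt fun σ => U (r • σ)) (σ : E3) (bv i) ^ 2 := by
  have hσ := S2_ne_zero σ
  have h1 : ‖sphGrad (fun σ => U (r • σ)) σ‖ ^ 2
      = ∑ i, fderiv ℝ (radialExt fun σ => U (r • σ)) (σ : E3) (bv i) ^ 2 := by
    rw [normSq_E3]
    refine Finset.sum_congr rfl fun i _ => ?_
    rw [sphGrad, gradient, ← InnerProductSpace.toDual_symm_apply (𝕜 := ℝ) (E := E3) (x := bv i),
      EuclideanSpace.inner_single_right]
    simp
  refine ⟨?_, h1⟩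
  have h2 := sum_map_J_sq (fderiv ℝ (radialExt fun σ => U (r • σ)) (σ : E3)) σ
  rw [fderiv_radialExt_self hU, norm_S2] at h2
  simp only [fderiv_radialExt_J hU r hσ, norm_S2] at h2
  simp only [inv_one, mul_one] at h2
  rw [h1, h2]; ring

/-- `Γ₂` is the sum of the squares of all second rotation derivatives: the first-order terms of
`fderiv_fderiv_radialExt_J` are orthogonal to the Hessian and their squares add up to the squared
gradient. -/
lemma Gamma2_eq (hU : ContDiff ℝ ∞ U) (r : ℝ) (σ : S2) :
    Gamma2 (fun σ => U (r • σ)) σ = ∑ l, ∑ k, rot l (rot k U) (r • (σ : E3)) ^ 2 := by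
  have hσ := S2_ne_zero σ
  set B := fderiv ℝ (fderiv ℝ (radialExt fun σ => U (r • σ))) (σ : E3) with hB
  have h1 : sphHessNormSq (fun σ => U (r • σ)) σ = ∑ l, ∑ k, B (J l σ) (J k σ) ^ 2 := by
    simp only [sphHessNormSq, sphHess, iteratedFDeriv_two_apply, Matrix.cons_val_zero,
      Matrix.cons_val_one]
    symm
    rw [Finset.sum_congr rfl fun l _ => sum_map_J_sq_sphere (B (J l σ)) σ, Finset.sum_comm]
    exact (Finset.sum_congr rfl fun j _ =>
      sum_map_J_sq_sphere (B.flip (tangentProj σ (bv j))) σ).trans Finset.sum_comm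
  have hz : ∀ l, ∑ k, (σ : E3) k * B (J l σ) (J k σ) = 0 := fun l => by
    have := congrArg (B (J l σ)) (sum_mul_J (σ : E3))
    simpa [map_sum] using this
  have h3 := normSq_E3 (σ : E3)
  rw [norm_S2] at h3
  rw [Gamma2, h1, (norm_sphGrad_sq hU r σ).2]
  simp only [fderiv_fderiv_radialExt_J hU, ← hB]
  rw [← Finset.sum_add_distrib]
  refine Finset.sum_congr rfl fun l _ => ?_
  have := hz l
  simp only [Fin.sum_univ_three] at this h3 ⊢
  set d := fderiv ℝ (radialExt fun σ => U (r • σ)) (σ : E3) (bv l)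
  linear_combination d ^ 2 * h3 - 2 * d * this

end Sphere

end

section

/-! ### Growth and decay classes on pairs -/

/-- The weight `(1 + |z|)(1 + |y|)`. -/
def wt (p : PS) : ℝ := (1 + ‖p.1‖) * (1 + ‖p.2‖)

lemma one_le_wt (p : PS) : 1 ≤ wt p := by
  unfold wt
  nlinarith [norm_nonneg p.1, norm_nonneg p.2, mul_nonneg (norm_nonneg p.1) (norm_nonneg p.2)]

lemma wt_pos (p : PS) : 0 < wt p := one_pos.trans_le (one_le_wt p)

lemma norm_snd_le_wt (p : PS) : ‖p.2‖ ≤ wt p := by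
  unfold wt
  nlinarith [norm_nonneg p.1, norm_nonneg p.2, mul_nonneg (norm_nonneg p.1) (norm_nonneg p.2)]

/-- `Q = O(|y|^m)` times a polynomially growing factor. -/
def PolyR (m : ℕ) (Q : PS → ℝ) : Prop :=
  ∃ (C : ℝ) (N : ℕ), 0 ≤ C ∧ ∀ p, |Q p| ≤ C * ‖p.2‖ ^ m * wt p ^ N

/-- `G = O(|y|^m)` times a rapidly decaying factor. -/
def RapidR (m : ℕ) (G : PS → ℝ) : Prop :=
  ∀ k : ℕ, ∃ C : ℝ, 0 ≤ C ∧ ∀ p, |G p| * wt p ^ k ≤ C * ‖p.2‖ ^ m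

variable {m n : ℕ} {Q R G K : PS → ℝ}

lemma PolyR.add (hQ : PolyR m Q) (hR : PolyR m R) : PolyR m fun p => Q p + R p := by
  obtain ⟨C, N, hC, h⟩ := hQ
  obtain ⟨D, M, hD, h'⟩ := hR
  refine ⟨C + D, N + M, by positivity, fun p => (abs_add_le _ _).trans ?_⟩
  have h1 := one_le_wt p
  have h2 : wt p ^ N ≤ wt p ^ (N + M) := pow_le_pow_right₀ h1 (by omega)
  have h3 : wt p ^ M ≤ wt p ^ (N + M) := pow_le_pow_right₀ h1 (by omega)
  calc |Q p| + |R p| ≤ C * ‖p.2‖ ^ m * wt p ^ N + D * ‖p.2‖ ^ m * wt p ^ M :=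
        add_le_add (h p) (h' p)
    _ ≤ C * ‖p.2‖ ^ m * wt p ^ (N + M) + D * ‖p.2‖ ^ m * wt p ^ (N + M) := by gcongr
    _ = _ := by ring

lemma PolyR.mul (hQ : PolyR m Q) (hR : PolyR n R) : PolyR (m + n) fun p => Q p * R p := by
  obtain ⟨C, N, hC, h⟩ := hQ
  obtain ⟨D, M, hD, h'⟩ := hR
  refine ⟨C * D, N + M, by positivity, fun p => ?_⟩
  rw [abs_mul]
  have := wt_pos p
  calc |Q p| * |R p| ≤ (C * ‖p.2‖ ^ m * wt p ^ N) * (D * ‖p.2‖ ^ n * wt p ^ M) :=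
        mul_le_mul (h p) (h' p) (abs_nonneg _) (by positivity)
    _ = _ := by ring

lemma PolyR.const_mul (c : ℝ) (hQ : PolyR m Q) : PolyR m fun p => c * Q p := by
  obtain ⟨C, N, hC, h⟩ := hQ
  refine ⟨|c| * C, N, by positivity, fun p => ?_⟩
  rw [abs_mul]
  calc |c| * |Q p| ≤ |c| * (C * ‖p.2‖ ^ m * wt p ^ N) := by gcongr; exact h p
    _ = _ := by ring

lemma polyR_zero : PolyR m fun _ => 0 := ⟨0, 0, le_rfl, fun p => by simp⟩

lemma PolyR.sum {ι : Type*} (s : Finset ι) {Q : ι → PS → ℝ} (h : ∀ i, PolyR m (Q i)) :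
    PolyR m fun p => ∑ i ∈ s, Q i p := by
  classical
  induction s using Finset.induction_on with
  | empty => simpa using polyR_zero
  | insert a s ha ih =>
    simp only [Finset.sum_insert ha]
    exact (h a).add ih

lemma PolyR.mono (hQ : PolyR (m + n) Q) : PolyR m Q := by
  obtain ⟨C, N, hC, h⟩ := hQ
  refine ⟨C, N + n, hC, fun p => (h p).trans ?_⟩
  rw [pow_add, pow_add]
  have := norm_snd_le_wt p
  have h0 := wt_pos p
  calc C * (‖p.2‖ ^ m * ‖p.2‖ ^ n) * wt p ^ N ≤ C * (‖p.2‖ ^ m * wt p ^ n) * wt p ^ N := by gcongr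
    _ = _ := by ring

lemma polyR_normSq : PolyR 2 fun p => ‖p.2‖ ^ 2 :=
  ⟨1, 0, zero_le_one, fun p => by simp⟩

lemma polyR_const (c : ℝ) : PolyR 0 fun _ => c :=
  ⟨|c|, 0, abs_nonneg c, fun p => by simp⟩

lemma RapidR.mul_polyR (hG : RapidR m G) (hQ : PolyR n Q) : RapidR (m + n) fun p => G p * Q p := by
  obtain ⟨D, M, hD, h'⟩ := hQ
  intro k
  obtain ⟨C, hC, h⟩ := hG (k + M)
  refine ⟨C * D, by positivity, fun p => ?_⟩
  rw [abs_mul]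
  have := wt_pos p
  calc |G p| * |Q p| * wt p ^ k ≤ |G p| * (D * ‖p.2‖ ^ n * wt p ^ M) * wt p ^ k := by
        gcongr; exact h' p
    _ = (|G p| * wt p ^ (k + M)) * (D * ‖p.2‖ ^ n) := by ring
    _ ≤ (C * ‖p.2‖ ^ m) * (D * ‖p.2‖ ^ n) := mul_le_mul_of_nonneg_right (h p) (by positivity)
    _ = _ := by ring

lemma RapidR.add (hG : RapidR m G) (hK : RapidR m K) : RapidR m fun p => G p + K p := by
  intro k
  obtain ⟨C, hC, h⟩ := hG k
  obtain ⟨D, hD, h'⟩ := hK k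
  refine ⟨C + D, by positivity, fun p => ?_⟩
  have := wt_pos p
  calc |G p + K p| * wt p ^ k ≤ (|G p| + |K p|) * wt p ^ k := by gcongr; exact abs_add_le _ _
    _ = |G p| * wt p ^ k + |K p| * wt p ^ k := by ring
    _ ≤ C * ‖p.2‖ ^ m + D * ‖p.2‖ ^ m := add_le_add (h p) (h' p)
    _ = _ := by ring

lemma RapidR.const_mul (c : ℝ) (hG : RapidR m G) : RapidR m fun p => c * G p := by
  have := hG.mul_polyR (polyR_const c)
  simpa [mul_comm] using this

lemma RapidR.mono (hG : RapidR (m + n) G) : RapidR m G := by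
  intro k
  obtain ⟨C, hC, h⟩ := hG (k + n)
  refine ⟨C, hC, fun p => ?_⟩
  have h0 := wt_pos p
  have h1 : |G p| * wt p ^ k * wt p ^ n ≤ C * ‖p.2‖ ^ m * wt p ^ n := by
    calc |G p| * wt p ^ k * wt p ^ n = |G p| * wt p ^ (k + n) := by ring
      _ ≤ C * ‖p.2‖ ^ (m + n) := h p
      _ = C * ‖p.2‖ ^ m * ‖p.2‖ ^ n := by ring
      _ ≤ _ := by gcongr; exact norm_snd_le_wt p
  exact le_of_mul_le_mul_right h1 (by positivity)

lemma RapidR.rapid (hG : RapidR m G) : RapidR 0 G := by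
  have : RapidR (0 + m) G := by simpa using hG
  exact this.mono

lemma PolyR.poly (hQ : PolyR m Q) : PolyR 0 Q := by
  have : PolyR (0 + m) Q := by simpa using hQ
  exact this.mono

/-! ### Integrability of rapidly decaying functions -/

lemma integrable_inv_one_add_norm : Integrable (fun z : E3 => ((1 + ‖z‖) ^ 4)⁻¹) := by
  have h := integrable_one_add_norm (E := E3) (μ := volume) (r := 4) (by simp; norm_num)
  refine h.congr (Filter.Eventually.of_forall fun z => ?_)
  have : (0 : ℝ) ≤ 1 + ‖z‖ := by positivity
  simp only [Real.rpow_neg this]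
  norm_cast

lemma RapidR.norm_le (hG : RapidR m G) (k : ℕ) : ∃ C : ℝ, 0 ≤ C ∧ ∀ p,
    ‖G p‖ ≤ C * ((1 + ‖p.1‖) ^ 4)⁻¹ * (‖p.2‖ ^ m / (1 + ‖p.2‖) ^ k) := by
  obtain ⟨C, hC, h⟩ := hG (4 + k)
  refine ⟨C, hC, fun p => ?_⟩
  have h1 : (1 + ‖p.1‖) ^ 4 * (1 + ‖p.2‖) ^ k ≤ wt p ^ (4 + k) := by
    unfold wt
    rw [mul_pow]
    have := norm_nonneg p.1
    have := norm_nonneg p.2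
    gcongr <;> linarith
  have h2 : |G p| * ((1 + ‖p.1‖) ^ 4 * (1 + ‖p.2‖) ^ k) ≤ C * ‖p.2‖ ^ m :=
    le_trans (by gcongr) (h p)
  have h3 : 0 < (1 + ‖p.1‖) ^ 4 * (1 + ‖p.2‖) ^ k := by positivity
  rw [Real.norm_eq_abs]
  calc |G p| ≤ C * ‖p.2‖ ^ m / ((1 + ‖p.1‖) ^ 4 * (1 + ‖p.2‖) ^ k) := (le_div_iff₀ h3).2 h2
    _ = _ := by field_simp

lemma RapidR.integrable_fst (hG : RapidR m G) (hc : Continuous G) (y : E3) :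
    Integrable fun z => G (z, y) := by
  obtain ⟨C, hC, h⟩ := hG.norm_le 0
  refine ((integrable_inv_one_add_norm.const_mul C).mul_const (‖y‖ ^ m)).mono'
    (by fun_prop) (Filter.Eventually.of_forall fun z => ?_)
  simpa using h (z, y)

lemma RapidR.integrable_slice (hG : RapidR m G) (hc : Continuous G) (r : ℝ) :
    Integrable (fun q : E3 × S2 => G (q.1, r • (q.2 : E3))) (volume.prod sphereMeasure) := by
  obtain ⟨C, hC, h⟩ := hG.norm_le 0
  have h1 : Integrable (fun q : E3 × S2 => (C * ((1 + ‖q.1‖) ^ 4)⁻¹) * (|r| ^ m))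
      (volume.prod sphereMeasure) :=
    (integrable_inv_one_add_norm.const_mul C).mul_prod (integrable_const _)
  refine h1.mono' (by fun_prop) (Filter.Eventually.of_forall fun q => ?_)
  simpa [norm_smul] using h (q.1, r • (q.2 : E3))

/-- The properties that are used of a potential `α` and of its lift `β`. In addition to
`IsPotential`, measurability on the whole line is asked for; integrability at zero and polynomial
growth at infinity are also combined into one integrability condition. -/
structure IsWeight (b : ℝ → ℝ) : Prop where
  measurable : Measurable b
  nonneg : ∀ r, 0 < r → 0 ≤ b r
  contDiffOn : ContDiffOn ℝ 1 b (Ioi 0)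
  integrableOn : ∃ k : ℕ, IntegrableOn (fun r => b r * (r ^ 4 / (1 + r) ^ k)) (Ioi 0)
  growth : ∃ (C : ℝ) (m : ℕ), ∀ r, 1 ≤ r → b r ≤ C * r ^ m

variable {b : ℝ → ℝ}

lemma coordMeasure_eq_restrict :
    coordMeasure = ((volume : Measure E3).prod ((volume : Measure ℝ).prod sphereMeasure)).restrict
      (univ ×ˢ Ioi 0 ×ˢ univ) := by
  rw [← Measure.prod_restrict, ← Measure.prod_restrict, Measure.restrict_univ,
    Measure.restrict_univ]
  rfl

lemma ae_coordMeasure_pos : ∀ᵐ q ∂coordMeasure, 0 < q.2.1 := by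
  rw [coordMeasure_eq_restrict]
  filter_upwards [ae_restrict_mem (MeasurableSet.univ.prod
    (measurableSet_Ioi.prod MeasurableSet.univ))] with q hq
  exact hq.2.1

/-- Four powers of `r` compensate the singularity of the weight in the coordinates `(z, r, σ)`. -/
lemma RapidR.integrable_coord (hb : IsWeight b) (hG : RapidR 4 G) (hc : Continuous G) :
    Integrable (fun q : E3 × ℝ × S2 => b q.2.1 * G (q.1, q.2.1 • (q.2.2 : E3))) coordMeasure := by
  obtain ⟨k, hk⟩ := hb.integrableOn
  obtain ⟨C, hC, h⟩ := hG.norm_le k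
  have h1 : Integrable (fun q : E3 × ℝ × S2 => (C * ((1 + ‖q.1‖) ^ 4)⁻¹) *
      ((b q.2.1 * (q.2.1 ^ 4 / (1 + q.2.1) ^ k)) * 1)) coordMeasure :=
    (integrable_inv_one_add_norm.const_mul C).mul_prod (hk.mul_prod (integrable_const 1))
  have hm := hb.measurable
  have hm2 : Measurable fun q : E3 × ℝ × S2 => G (q.1, q.2.1 • (q.2.2 : E3)) :=
    (by fun_prop : Continuous fun q : E3 × ℝ × S2 => G (q.1, q.2.1 • (q.2.2 : E3))).measurable
  refine h1.mono' (by fun_prop : Measurable _).aestronglyMeasurable ?_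
  filter_upwards [ae_coordMeasure_pos] with q hq
  have h2 := h (q.1, q.2.1 • (q.2.2 : E3))
  simp only [norm_smul, Real.norm_eq_abs, abs_of_pos hq, norm_S2, mul_one] at h2
  rw [norm_mul, Real.norm_eq_abs, Real.norm_eq_abs, abs_of_nonneg (hb.nonneg _ hq), mul_one]
  calc b q.2.1 * |G (q.1, q.2.1 • (q.2.2 : E3))|
      ≤ b q.2.1 * (C * ((1 + ‖q.1‖) ^ 4)⁻¹ * (q.2.1 ^ 4 / (1 + q.2.1) ^ k)) :=
        mul_le_mul_of_nonneg_left h2 (hb.nonneg _ hq)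
    _ = _ := by ring

/-- In the variables `(z, y)` the Jacobian `r²` leaves two powers of `|y|` to compensate. -/
lemma RapidR.integrable_pair (hb : IsWeight b) (hG : RapidR 2 G) (hc : Continuous G) :
    Integrable (fun p : PS => b ‖p.2‖ * G p) := by
  have hm := hb.measurable
  have hm2 := hc.measurable
  have h2 : RapidR 4 fun p => G p * ‖p.2‖ ^ 2 := hG.mul_polyR polyR_normSq
  have h3 := h2.integrable_coord hb (by fun_prop)
  rw [← map_polar_prod, integrable_map_measure (by fun_prop) (by fun_prop)]
  have : (fun q : E3 × ℝ × S2 => ENNReal.ofReal (q.2.1 ^ 2))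
    = fun q => ((q.2.1 ^ 2).toNNReal : ℝ≥0∞) := rfl
  rw [this, integrable_withDensity_iff_integrable_smul (by fun_prop)]
  refine h3.congr ?_
  filter_upwards [ae_coordMeasure_pos] with q hq
  simp only [Function.comp_def, NNReal.smul_def, smul_eq_mul, norm_smul, Real.norm_eq_abs,
    abs_of_pos hq, norm_S2, mul_one]
  rw [Real.coe_toNNReal _ (sq_nonneg _)]
  ring

/-! ### Schwartz functions on pairs -/

/-- `G` is a Schwartz function. -/
def IsSchwartz {H : Type*} [NormedAddCommGroup H] [NormedSpace ℝ H] (G : H → ℝ) : Prop :=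
  ∃ φ : SchwartzMap H ℝ, ∀ p, φ p = G p

lemma IsSchwartz.der {H : Type*} [NormedAddCommGroup H] [NormedSpace ℝ H] {G : H → ℝ} {V : H → H}
    (hV : V.HasTemperateGrowth) (hG : IsSchwartz G) : IsSchwartz (der V G) := by
  obtain ⟨φ, hφ⟩ := hG
  have : G = φ := (funext hφ).symm
  subst this
  exact ⟨SchwartzMap.bilinLeftCLM (ContinuousLinearMap.id ℝ (H →L[ℝ] ℝ)) hV
    (SchwartzMap.fderivCLM ℝ H ℝ φ), fun p => rfl⟩

lemma IsSchwartz.add {H : Type*} [NormedAddCommGroup H] [NormedSpace ℝ H] {G K : H → ℝ}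
    (hG : IsSchwartz G) (hK : IsSchwartz K) : IsSchwartz fun p => G p + K p := by
  obtain ⟨φ, hφ⟩ := hG
  obtain ⟨ψ, hψ⟩ := hK
  exact ⟨φ + ψ, fun p => by simp [hφ, hψ]⟩

lemma IsSchwartz.decay {H : Type*} [NormedAddCommGroup H] [NormedSpace ℝ H] {G : H → ℝ}
    (hG : IsSchwartz G) (k : ℕ) : ∃ C : ℝ, 0 ≤ C ∧ ∀ p, |G p| * (1 + ‖p‖) ^ k ≤ C := by
  obtain ⟨φ, hφ⟩ := hG
  refine ⟨2 ^ k * ((Finset.Iic (k, 0)).sup fun m => SchwartzMap.seminorm ℝ m.1 m.2) φ,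
    by positivity, fun p => ?_⟩
  · have := SchwartzMap.one_add_le_sup_seminorm_apply (𝕜 := ℝ) (m := (k, 0)) le_rfl le_rfl φ p
    rw [norm_iteratedFDeriv_zero, hφ, Real.norm_eq_abs, mul_comm] at this
    exact this

lemma IsSchwartz.rapidR {G : PS → ℝ} (hG : IsSchwartz G) : RapidR 0 G := by
  intro k
  obtain ⟨C, hC, h⟩ := hG.decay (2 * k)
  refine ⟨C, hC, fun p => ?_⟩
  rw [pow_zero, mul_one]
  refine le_trans ?_ (h p)
  rw [pow_mul]
  have h1 : wt p ≤ (1 + ‖p‖) ^ 2 := by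
    unfold wt
    rw [sq]
    have := norm_fst_le p
    have := norm_snd_le p
    gcongr
  have := wt_pos p
  gcongr

lemma hasTemperateGrowth_fZ (i : Fin 3) : (fZ i).HasTemperateGrowth :=
  Function.HasTemperateGrowth.const _

lemma hasTemperateGrowth_fL (k : Fin 3) : (fL k).HasTemperateGrowth :=
  (((ContinuousLinearMap.inr ℝ E3 E3).comp (J k)).comp
    (ContinuousLinearMap.snd ℝ E3 E3)).hasTemperateGrowth

lemma hasTemperateGrowth_fX : fX.HasTemperateGrowth :=
  ((ContinuousLinearMap.inr ℝ E3 E3).comp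
    (ContinuousLinearMap.snd ℝ E3 E3)).hasTemperateGrowth

lemma IsSchwartz.lap {G : PS → ℝ} (hG : IsSchwartz G) : IsSchwartz (lap G) := by
  have h : ∀ k, IsSchwartz (Landau.der (fL k) (Landau.der (fL k) G)) := fun k =>
    (hG.der (hasTemperateGrowth_fL k)).der (hasTemperateGrowth_fL k)
  have : Landau.lap G = fun p => Landau.der (fL 0) (Landau.der (fL 0) G) p
      + Landau.der (fL 1) (Landau.der (fL 1) G) p + Landau.der (fL 2) (Landau.der (fL 2) G) p := by
    funext p; simp [Landau.lap, Fin.sum_univ_three]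
  rw [this]
  exact ((h 0).add (h 1)).add (h 2)

lemma IsSchwartz.tensor {f g : E3 → ℝ} (hf : IsSchwartz f) (hg : IsSchwartz g) :
    IsSchwartz fun p : PS => f (p.1 + p.2) * g (p.1 - p.2) := by
  obtain ⟨φ, hφ⟩ := hf
  obtain ⟨ψ, hψ⟩ := hg
  obtain rfl : f = φ := (funext hφ).symm
  obtain rfl : g = ψ := (funext hψ).symm
  let A : PS →L[ℝ] E3 := ContinuousLinearMap.fst ℝ E3 E3 + ContinuousLinearMap.snd ℝ E3 E3
  let B : PS →L[ℝ] E3 := ContinuousLinearMap.fst ℝ E3 E3 - ContinuousLinearMap.snd ℝ E3 E3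
  have hA : ContDiff ℝ ∞ (φ ∘ A) := (φ.smooth ⊤).comp A.contDiff
  have hB : ContDiff ℝ ∞ (ψ ∘ B) := (ψ.smooth ⊤).comp B.contDiff
  refine ⟨⟨fun p => φ (A p) * ψ (B p), hA.mul hB, fun k n => ?_⟩, fun p => rfl⟩
  have hbd : ∀ (χ : SchwartzMap E3 ℝ) (L : PS →L[ℝ] E3), ∃ C : ℝ, ∀ i ≤ n, ∀ p,
      (1 + ‖L p‖) ^ k * ‖iteratedFDeriv ℝ i (χ ∘ L) p‖ ≤ C := by
    intro χ L
    refine ⟨2 ^ k * ((Finset.Iic (k, n)).sup fun m => SchwartzMap.seminorm ℝ m.1 m.2) χ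
      * (1 + ‖L‖) ^ n, fun i hi p => ?_⟩
    have h1 := SchwartzMap.one_add_le_sup_seminorm_apply (𝕜 := ℝ) (m := (k, n)) le_rfl hi χ (L p)
    have h2 : ‖iteratedFDeriv ℝ i (χ ∘ L) p‖
        ≤ ‖iteratedFDeriv ℝ i χ (L p)‖ * (1 + ‖L‖) ^ n := by
      rw [L.iteratedFDeriv_comp_right (χ.smooth ⊤) p (by exact_mod_cast le_top)]
      refine (ContinuousMultilinearMap.norm_compContinuousLinearMap_le _ _).trans ?_
      rw [Finset.prod_const, Finset.card_univ, Fintype.card_fin]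
      have h3 : ‖L‖ ^ i ≤ (1 + ‖L‖) ^ n := by
        calc ‖L‖ ^ i ≤ (1 + ‖L‖) ^ i := by gcongr; linarith
          _ ≤ (1 + ‖L‖) ^ n := pow_le_pow_right₀ (by linarith [norm_nonneg L]) hi
      gcongr
    calc (1 + ‖L p‖) ^ k * ‖iteratedFDeriv ℝ i (χ ∘ L) p‖
        ≤ (1 + ‖L p‖) ^ k * (‖iteratedFDeriv ℝ i χ (L p)‖ * (1 + ‖L‖) ^ n) := by gcongr
      _ = ((1 + ‖L p‖) ^ k * ‖iteratedFDeriv ℝ i χ (L p)‖) * (1 + ‖L‖) ^ n := by ring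
      _ ≤ _ := by gcongr
  obtain ⟨C, hC⟩ := hbd φ A
  obtain ⟨D, hD⟩ := hbd ψ B
  refine ⟨∑ i ∈ Finset.range (n + 1), (n.choose i : ℝ) * C * D, fun p => ?_⟩
  have hp : ‖p‖ ≤ (1 + ‖A p‖) * (1 + ‖B p‖) := by
    have h1 : (2 : ℝ) • p.1 = A p + B p := by simp [A, B, two_smul]
    have h2 : (2 : ℝ) • p.2 = A p - B p := by simp [A, B, two_smul]
    have h3 : 2 * ‖p.1‖ ≤ ‖A p‖ + ‖B p‖ := by
      have := norm_add_le (A p) (B p); rw [← h1, norm_smul] at this; simpa using this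
    have h4 : 2 * ‖p.2‖ ≤ ‖A p‖ + ‖B p‖ := by
      have := norm_sub_le (A p) (B p); rw [← h2, norm_smul] at this; simpa using this
    have := mul_nonneg (norm_nonneg (A p)) (norm_nonneg (B p))
    have := norm_nonneg (A p); have := norm_nonneg (B p)
    rw [Prod.norm_def]
    exact max_le (by nlinarith) (by nlinarith)
  have hmul := norm_iteratedFDeriv_mul_le hA hB p (n := n) (by exact_mod_cast le_top)
  calc ‖p‖ ^ k * ‖iteratedFDeriv ℝ n (fun p => φ (A p) * ψ (B p)) p‖
      ≤ ((1 + ‖A p‖) * (1 + ‖B p‖)) ^ k * ∑ i ∈ Finset.range (n + 1), (n.choose i : ℝ)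
          * ‖iteratedFDeriv ℝ i (φ ∘ A) p‖ * ‖iteratedFDeriv ℝ (n - i) (ψ ∘ B) p‖ := by
        gcongr; exact hmul
    _ = ∑ i ∈ Finset.range (n + 1), (n.choose i : ℝ)
          * ((1 + ‖A p‖) ^ k * ‖iteratedFDeriv ℝ i (φ ∘ A) p‖)
          * ((1 + ‖B p‖) ^ k * ‖iteratedFDeriv ℝ (n - i) (ψ ∘ B) p‖) := by
        rw [Finset.mul_sum, mul_pow]
        exact Finset.sum_congr rfl fun i _ => by ring
    _ ≤ _ := by
        refine Finset.sum_le_sum fun i hi => ?_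
        have hi' : i ≤ n := by simp at hi; omega
        have e1 := hC i hi' p
        have e2 := hD (n - i) (by omega) p
        have : 0 ≤ C := le_trans (by positivity) e1
        gcongr

end

section

/-! ### Bounds for the logarithm of the lifted density -/

/-- Smooth positive functions with the decay of a solution at a fixed time. -/
structure IsTame (f : E3 → ℝ) : Prop where
  smooth : ContDiff ℝ ∞ f
  pos : ∀ v, 0 < f v
  decay : ∀ k n : ℕ, ∃ C : ℝ, ∀ v, ‖v‖ ^ k * ‖iteratedFDeriv ℝ n f v‖ ≤ C
  log_growth : ∃ (C : ℝ) (N : ℕ), ∀ v, ‖iteratedFDeriv ℝ 1 (fun w => Real.log (f w)) v‖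
    + ‖iteratedFDeriv ℝ 2 (fun w => Real.log (f w)) v‖ ≤ C * (1 + ‖v‖) ^ N

/-- `ln f`. -/
def logf (f : E3 → ℝ) (v : E3) : ℝ := Real.log (f v)

/-- `ln F` in the variables `(z, y)`, where `F(v, w) = f(v) f(w)`. -/
def logF (f : E3 → ℝ) (p : PS) : ℝ := logf f (p.1 + p.2) + logf f (p.1 - p.2)

variable {f : E3 → ℝ}

lemma IsTame.isSchwartz (hf : IsTame f) : IsSchwartz f :=
  ⟨⟨f, hf.smooth, hf.decay⟩, fun _ => rfl⟩

lemma IsTame.contDiff_logf (hf : IsTame f) : ContDiff ℝ ∞ (logf f) :=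
  hf.smooth.log fun v => (hf.pos v).ne'

lemma IsTame.contDiff_logF (hf : IsTame f) : ContDiff ℝ ∞ (logF f) :=
  (hf.contDiff_logf.comp (contDiff_fst.add contDiff_snd)).add
    (hf.contDiff_logf.comp (contDiff_fst.sub contDiff_snd))

lemma IsTame.exp_logF (hf : IsTame f) :
    (fun p => Real.exp (logF f p)) = fun p : PS => f (p.1 + p.2) * f (p.1 - p.2) := by
  funext p
  rw [logF, Real.exp_add, logf, logf, Real.exp_log (hf.pos _), Real.exp_log (hf.pos _)]

lemma IsTame.isSchwartz_exp (hf : IsTame f) : IsSchwartz fun p => Real.exp (logF f p) := by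
  rw [hf.exp_logF]; exact hf.isSchwartz.tensor hf.isSchwartz

lemma IsTame.log_bound (hf : IsTame f) : ∃ (C : ℝ) (N : ℕ), 0 ≤ C ∧ ∀ v,
    ‖fderiv ℝ (logf f) v‖ ≤ C * (1 + ‖v‖) ^ N ∧
    ‖fderiv ℝ (fderiv ℝ (logf f)) v‖ ≤ C * (1 + ‖v‖) ^ N := by
  obtain ⟨C, N, h⟩ := hf.log_growth
  have key : ∀ v, ‖fderiv ℝ (logf f) v‖ + ‖fderiv ℝ (fderiv ℝ (logf f)) v‖
      ≤ C * (1 + ‖v‖) ^ N := fun v => by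
    have h1 := h v
    rw [← norm_iteratedFDeriv_fderiv (n := 0), ← norm_iteratedFDeriv_fderiv (n := 1),
      ← norm_iteratedFDeriv_fderiv (n := 0), norm_iteratedFDeriv_zero,
      norm_iteratedFDeriv_zero] at h1
    exact h1
  refine ⟨C, N, ?_, fun v => ?_⟩
  · have := (by positivity : (0:ℝ) ≤ _).trans (key 0)
    simpa using this
  · have h1 := norm_nonneg (fderiv ℝ (logf f) v)
    have h2 := norm_nonneg (fderiv ℝ (fderiv ℝ (logf f)) v)
    constructor <;> linarith [key v]

/-- The map `(z, y) ↦ z + y`. -/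
def addMap : PS →L[ℝ] E3 := ContinuousLinearMap.fst ℝ E3 E3 + ContinuousLinearMap.snd ℝ E3 E3
/-- The map `(z, y) ↦ z - y`. -/
def subMap : PS →L[ℝ] E3 := ContinuousLinearMap.fst ℝ E3 E3 - ContinuousLinearMap.snd ℝ E3 E3

lemma addMap_apply (p : PS) : addMap p = p.1 + p.2 := rfl
lemma subMap_apply (p : PS) : subMap p = p.1 - p.2 := rfl

lemma fderiv_comp_clm {H H' : Type*} [NormedAddCommGroup H] [NormedSpace ℝ H]
    [NormedAddCommGroup H'] [NormedSpace ℝ H'] {g : H' → ℝ} (hg : ContDiff ℝ ∞ g)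
    (A : H →L[ℝ] H') (p x : H) : fderiv ℝ (fun q => g (A q)) p x = fderiv ℝ g (A p) (A x) := by
  have : HasFDerivAt (fun q => g (A q)) ((fderiv ℝ g (A p)).comp A) p :=
    (hg.diffAt (A p)).hasFDerivAt.comp p A.hasFDerivAt
  rw [this.fderiv]; rfl

/-- Second derivatives, as iterated derivatives along constant fields. -/
lemma fderiv_fderiv_apply {H : Type*} [NormedAddCommGroup H] [NormedSpace ℝ H] {g : H → ℝ}
    (hg : ContDiff ℝ ∞ g) (p x y : H) :
    fderiv ℝ (fderiv ℝ g) p x y = fderiv ℝ (fun q => fderiv ℝ g q y) p x := by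
  have := fderiv_der (V := fun _ => y) contDiff_const hg p x
  simp only [fderiv_fun_const, Pi.zero_apply, zero_apply, map_zero, add_zero] at this
  rw [← this]; rfl

lemma contDiff_fderiv_apply {H : Type*} [NormedAddCommGroup H] [NormedSpace ℝ H] {g : H → ℝ}
    (hg : ContDiff ℝ ∞ g) (y : H) : ContDiff ℝ ∞ fun q => fderiv ℝ g q y :=
  contDiff_der (V := fun _ => y) contDiff_const hg

lemma IsTame.fderiv_logF (hf : IsTame f) (p x : PS) : fderiv ℝ (logF f) p x
    = fderiv ℝ (logf f) (p.1 + p.2) (x.1 + x.2) + fderiv ℝ (logf f) (p.1 - p.2) (x.1 - x.2) := by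
  have hl := hf.contDiff_logf
  have : logF f = fun p => logf f (addMap p) + logf f (subMap p) := rfl
  have h1 : ContDiff ℝ ∞ fun p => logf f (addMap p) := hl.comp addMap.contDiff
  have h2 : ContDiff ℝ ∞ fun p => logf f (subMap p) := hl.comp subMap.contDiff
  rw [this, fderiv_fun_add (h1.diffAt p) (h2.diffAt p), add_apply]
  exact congrArg₂ _ (fderiv_comp_clm hl addMap p x) (fderiv_comp_clm hl subMap p x)

lemma IsTame.fderiv_fderiv_logF (hf : IsTame f) (p x y : PS) :
    fderiv ℝ (fderiv ℝ (logF f)) p x y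
    = fderiv ℝ (fderiv ℝ (logf f)) (p.1 + p.2) (x.1 + x.2) (y.1 + y.2)
      + fderiv ℝ (fderiv ℝ (logf f)) (p.1 - p.2) (x.1 - x.2) (y.1 - y.2) := by
  have hl := hf.contDiff_logf
  rw [fderiv_fderiv_apply hf.contDiff_logF]
  simp only [hf.fderiv_logF]
  have h1 : ContDiff ℝ ∞ fun q : PS => fderiv ℝ (logf f) (q.1 + q.2) (y.1 + y.2) :=
    (contDiff_fderiv_apply hl (y.1 + y.2)).comp addMap.contDiff
  have h2 : ContDiff ℝ ∞ fun q : PS => fderiv ℝ (logf f) (q.1 - q.2) (y.1 - y.2) :=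
    (contDiff_fderiv_apply hl (y.1 - y.2)).comp subMap.contDiff
  rw [fderiv_fun_add (h1.diffAt p) (h2.diffAt p), add_apply]
  rw [fderiv_fderiv_apply hl, fderiv_fderiv_apply hl]
  exact congrArg₂ _ (fderiv_comp_clm (contDiff_fderiv_apply hl _) addMap p x)
    (fderiv_comp_clm (contDiff_fderiv_apply hl _) subMap p x)

lemma one_add_norm_le_wt {p : PS} {v : E3} (h : ‖v‖ ≤ ‖p.1‖ + ‖p.2‖) : 1 + ‖v‖ ≤ wt p := by
  unfold wt
  nlinarith [mul_nonneg (norm_nonneg p.1) (norm_nonneg p.2)]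

/-- The polynomial bounds for the first two derivatives of `ln F`; the derivative in `y` vanishes
on the diagonal `y = 0` by symmetry. -/
lemma IsTame.logF_bound (hf : IsTame f) : ∃ (C : ℝ) (N : ℕ), 0 ≤ C ∧ ∀ p : PS,
    (∀ x, |fderiv ℝ (logF f) p x| ≤ C * wt p ^ N * ‖x‖) ∧
    (∀ x y, |fderiv ℝ (fderiv ℝ (logF f)) p x y| ≤ C * wt p ^ N * ‖x‖ * ‖y‖) ∧
    (∀ b, |fderiv ℝ (logF f) p (0, b)| ≤ C * wt p ^ N * ‖p.2‖ * ‖b‖) := by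
  obtain ⟨C, N, hC, h⟩ := hf.log_bound
  have hadd : ∀ x : PS, ‖x.1 + x.2‖ ≤ 2 * ‖x‖ := fun x => by
    linarith [norm_add_le x.1 x.2, norm_fst_le x, norm_snd_le x]
  have hsub : ∀ x : PS, ‖x.1 - x.2‖ ≤ 2 * ‖x‖ := fun x => by
    linarith [norm_sub_le x.1 x.2, norm_fst_le x, norm_snd_le x]
  have hw : ∀ p : PS, (1 + ‖p.1 + p.2‖) ^ N ≤ wt p ^ N ∧ (1 + ‖p.1 - p.2‖) ^ N ≤ wt p ^ N :=
    fun p => ⟨pow_le_pow_left₀ (by positivity) (one_add_norm_le_wt (norm_add_le _ _)) _,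
      pow_le_pow_left₀ (by positivity) (one_add_norm_le_wt (norm_sub_le _ _)) _⟩
  have h2 : ∀ p x y : PS, |fderiv ℝ (fderiv ℝ (logF f)) p x y|
      ≤ (8 * C) * wt p ^ N * ‖x‖ * ‖y‖ := by
    intro p x y
    rw [hf.fderiv_fderiv_logF]
    have e1 := (fderiv ℝ (fderiv ℝ (logf f)) (p.1 + p.2)).le_opNorm₂ (x.1 + x.2) (y.1 + y.2)
    have e2 := (fderiv ℝ (fderiv ℝ (logf f)) (p.1 - p.2)).le_opNorm₂ (x.1 - x.2) (y.1 - y.2)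
    have f1 := (h (p.1 + p.2)).2
    have f2 := (h (p.1 - p.2)).2
    have hwp := wt_pos p
    calc _ ≤ _ := (abs_add_le _ _).trans (add_le_add e1 e2)
      _ ≤ (C * wt p ^ N) * (2 * ‖x‖) * (2 * ‖y‖) + (C * wt p ^ N) * (2 * ‖x‖) * (2 * ‖y‖) := by
          gcongr
          · exact f1.trans (mul_le_mul_of_nonneg_left (hw p).1 hC)
          · exact hadd x
          · exact hadd y
          · exact f2.trans (mul_le_mul_of_nonneg_left (hw p).2 hC)
          · exact hsub x
          · exact hsub y
      _ = _ := by ring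
  refine ⟨8 * C, N, by positivity, fun p => ⟨fun x => ?_, h2 p, fun b => ?_⟩⟩
  · rw [hf.fderiv_logF]
    have e1 := (fderiv ℝ (logf f) (p.1 + p.2)).le_opNorm (x.1 + x.2)
    have e2 := (fderiv ℝ (logf f) (p.1 - p.2)).le_opNorm (x.1 - x.2)
    have f1 := (h (p.1 + p.2)).1
    have f2 := (h (p.1 - p.2)).1
    have hwp := wt_pos p
    calc _ ≤ _ := (abs_add_le _ _).trans (add_le_add e1 e2)
      _ ≤ (C * wt p ^ N) * (2 * ‖x‖) + (C * wt p ^ N) * (2 * ‖x‖) := by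
          gcongr
          · exact f1.trans (mul_le_mul_of_nonneg_left (hw p).1 hC)
          · exact hadd x
          · exact f2.trans (mul_le_mul_of_nonneg_left (hw p).2 hC)
          · exact hsub x
      _ ≤ _ := by
          have : 0 ≤ C * wt p ^ N * ‖x‖ := by positivity
          linarith
  · let s : Set PS := {p.1} ×ˢ Metric.closedBall (0 : E3) ‖p.2‖
    have hs : Convex ℝ s := (convex_singleton _).prod (convex_closedBall _ _)
    have hwp := wt_pos p
    have hmv := hs.norm_image_sub_le_of_norm_fderiv_le (𝕜 := ℝ)
      (f := fun q => fderiv ℝ (logF f) q (0, b))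
      (C := (8 * C) * wt p ^ N * ‖b‖) (x := (p.1, 0)) (y := p)
      (fun q _ => (contDiff_fderiv_apply hf.contDiff_logF _).diffAt q) ?_
      (by simp [s]) (by simp [s])
    · have hz : fderiv ℝ (logF f) (p.1, 0) (0, b) = 0 := by
        rw [hf.fderiv_logF]; simp
      have hpn : ‖p - (p.1, 0)‖ = ‖p.2‖ := by
        rw [Prod.norm_def]; simp
      rw [hz, sub_zero, hpn, Real.norm_eq_abs] at hmv
      linarith [hmv]
    · intro q hq
      have hq1 : q.1 = p.1 := hq.1
      have hq2 : ‖q.2‖ ≤ ‖p.2‖ := by simpa using hq.2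
      have hwq : wt q ≤ wt p := by unfold wt; rw [hq1]; gcongr
      have := wt_pos q
      refine ContinuousLinearMap.opNorm_le_bound _ (by positivity) fun x => ?_
      rw [← fderiv_fderiv_apply hf.contDiff_logF, Real.norm_eq_abs]
      refine (h2 q x (0, b)).trans ?_
      have hb : ‖((0 : E3), b)‖ = ‖b‖ := by rw [Prod.norm_def]; simp
      rw [hb]
      calc 8 * C * wt q ^ N * ‖x‖ * ‖b‖ ≤ 8 * C * wt p ^ N * ‖x‖ * ‖b‖ := by gcongr
        _ = _ := by ring

section Bounds

variable (A B : E3 →L[ℝ] E3)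

/-- The linear field `(0, A y)`. -/
def fLin (p : PS) : PS := (0, A p.2)

lemma fX_eq : fX = fLin (ContinuousLinearMap.id ℝ E3) := rfl

lemma contDiff_fLin : ContDiff ℝ ∞ (fLin A) :=
  contDiff_const.prodMk (A.contDiff.comp contDiff_snd)

lemma fderiv_fLin (p x : PS) : fderiv ℝ (fLin A) p x = (0, A x.2) := by
  have h : HasFDerivAt (fLin A)
      ((0 : PS →L[ℝ] E3).prod (A.comp (ContinuousLinearMap.snd ℝ E3 E3))) p :=
    (hasFDerivAt_const _ _).prodMk (A.hasFDerivAt.comp p hasFDerivAt_snd)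
  rw [h.fderiv]; simp

lemma norm_inr (y : E3) : ‖((0 : E3), y)‖ = ‖y‖ := by rw [Prod.norm_def]; simp
lemma norm_inl (y : E3) : ‖(y, (0 : E3))‖ = ‖y‖ := by rw [Prod.norm_def]; simp

lemma IsTame.polyR_der_fLin (hf : IsTame f) : PolyR 2 (der (fLin A) (logF f)) := by
  obtain ⟨C, N, hC, h⟩ := hf.logF_bound
  refine ⟨C * ‖A‖, N, by positivity, fun p => ?_⟩
  have := wt_pos p
  calc |der (fLin A) (logF f) p| ≤ C * wt p ^ N * ‖p.2‖ * ‖A p.2‖ := (h p).2.2 _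
    _ ≤ C * wt p ^ N * ‖p.2‖ * (‖A‖ * ‖p.2‖) := by gcongr; exact A.le_opNorm _
    _ = _ := by ring

lemma IsTame.polyR_der_fLin_fLin (hf : IsTame f) :
    PolyR 2 (der (fLin A) (der (fLin B) (logF f))) := by
  obtain ⟨C, N, hC, h⟩ := hf.logF_bound
  refine ⟨C * ‖A‖ * ‖B‖ + C * ‖B‖ * ‖A‖, N, by positivity, fun p => ?_⟩
  have := wt_pos p
  rw [der, fderiv_der (contDiff_fLin B) hf.contDiff_logF, fderiv_fLin]
  refine (abs_add_le _ _).trans ?_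
  calc _ ≤ C * wt p ^ N * ‖fLin A p‖ * ‖fLin B p‖ + C * wt p ^ N * ‖p.2‖ * ‖B (fLin A p).2‖ :=
        add_le_add ((h p).2.1 _ _) ((h p).2.2 _)
    _ ≤ C * wt p ^ N * (‖A‖ * ‖p.2‖) * (‖B‖ * ‖p.2‖)
        + C * wt p ^ N * ‖p.2‖ * (‖B‖ * (‖A‖ * ‖p.2‖)) := by
        simp only [fLin, norm_inr]
        gcongr
        · exact A.le_opNorm _
        · exact B.le_opNorm _
        · exact (B.le_opNorm _).trans (by gcongr; exact A.le_opNorm _)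
    _ = _ := by ring

lemma IsTame.polyR_der_fZ (hf : IsTame f) (i : Fin 3) : PolyR 0 (der (fZ i) (logF f)) := by
  obtain ⟨C, N, hC, h⟩ := hf.logF_bound
  refine ⟨C, N, hC, fun p => ?_⟩
  have := (h p).1 (fZ i p)
  rw [fZ, norm_inl] at this
  simpa [der, fZ] using this

lemma IsTame.polyR_der_fZ_fZ (hf : IsTame f) (i : Fin 3) :
    PolyR 0 (der (fZ i) (der (fZ i) (logF f))) := by
  obtain ⟨C, N, hC, h⟩ := hf.logF_bound
  refine ⟨C, N, hC, fun p => ?_⟩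
  have := (h p).2.1 (fZ i p) (fZ i p)
  rw [fZ, norm_inl] at this
  rw [der, fderiv_der (contDiff_fZ i) hf.contDiff_logF, fderiv_fZ, map_zero, add_zero]
  simpa [fZ] using this

lemma IsTame.polyR_der_fLin_fZ (hf : IsTame f) (i : Fin 3) :
    PolyR 1 (der (fLin A) (der (fZ i) (logF f))) := by
  obtain ⟨C, N, hC, h⟩ := hf.logF_bound
  refine ⟨C * ‖A‖, N, by positivity, fun p => ?_⟩
  have h1 := (h p).2.1 (fLin A p) (fZ i p)
  have := wt_pos p
  rw [der, fderiv_der (contDiff_fZ i) hf.contDiff_logF, fderiv_fZ, map_zero, add_zero]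
  refine h1.trans ?_
  simp only [fLin, fZ, norm_inr, norm_inl, PiLp.norm_single, norm_one, mul_one]
  calc C * wt p ^ N * ‖A p.2‖ ≤ C * wt p ^ N * (‖A‖ * ‖p.2‖) := by gcongr; exact A.le_opNorm _
    _ = _ := by ring

end Bounds

/-- The lifted density `F` as a function of `(z, y)`. -/
def liftF (f : E3 → ℝ) (p : PS) : ℝ := Real.exp (logF f p)

lemma IsTame.contDiff_liftF (hf : IsTame f) : ContDiff ℝ ∞ (liftF f) := hf.contDiff_logF.exp

lemma IsTame.isSchwartz_liftF (hf : IsTame f) : IsSchwartz (liftF f) := hf.isSchwartz_exp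

lemma IsTame.rapidR_liftF (hf : IsTame f) : RapidR 0 (liftF f) := hf.isSchwartz_exp.rapidR

lemma liftF_pos (p : PS) : 0 < liftF f p := Real.exp_pos _

lemma PolyR.pow_two {m : ℕ} {Q : PS → ℝ} (hQ : PolyR m Q) : PolyR (m + m) fun p => Q p ^ 2 := by
  simpa [sq] using hQ.mul hQ

lemma IsTame.rapidR_lap (hf : IsTame f) : RapidR 2 (lap (liftF f)) := by
  have h : PolyR 2 fun p => ∑ k, (der (fL k) (der (fL k) (logF f)) p + der (fL k) (logF f) p ^ 2) :=
    PolyR.sum _ fun k => (hf.polyR_der_fLin_fLin (J k) (J k)).add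
      ((PolyR.pow_two (hf.polyR_der_fLin (J k))).mono (n := 2))
  have h2 := hf.rapidR_liftF.mul_polyR h
  have : lap (liftF f) = fun p => liftF f p * ∑ k, (der (fL k) (der (fL k) (logF f)) p
      + der (fL k) (logF f) p ^ 2) := funext fun p => lap_exp hf.contDiff_logF p
  rw [this]
  simpa using h2

lemma RapidR.congr {m : ℕ} {G K : PS → ℝ} (hG : RapidR m G) (h : ∀ p, K p = G p) : RapidR m K := by
  rwa [funext h]

lemma IsTame.rapidR_termZ (hf : IsTame f) : RapidR 4 (termZ (logF f)) := by
  have h : PolyR 0 fun p => ∑ i, (2 * der (fZ i) (der (fZ i) (logF f)) p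
      + der (fZ i) (logF f) p ^ 2) := PolyR.sum _ fun i =>
    ((hf.polyR_der_fZ_fZ i).const_mul 2).add (PolyR.pow_two (hf.polyR_der_fZ i))
  have h2 := hf.rapidR_lap.mul_polyR (polyR_normSq.mul h)
  exact h2.congr fun p => mul_comm _ _

lemma IsTame.rapidR_termX (hf : IsTame f) : RapidR 4 (termX (logF f)) := by
  have h : PolyR 2 fun p => 2 * der fX (der fX (logF f)) p + 2 * der fX (logF f) p
      + der fX (logF f) p ^ 2 :=
    (((hf.polyR_der_fLin_fLin (.id ℝ E3) (.id ℝ E3)).const_mul 2).add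
      ((hf.polyR_der_fLin (.id ℝ E3)).const_mul 2)).add
      ((PolyR.pow_two (hf.polyR_der_fLin (.id ℝ E3))).mono (n := 2))
  have h2 := hf.rapidR_lap.mul_polyR h
  exact h2.congr fun p => mul_comm _ _

lemma IsTame.rapidR_termL (hf : IsTame f) : RapidR 4 (termL (logF f)) := by
  have h : PolyR 2 fun p => ∑ l, (2 * der (fL l) (der (fL l) (logF f)) p
      + der (fL l) (logF f) p ^ 2) := PolyR.sum _ fun l =>
    ((hf.polyR_der_fLin_fLin (J l) (J l)).const_mul 2).add
      ((PolyR.pow_two (hf.polyR_der_fLin (J l))).mono (n := 2))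
  have h2 := hf.rapidR_lap.mul_polyR h
  exact h2.congr fun p => mul_comm _ _

/-- The density `Γ₂(ln F) F` through rotations. -/
def gammaF (f : E3 → ℝ) (p : PS) : ℝ :=
  liftF f p * ∑ l, ∑ k, der (fL k) (der (fL l) (logF f)) p ^ 2

lemma IsTame.rapidR_gammaF (hf : IsTame f) : RapidR 4 (gammaF f) := by
  have h := hf.rapidR_liftF.mul_polyR (PolyR.sum Finset.univ fun l : Fin 3 =>
    PolyR.sum Finset.univ fun k : Fin 3 => PolyR.pow_two (hf.polyR_der_fLin_fLin (J k) (J l)))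
  exact h.congr fun p => rfl

end

section

/-! ### Integration over spheres of fixed radius -/

/-- The measure `dz dσ`. -/
abbrev sliceMeasure : Measure (E3 × S2) := (volume : Measure E3).prod sphereMeasure

instance : SFinite sliceMeasure := Measure.prod.instSFinite

/-- The integral of `G` over all `z` and all `y` with `|y| = r`. -/
def slice (G : PS → ℝ) (r : ℝ) : ℝ := ∫ q : E3 × S2, G (q.1, r • (q.2 : E3)) ∂sliceMeasure

/-- The radius may be integrated last. -/
lemma measurePreserving_reorder : MeasurePreserving
    (fun q : ℝ × E3 × S2 => ((q.2.1, q.1, q.2.2) : E3 × ℝ × S2))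
    (((volume : Measure ℝ).restrict (Ioi 0)).prod sliceMeasure) coordMeasure := by
  have h1 := (measurePreserving_prodAssoc ((volume : Measure ℝ).restrict (Ioi 0))
    (volume : Measure E3) sphereMeasure).symm
  have h2 : MeasurePreserving Prod.swap
      (((volume : Measure ℝ).restrict (Ioi 0)).prod (volume : Measure E3))
      ((volume : Measure E3).prod ((volume : Measure ℝ).restrict (Ioi 0))) :=
    ⟨measurable_swap, Measure.prod_swap⟩
  have h3 := h2.prod (MeasurePreserving.id sphereMeasure)
  have h4 := measurePreserving_prodAssoc (volume : Measure E3)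
    ((volume : Measure ℝ).restrict (Ioi 0)) sphereMeasure
  exact h4.comp (h3.comp h1)

lemma integral_coord_radial {H : E3 × ℝ × S2 → ℝ} (hH : Integrable H coordMeasure) :
    IntegrableOn (fun r => ∫ q : E3 × S2, H (q.1, r, q.2) ∂sliceMeasure) (Ioi 0) ∧
    ∫ q, H q ∂coordMeasure
      = ∫ r in Ioi (0 : ℝ), ∫ q : E3 × S2, H (q.1, r, q.2) ∂sliceMeasure := by
  have hmp := measurePreserving_reorder
  have h1 : Integrable (fun q : ℝ × E3 × S2 => H (q.2.1, q.1, q.2.2))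
      (((volume : Measure ℝ).restrict (Ioi 0)).prod sliceMeasure) :=
    hmp.integrable_comp_of_integrable hH
  refine ⟨h1.integral_prod_left, ?_⟩
  rw [← hmp.map_eq, integral_map hmp.measurable.aemeasurable (by
    rw [hmp.map_eq]; exact hH.aestronglyMeasurable)]
  exact integral_prod _ h1

variable {m : ℕ} {G K : PS → ℝ} {b : ℝ → ℝ} {f : E3 → ℝ}

lemma RapidR.integral_coord (hb : IsWeight b) (hG : RapidR 4 G) (hc : Continuous G) :
    IntegrableOn (fun r => b r * slice G r) (Ioi 0) ∧
    ∫ q, b q.2.1 * G (q.1, q.2.1 • (q.2.2 : E3)) ∂coordMeasure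
      = ∫ r in Ioi (0 : ℝ), b r * slice G r := by
  have := integral_coord_radial (hG.integrable_coord hb hc)
  simp only [integral_const_mul] at this
  exact this

lemma slice_congr_sphere (hG : RapidR 0 G) (hGc : Continuous G) (hK : RapidR 0 K)
    (hKc : Continuous K) (r : ℝ) (h : ∀ z, ∫ σ : S2, G (z, r • (σ : E3)) ∂sphereMeasure
      = ∫ σ : S2, K (z, r • (σ : E3)) ∂sphereMeasure) : slice G r = slice K r := by
  rw [slice, slice, integral_prod _ (hG.integrable_slice hGc r),
    integral_prod _ (hK.integrable_slice hKc r)]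
  simp only [h]

lemma slice_add (hG : RapidR 0 G) (hGc : Continuous G) (hK : RapidR 0 K)
    (hKc : Continuous K) (r : ℝ) : slice (fun p => G p + K p) r = slice G r + slice K r :=
  integral_add (hG.integrable_slice hGc r) (hK.integrable_slice hKc r)

lemma slice_const_mul (c r : ℝ) : slice (fun p => c * G p) r = c * slice G r :=
  integral_const_mul _ _

lemma slice_nonneg (h : ∀ p, 0 ≤ G p) (r : ℝ) : 0 ≤ slice G r :=
  integral_nonneg fun _ => h _

lemma slice_mono (hG : RapidR 0 G) (hGc : Continuous G) (hK : RapidR 0 K)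
    (hKc : Continuous K) (r : ℝ) (h : ∀ p, G p ≤ K p) : slice G r ≤ slice K r :=
  integral_mono (hG.integrable_slice hGc r) (hK.integrable_slice hKc r) fun _ => h _

/-- Integration by parts in `z`. -/
lemma slice_der_fZ (i : Fin 3) (hc : ContDiff ℝ ∞ G) (hG : RapidR 0 G)
    (hG' : RapidR 0 (der (fZ i) G)) (r : ℝ) : slice (der (fZ i) G) r = 0 := by
  have hd := (contDiff_der (contDiff_fZ i) hc).continuous
  rw [slice, integral_prod_symm _ (hG'.integrable_slice hd r)]
  refine integral_eq_zero_of_ae (Filter.Eventually.of_forall fun σ => ?_)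
  set y := r • (σ : E3)
  have hsl : ∀ z : E3, HasFDerivAt (fun z => G (z, y))
      ((fderiv ℝ G (z, y)).comp ((ContinuousLinearMap.id ℝ E3).prod (0 : E3 →L[ℝ] E3))) z :=
    fun z => (hc.diffAt (z, y)).hasFDerivAt.comp z
      ((hasFDerivAt_id _).prodMk (hasFDerivAt_const _ _))
  have hfd : ∀ z : E3, fderiv ℝ (fun z => G (z, y)) z (bv i) = der (fZ i) G (z, y) := fun z => by
    rw [(hsl z).fderiv]; rfl
  have := integral_mul_fderiv_eq_neg_fderiv_mul_of_integrable (μ := (volume : Measure E3))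
    (f := fun _ => (1 : ℝ)) (g := fun z => G (z, y)) (v := bv i) (by simp)
    (by simpa [hfd] using hG'.integrable_fst hd y)
    (by simpa using hG.integrable_fst hc.continuous y)
    (fun z _ => differentiableAt_const _) (fun z _ => (hsl z).differentiableAt)
  simpa [hfd] using this

lemma slice_continuous (hG : RapidR 0 G) (hc : Continuous G) : Continuous (slice G) := by
  obtain ⟨C, hC, h⟩ := hG.norm_le 0
  refine continuous_of_dominated (bound := fun q : E3 × S2 => C * ((1 + ‖q.1‖) ^ 4)⁻¹ * 1)
    (fun r => by fun_prop) (fun r => Filter.Eventually.of_forall fun q => ?_) ?_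
    (Filter.Eventually.of_forall fun q => by fun_prop)
  · simpa using h (q.1, r • (q.2 : E3))
  · exact (integrable_inv_one_add_norm.const_mul C).mul_prod (integrable_const 1)

lemma slice_norm_le (hG : RapidR m G) (k : ℕ) :
    ∃ C : ℝ, 0 ≤ C ∧ ∀ r, 0 < r → |slice G r| ≤ C * (r ^ m / (1 + r) ^ k) := by
  obtain ⟨C, hC, h⟩ := hG.norm_le k
  have hi : Integrable (fun q : E3 × S2 => (C * ((1 + ‖q.1‖) ^ 4)⁻¹) * 1) sliceMeasure :=
    (integrable_inv_one_add_norm.const_mul C).mul_prod (integrable_const 1)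
  refine ⟨∫ q : E3 × S2, (C * ((1 + ‖q.1‖) ^ 4)⁻¹) * 1 ∂sliceMeasure,
    integral_nonneg fun q => by positivity, fun r hr => ?_⟩
  rw [← integral_mul_const, ← Real.norm_eq_abs, slice]
  refine norm_integral_le_of_norm_le (hi.mul_const _) (Filter.Eventually.of_forall fun q => ?_)
  have := h (q.1, r • (q.2 : E3))
  simpa [norm_smul, abs_of_pos hr] using this

/-- The Euler field differentiates slices in the radius. -/
lemma hasDerivAt_slice (hc : ContDiff ℝ ∞ G) (hG : RapidR 0 G) (hG' : RapidR 0 (der fX G))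
    {r : ℝ} (hr : 0 < r) : HasDerivAt (slice G) (r⁻¹ * slice (der fX G) r) r := by
  obtain ⟨C, hC, h⟩ := hG'.norm_le 0
  have hd := (contDiff_der contDiff_fX hc).continuous
  have key := hasDerivAt_integral_of_dominated_loc_of_deriv_le (μ := sliceMeasure)
    (F := fun r (q : E3 × S2) => G (q.1, r • (q.2 : E3)))
    (F' := fun r (q : E3 × S2) => r⁻¹ * der fX G (q.1, r • (q.2 : E3)))
    (x₀ := r) (s := Ioi (r / 2))
    (bound := fun q : E3 × S2 => (C * ((1 + ‖q.1‖) ^ 4)⁻¹) * (r / 2)⁻¹)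
    (Ioi_mem_nhds (by linarith)) (Filter.Eventually.of_forall fun s => by
      have := hc.continuous; fun_prop)
    (hG.integrable_slice hc.continuous r) (by fun_prop)
    (Filter.Eventually.of_forall fun q s hs => ?_)
    ((integrable_inv_one_add_norm.const_mul C).mul_prod (integrable_const (r / 2)⁻¹))
    (Filter.Eventually.of_forall fun q s hs => ?_)
  · have := key.2
    rwa [integral_const_mul] at this
  · have hs' : r / 2 < s := hs
    have hs0 : 0 < s := by linarith
    have h1 := h (q.1, s • (q.2 : E3))
    simp only [pow_zero, div_one, mul_one] at h1
    rw [norm_mul, norm_inv, Real.norm_eq_abs, abs_of_pos hs0, mul_comm]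
    gcongr
  · have hs0 : 0 < s := by have : r / 2 < s := hs; linarith
    have h1 : HasDerivAt (fun s : ℝ => ((q.1, s • (q.2 : E3)) : PS)) (0, (q.2 : E3)) s := by
      refine (hasDerivAt_const s q.1).prodMk ?_
      simpa using (hasDerivAt_id s).smul_const (q.2 : E3)
    have h2 := (hc.diffAt (q.1, s • (q.2 : E3))).hasFDerivAt.comp_hasDerivAt s h1
    have h3 : s⁻¹ * der fX G (q.1, s • (q.2 : E3))
        = fderiv ℝ G (q.1, s • (q.2 : E3)) (0, (q.2 : E3)) := by
      have : fX (q.1, s • (q.2 : E3)) = s • ((0, (q.2 : E3)) : PS) := by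
        rw [fX]; ext1 <;> simp
      rw [der, this, map_smul, smul_eq_mul, inv_mul_cancel_left₀ hs0.ne']
    simp only [h3]
    exact h2

/-- Green's identity on a sphere. -/
lemma integral_sphere_mul_lap {a F : PS → ℝ} (ha : ContDiff ℝ ∞ a) (hF : ContDiff ℝ ∞ F) (z : E3)
    (r : ℝ) : ∫ σ : S2, (fun p => a p * lap F p) (z, r • (σ : E3)) ∂sphereMeasure
      = ∫ σ : S2, (fun p => -∑ k, der (fL k) a p * der (fL k) F p) (z, r • (σ : E3))
        ∂sphereMeasure := by
  have c1 := fun k => contDiff_der (contDiff_fL k) ha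
  have c2 := fun k => contDiff_der (contDiff_fL k) hF
  have hK := fun k => ha.mul (c2 k)
  have hpt : ∀ p, a p * lap F p = (∑ k, der (fL k) (fun q => a q * der (fL k) F q) p)
      + -∑ k, der (fL k) a p * der (fL k) F p := by
    intro p
    simp only [lap, Finset.mul_sum, ← sub_eq_add_neg, ← Finset.sum_sub_distrib]
    refine Finset.sum_congr rfl fun k _ => ?_
    rw [der_mul ha (c2 k)]
    ring
  simp only [hpt]
  have hcs := fun k => (contDiff_der (contDiff_fL k) (hK k)).continuous
  rw [integral_add, integral_finsetSum]
  · simp [integral_sphere_der_fL (hK _)]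
  · exact fun k _ => integrable_sphere (continuous_slice (hcs k) z r)
  · exact integrable_finsetSum _ fun k _ => integrable_sphere (continuous_slice (hcs k) z r)
  · have h1 := fun k => (c1 k).continuous
    have h2 := fun k => (c2 k).continuous
    exact integrable_sphere (continuous_slice
      (G := fun p => -∑ k, der (fL k) a p * der (fL k) F p) (by fun_prop) z r)

/-! ### The three directions -/

lemma IsTame.continuous_termL (hf : IsTame f) : Continuous (termL (logF f)) := by
  have c1 := fun k => contDiff_der (contDiff_fL k) hf.contDiff_logF
  have h1 := fun k => (c1 k).continuous
  have h2 := fun k => (contDiff_der (contDiff_fL k) (c1 k)).continuous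
  have h3 := (contDiff_lap hf.contDiff_liftF).continuous
  have : termL (logF f) = fun p => (∑ l, (2 * der (fL l) (der (fL l) (logF f)) p
    + der (fL l) (logF f) p ^ 2)) * lap (liftF f) p := rfl
  rw [this]; fun_prop

lemma IsTame.continuous_termX (hf : IsTame f) : Continuous (termX (logF f)) := by
  have c1 := contDiff_der contDiff_fX hf.contDiff_logF
  have h1 := c1.continuous
  have h2 := (contDiff_der contDiff_fX c1).continuous
  have h3 := (contDiff_lap hf.contDiff_liftF).continuous
  have : termX (logF f) = fun p => (2 * der fX (der fX (logF f)) p + 2 * der fX (logF f) p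
    + der fX (logF f) p ^ 2) * lap (liftF f) p := rfl
  rw [this]; fun_prop

lemma IsTame.continuous_termZ (hf : IsTame f) : Continuous (termZ (logF f)) := by
  have c1 := fun k => contDiff_der (contDiff_fZ k) hf.contDiff_logF
  have h1 := fun k => (c1 k).continuous
  have h2 := fun k => (contDiff_der (contDiff_fZ k) (c1 k)).continuous
  have h3 := (contDiff_lap hf.contDiff_liftF).continuous
  have : termZ (logF f) = fun p => ‖p.2‖ ^ 2 * (∑ l, (2 * der (fZ l) (der (fZ l) (logF f)) p
    + der (fZ l) (logF f) p ^ 2)) * lap (liftF f) p := rfl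
  rw [this]; fun_prop

lemma IsTame.continuous_gammaF (hf : IsTame f) : Continuous (gammaF f) := by
  have h1 := fun l k => (contDiff_der (contDiff_fL k)
    (contDiff_der (contDiff_fL l) hf.contDiff_logF)).continuous
  have h2 := hf.contDiff_liftF.continuous
  unfold gammaF; fun_prop

/-- The angular directions contribute exactly the `Γ₂` term. -/
lemma IsTame.slice_termL (hf : IsTame f) (r : ℝ) :
    slice (termL (logF f)) r = 2 * slice (gammaF f) r := by
  rw [← slice_const_mul]
  refine slice_congr_sphere (hf.rapidR_termL.rapid) hf.continuous_termL
    ((hf.rapidR_gammaF.rapid).const_mul 2) (continuous_const.mul hf.continuous_gammaF) r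
    fun z => ?_
  rw [integral_const_mul]
  exact integral_sphere_bochner hf.contDiff_logF z r

lemma der_liftF {V : PS → PS} (hf : IsTame f) :
    der V (liftF f) = fun p => der V (logF f) p * liftF f p := der_exp hf.contDiff_logF

/-- `integral_sphere_carre` for `a = V ln F`, integrated over the centre `z`. The function
`a F = V F` is Schwartz, so its spherical Laplacian decays although third derivatives of `ln F` are
not controlled. -/
lemma slice_carre (hf : IsTame f) {V : PS → PS} (hV : ContDiff ℝ ∞ V)
    (hVt : V.HasTemperateGrowth) (h1 : PolyR 0 (der V (logF f)))
    (h2 : ∀ k, PolyR 0 (der (fL k) (der V (logF f)))) :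
    RapidR 0 (fun p => der V (logF f) p ^ 2 * lap (liftF f) p
      - 2 * der V (logF f) p * lap (fun q => der V (logF f) q * liftF f q) p) ∧
    Continuous (fun p => der V (logF f) p ^ 2 * lap (liftF f) p
      - 2 * der V (logF f) p * lap (fun q => der V (logF f) q * liftF f q) p) ∧
    ∀ r, slice (fun p => der V (logF f) p ^ 2 * lap (liftF f) p
      - 2 * der V (logF f) p * lap (fun q => der V (logF f) q * liftF f q) p) r
      = 2 * slice (fun p => liftF f p * ∑ k, der (fL k) (der V (logF f)) p ^ 2) r := by
  have ha := contDiff_der hV hf.contDiff_logF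
  have hF := hf.contDiff_liftF
  have hlap : IsSchwartz (lap (fun q => der V (logF f) q * liftF f q)) := by
    rw [← der_liftF hf]
    exact (hf.isSchwartz_liftF.der hVt).lap
  have hR : RapidR 0 (fun p => der V (logF f) p ^ 2 * lap (liftF f) p
      - 2 * der V (logF f) p * lap (fun q => der V (logF f) q * liftF f q) p) := by
    have e1 := (hf.rapidR_lap.rapid).mul_polyR (PolyR.pow_two h1)
    have e2 := hlap.rapidR.mul_polyR (h1.const_mul (-2))
    exact (e1.add e2).congr fun p => by ring
  have hC : Continuous (fun p => der V (logF f) p ^ 2 * lap (liftF f) p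
      - 2 * der V (logF f) p * lap (fun q => der V (logF f) q * liftF f q) p) := by
    have e1 := ha.continuous
    have e2 := (contDiff_lap hF).continuous
    have e3 := (contDiff_lap (ha.mul hF)).continuous
    fun_prop
  refine ⟨hR, hC, fun r => ?_⟩
  rw [← slice_const_mul]
  have hQ : PolyR 0 fun p => ∑ k, der (fL k) (der V (logF f)) p ^ 2 :=
    PolyR.sum _ fun k => PolyR.pow_two (h2 k)
  refine slice_congr_sphere hR hC ((hf.rapidR_liftF.mul_polyR hQ).const_mul 2) ?_ r fun z => ?_
  · have e1 := fun k => (contDiff_der (contDiff_fL k) ha).continuous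
    have e2 := hF.continuous
    fun_prop
  · rw [integral_const_mul]
    exact integral_sphere_carre ha hF z r

/-- The `z`-directions only dissipate: their contribution is a `z`-derivative, which integrates to
zero, plus `2 r² |∇_σ ∂_z ln F|² F`. -/
lemma IsTame.slice_termZ_nonneg (hf : IsTame f) (r : ℝ) : 0 ≤ slice (termZ (logF f)) r := by
  have hu := hf.contDiff_logF
  have ha := fun i => contDiff_der (contDiff_fZ i) hu
  have hF := hf.contDiff_liftF
  have hl := contDiff_lap hF
  let c : Fin 3 → PS → ℝ := fun i q => der (fZ i) (logF f) q * lap (liftF f) q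
  have hc : ∀ i, ContDiff ℝ ∞ (c i) := fun i => (ha i).mul hl
  have hcR : ∀ i, RapidR 0 (c i) := fun i =>
    ((hf.rapidR_lap.rapid).mul_polyR (hf.polyR_der_fZ i)).congr fun p => mul_comm _ _
  have hcR' : ∀ i, RapidR 0 (der (fZ i) (c i)) := fun i => by
    have e1 := (hf.rapidR_lap.rapid).mul_polyR (hf.polyR_der_fZ_fZ i)
    have e2 := (((hf.isSchwartz_liftF.lap).der (hasTemperateGrowth_fZ i)).rapidR).mul_polyR
      (hf.polyR_der_fZ i)
    refine (e1.add e2).congr fun p => ?_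
    simp only [c]
    rw [der_mul (ha i) hl]
    ring
  have hca := fun i => slice_carre hf (contDiff_fZ i) (hasTemperateGrowth_fZ i) (hf.polyR_der_fZ i)
    (fun k => (hf.polyR_der_fLin_fZ (J k) i).poly)
  have hpt : ∀ p, termZ (logF f) p = ∑ i, ‖p.2‖ ^ 2 * (2 * der (fZ i) (c i) p
      + (der (fZ i) (logF f) p ^ 2 * lap (liftF f) p
      - 2 * der (fZ i) (logF f) p * lap (fun q => der (fZ i) (logF f) q * liftF f q) p)) := by
    intro p
    rw [termZ, mul_assoc, Finset.sum_mul, Finset.mul_sum]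
    exact Finset.sum_congr rfl fun i _ => congrArg _
      (bracket_mul_lap (contDiff_fZ i) hu (der_fZ_lap i hF) p)
  have hnorm : ∀ q : E3 × S2, ‖r • (q.2 : E3)‖ ^ 2 = r ^ 2 := fun q => by
    simp [norm_smul]
  have hd := fun i => (contDiff_der (contDiff_fZ i) (hc i)).continuous
  have h0 : slice (termZ (logF f)) r = ∑ i, r ^ 2 * slice (fun p => 2 * der (fZ i) (c i) p
      + (der (fZ i) (logF f) p ^ 2 * lap (liftF f) p
      - 2 * der (fZ i) (logF f) p * lap (fun q => der (fZ i) (logF f) q * liftF f q) p)) r := by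
    simp only [slice, hpt, hnorm]
    rw [integral_finsetSum]
    · simp only [integral_const_mul]
    · intro i _
      exact (((((hcR' i).const_mul 2).add (hca i).1).integrable_slice
        ((continuous_const.mul (hd i)).add (hca i).2.1) r).const_mul _)
  rw [h0]
  refine Finset.sum_nonneg fun i _ => mul_nonneg (sq_nonneg r) ?_
  rw [slice_add ((hcR' i).const_mul 2) (continuous_const.mul (hd i)) (hca i).1 (hca i).2.1,
    slice_const_mul, slice_der_fZ i (hc i) (hcR i) (hcR' i), (hca i).2.2, mul_zero, zero_add]
  exact mul_nonneg zero_le_two (slice_nonneg (fun p => mul_nonneg (liftF_pos p).le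
    (Finset.sum_nonneg fun k _ => sq_nonneg _)) r)

end

section

/-! ### The radial direction -/

variable {b : ℝ → ℝ} {f : E3 → ℝ}

/-- `r∂_r ln F · Δ_σ F`. -/
def crossX (f : E3 → ℝ) (p : PS) : ℝ := der fX (logF f) p * lap (liftF f) p

/-- `|∇_σ (r∂_r ln F)|² F`. -/
def mixedSq (f : E3 → ℝ) (p : PS) : ℝ :=
  liftF f p * ∑ k, der (fL k) (der fX (logF f)) p ^ 2

/-- `∇_σ (r∂_r ln F) · ∇_σ ln F · F`. -/
def mixedMul (f : E3 → ℝ) (p : PS) : ℝ :=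
  liftF f p * ∑ k, der (fL k) (der fX (logF f)) p * der (fL k) (logF f) p

/-- `|∇_σ ln F|² F`. -/
def angularSq (f : E3 → ℝ) (p : PS) : ℝ := liftF f p * ∑ k, der (fL k) (logF f) p ^ 2

section Props

variable (hf : IsTame f)
include hf

lemma IsTame.contDiff_crossX : ContDiff ℝ ∞ (crossX f) :=
  (contDiff_der contDiff_fX hf.contDiff_logF).mul (contDiff_lap hf.contDiff_liftF)

lemma IsTame.rapidR_crossX : RapidR 4 (crossX f) :=
  (hf.rapidR_lap.mul_polyR (hf.polyR_der_fLin (.id ℝ E3))).congr fun _ => mul_comm _ _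

lemma IsTame.rapidR_der_crossX : RapidR 0 (der fX (crossX f)) := by
  have ha := contDiff_der contDiff_fX hf.contDiff_logF
  have e1 := (hf.rapidR_lap.rapid).mul_polyR (hf.polyR_der_fLin_fLin (.id ℝ E3) (.id ℝ E3)).poly
  have e2 := (((hf.isSchwartz_liftF.lap).der hasTemperateGrowth_fX).rapidR).mul_polyR
    (hf.polyR_der_fLin (.id ℝ E3)).poly
  refine (e1.add e2).congr fun p => ?_
  have : crossX f = fun p => der fX (logF f) p * lap (liftF f) p := rfl
  rw [this, der_mul ha (contDiff_lap hf.contDiff_liftF)]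
  simp only [← fX_eq]
  ring

lemma IsTame.rapidR_mixedSq : RapidR 4 (mixedSq f) :=
  (hf.rapidR_liftF.mul_polyR (PolyR.sum Finset.univ fun k : Fin 3 =>
    PolyR.pow_two (hf.polyR_der_fLin_fLin (J k) (.id ℝ E3)))).congr fun _ => rfl

lemma IsTame.rapidR_mixedMul : RapidR 4 (mixedMul f) :=
  (hf.rapidR_liftF.mul_polyR (PolyR.sum Finset.univ fun k : Fin 3 =>
    (hf.polyR_der_fLin_fLin (J k) (.id ℝ E3)).mul (hf.polyR_der_fLin (J k)))).congr fun _ => rfl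

lemma IsTame.rapidR_angularSq : RapidR 4 (angularSq f) :=
  (hf.rapidR_liftF.mul_polyR (PolyR.sum Finset.univ fun k : Fin 3 =>
    PolyR.pow_two (hf.polyR_der_fLin (J k)))).congr fun _ => rfl

lemma IsTame.continuous_mixed :
    Continuous (mixedSq f) ∧ Continuous (mixedMul f) ∧ Continuous (angularSq f) := by
  have h0 := hf.contDiff_liftF.continuous
  have h1 := fun k => (contDiff_der (contDiff_fL k) hf.contDiff_logF).continuous
  have h2 := fun k => (contDiff_der (contDiff_fL k)
    (contDiff_der contDiff_fX hf.contDiff_logF)).continuous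
  unfold mixedSq mixedMul angularSq
  refine ⟨by fun_prop, by fun_prop, by fun_prop⟩

/-- Green's identity for `crossX`. -/
lemma IsTame.slice_crossX (r : ℝ) : slice (crossX f) r = -slice (mixedMul f) r := by
  have h : slice (fun p => (-1) * mixedMul f p) r = -slice (mixedMul f) r := by
    rw [slice_const_mul]; ring
  rw [← h]
  refine slice_congr_sphere hf.rapidR_crossX.rapid hf.contDiff_crossX.continuous
    (hf.rapidR_mixedMul.rapid.const_mul (-1)) (continuous_const.mul hf.continuous_mixed.2.1) r
    fun z => ?_
  refine (integral_sphere_mul_lap (contDiff_der contDiff_fX hf.contDiff_logF) hf.contDiff_liftF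
    z r).trans (integral_congr_ae (Filter.Eventually.of_forall fun σ => ?_))
  simp only [mixedMul, Finset.mul_sum, ← Finset.sum_neg_distrib, der_liftF hf]
  exact Finset.sum_congr rfl fun k _ => by ring

/-- On the sphere of radius `r` the radial term is `2 (r A)' + 2 N`, where `A` and `N` are the
integrals of `crossX` and `mixedSq`. -/
lemma IsTame.slice_termX (r : ℝ) : slice (termX (logF f)) r
    = 2 * (slice (crossX f) r + slice (der fX (crossX f)) r) + 2 * slice (mixedSq f) r := by
  have hd := (contDiff_der contDiff_fX hf.contDiff_crossX).continuous
  obtain ⟨e1, e2, e3⟩ := slice_carre hf contDiff_fX hasTemperateGrowth_fX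
    (hf.polyR_der_fLin (.id ℝ E3)).poly (fun k => (hf.polyR_der_fLin_fLin (J k) (.id ℝ E3)).poly)
  have hm : mixedSq f = fun p => liftF f p * ∑ k, der (fL k) (der fX (logF f)) p ^ 2 := rfl
  have hc := hf.rapidR_crossX.rapid
  have hcc := hf.contDiff_crossX.continuous
  rw [hm, ← e3 r, ← slice_add hc hcc hf.rapidR_der_crossX hd, ← slice_const_mul,
    ← slice_add ((hc.add hf.rapidR_der_crossX).const_mul 2)
      (continuous_const.mul (hcc.add hd)) e1 e2]
  congr 1
  funext p
  have h : (2 * der fX (der fX (logF f)) p + der fX (logF f) p ^ 2) * lap (liftF f) p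
      = 2 * der fX (crossX f) p + (der fX (logF f) p ^ 2 * lap (liftF f) p
        - 2 * der fX (logF f) p * lap (fun q => der fX (logF f) q * liftF f q) p) :=
    bracket_mul_lap contDiff_fX hf.contDiff_logF (der_fX_lap hf.contDiff_liftF) p
  change (2 * der fX (der fX (logF f)) p + 2 * der fX (logF f) p + der fX (logF f) p ^ 2)
      * lap (liftF f) p = 2 * (der fX (logF f) p * lap (liftF f) p + der fX (crossX f) p) + _
  linear_combination h

end Props

/-- Integrability of `b(r) r⁴` at zero forces `b(r) r⁵` to be small along a sequence of radii
tending to zero. -/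
lemma IsWeight.exists_small (hb : IsWeight b) {η δ : ℝ} (hη : 0 < η) (hδ : 0 < δ) :
    ∃ ε, 0 < ε ∧ ε < δ ∧ b ε * ε ^ 5 ≤ η := by
  -- otherwise `b(r) r⁴ ≥ η / r` near zero, which is not integrable
  by_contra! hcon
  obtain ⟨k, hk⟩ := hb.integrableOn
  set δ' := min δ 1 / 2
  have hδ' : 0 < δ' := by positivity
  have hδ1 : δ' < δ := by have := min_le_left δ 1; simp only [δ']; linarith [lt_min hδ one_pos]
  have hδ2 : δ' < 1 := by have := min_le_right δ 1; simp only [δ']; linarith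
  have h1 : IntegrableOn (fun r => b r * (r ^ 4 / (1 + r) ^ k)) (Ioc 0 δ') :=
    hk.mono_set fun x hx => hx.1
  have h2 : IntegrableOn (fun r : ℝ => r⁻¹) (Ioc 0 δ') := by
    refine (h1.const_mul (2 ^ k / η)).mono' (by fun_prop) ?_
    filter_upwards [ae_restrict_mem measurableSet_Ioc] with r hr
    have hr0 : 0 < r := hr.1
    have h3 := hcon r hr0 (hr.2.trans_lt hδ1)
    have h4 : (1 + r) ^ k ≤ 2 ^ k := by gcongr; linarith [hr.2]
    rw [Real.norm_eq_abs, abs_of_pos (inv_pos.2 hr0)]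
    have h5 : η / r ≤ b r * r ^ 4 := by
      rw [div_le_iff₀ hr0]; nlinarith [h3]
    have h6 : 0 ≤ b r * r ^ 4 := le_trans (by positivity) h5
    calc r⁻¹ = 1 / η * (η / r) := by field_simp
      _ ≤ 1 / η * (b r * r ^ 4) := by gcongr
      _ ≤ 1 / η * (b r * r ^ 4) * (2 ^ k / (1 + r) ^ k) :=
          le_mul_of_one_le_right (by positivity) ((one_le_div (by positivity)).2 h4)
      _ = _ := by ring
  have h3 : IntervalIntegrable (fun r : ℝ => r⁻¹) volume 0 δ' :=
    (intervalIntegrable_iff_integrableOn_Ioc_of_le hδ'.le).2 h2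
  rw [intervalIntegrable_inv_iff] at h3
  rcases h3 with h3 | h3
  · exact hδ'.ne h3
  · exact h3 left_mem_uIcc

lemma IsWeight.hasDerivAt (hb : IsWeight b) {r : ℝ} (hr : 0 < r) : HasDerivAt b (deriv b r) r :=
  ((hb.contDiffOn.differentiableOn (by simp)).differentiableAt (Ioi_mem_nhds hr)).hasDerivAt

/-- The pointwise Young inequality behind the radial estimate; where `b` vanishes, so does its
derivative. -/
lemma IsWeight.young (hb : IsWeight b) {r : ℝ} (hr : 0 < r) (x y : ℝ) :
    -(deriv b r * r * (x * y)) - b r * x ^ 2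
      ≤ deriv (fun r => √(b r)) r ^ 2 * r ^ 2 * y ^ 2 := by
  rcases (hb.nonneg r hr).eq_or_lt with h0 | h0
  · have hmin : IsLocalMin b r := by
      filter_upwards [Ioi_mem_nhds hr] with s hs
      rw [← h0]; exact hb.nonneg s hs
    rw [hmin.deriv_eq_zero, ← h0]
    have : 0 ≤ deriv (fun r => √(b r)) r ^ 2 * r ^ 2 * y ^ 2 := by positivity
    linarith
  · have h1 := ((hb.hasDerivAt hr).sqrt h0.ne').deriv
    set w := √(b r) with hw
    have hw0 : 0 < w := Real.sqrt_pos.2 h0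
    have hw2 : b r = w ^ 2 := (Real.sq_sqrt h0.le).symm
    set s := deriv (fun r => √(b r)) r
    have hb' : deriv b r = 2 * w * s := by rw [h1]; field_simp
    rw [hb', hw2]
    nlinarith [sq_nonneg (w * x + s * r * y)]

/-- The radial estimate on a finite interval, with boundary terms. -/
lemma radial_interval (hf : IsTame f) (hb : IsWeight b)
    (hI : IntegrableOn (fun r => deriv (fun r => √(b r)) r ^ 2 * r ^ 2 * slice (angularSq f) r)
      (Ioi 0)) {ε R : ℝ} (hε : 0 < ε) (hR : ε ≤ R) :
    -∫ r in ε..R, b r * slice (termX (logF f)) r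
      ≤ 2 * (∫ r in Ioi (0 : ℝ),
          deriv (fun r => √(b r)) r ^ 2 * r ^ 2 * slice (angularSq f) r)
        + 2 * (|b R * (R * slice (crossX f) R)| + |b ε * (ε * slice (crossX f) ε)|) := by
  have hpos : ∀ x ∈ uIcc ε R, 0 < x := fun x hx => by
    rw [uIcc_of_le hR] at hx; exact hε.trans_le hx.1
  have hcX := hf.rapidR_crossX.rapid
  have hcc := hf.contDiff_crossX
  have hsub : uIcc ε R ⊆ Ioi 0 := fun x hx => hpos x hx
  -- `A' = (r ↦ r · slice (crossX f) r)'`, since `crossX` is differentiated by the Euler field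
  let A : ℝ → ℝ := fun r => r * slice (crossX f) r
  let A' : ℝ → ℝ := fun r => slice (crossX f) r + slice (der fX (crossX f)) r
  have hA : ∀ x ∈ uIcc ε R, HasDerivAt A (A' x) x := fun x hx => by
    have h1 := (hasDerivAt_id x).mul (hasDerivAt_slice hcc hcX hf.rapidR_der_crossX (hpos x hx))
    have h2 : (1 * slice (crossX f) x + id x * (x⁻¹ * slice (der fX (crossX f)) x)) = A' x := by
      simp only [A', id, one_mul, mul_inv_cancel_left₀ (hpos x hx).ne']
    rw [h2] at h1; exact h1
  have hcont1 : Continuous (slice (crossX f)) := slice_continuous hcX hcc.continuous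
  have hcont2 : Continuous (slice (der fX (crossX f))) :=
    slice_continuous hf.rapidR_der_crossX (contDiff_der contDiff_fX hcc).continuous
  have hcont3 : Continuous (slice (mixedSq f)) :=
    slice_continuous hf.rapidR_mixedSq.rapid hf.continuous_mixed.1
  have hA'c : Continuous A' := hcont1.add hcont2
  have hAc : Continuous A := continuous_id.mul hcont1
  have hbc : ContinuousOn b (uIcc ε R) := hb.contDiffOn.continuousOn.mono hsub
  have hb'c : ContinuousOn (deriv b) (uIcc ε R) :=
    (hb.contDiffOn.continuousOn_deriv_of_isOpen isOpen_Ioi (by simp)).mono hsub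
  have hibp := intervalIntegral.integral_mul_deriv_eq_deriv_mul (a := ε) (b := R) (u := b)
    (v := A) (u' := deriv b) (v' := A') (fun x hx => hb.hasDerivAt (hpos x hx)) hA
    hb'c.intervalIntegrable hA'c.continuousOn.intervalIntegrable
  have i1 : IntervalIntegrable (fun r => b r * A' r) volume ε R :=
    (hbc.mul hA'c.continuousOn).intervalIntegrable
  have i2 : IntervalIntegrable (fun r => b r * slice (mixedSq f) r) volume ε R :=
    (hbc.mul hcont3.continuousOn).intervalIntegrable
  have i3 : IntervalIntegrable (fun r => deriv b r * A r) volume ε R :=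
    (hb'c.mul hAc.continuousOn).intervalIntegrable
  have e1 : ∫ r in ε..R, b r * slice (termX (logF f)) r
      = 2 * (∫ r in ε..R, b r * A' r) + 2 * ∫ r in ε..R, b r * slice (mixedSq f) r := by
    rw [← intervalIntegral.integral_const_mul, ← intervalIntegral.integral_const_mul,
      ← intervalIntegral.integral_add (i1.const_mul 2) (i2.const_mul 2)]
    refine intervalIntegral.integral_congr fun r _ => ?_
    simp only [hf.slice_termX, A']
    ring
  have e2 : (∫ r in ε..R, deriv b r * A r) - ∫ r in ε..R, b r * slice (mixedSq f) r
      ≤ ∫ r in Ioi (0 : ℝ), deriv (fun r => √(b r)) r ^ 2 * r ^ 2 * slice (angularSq f) r := by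
    have hnn : ∀ r, 0 ≤ slice (angularSq f) r := slice_nonneg fun p =>
      mul_nonneg (liftF_pos p).le (Finset.sum_nonneg fun k _ => sq_nonneg _)
    have hsub2 : Ioc ε R ⊆ Ioi 0 := fun x hx => hε.trans hx.1
    rw [← intervalIntegral.integral_sub i3 i2, intervalIntegral.integral_of_le hR]
    refine le_trans (setIntegral_mono_on (g := fun r =>
      deriv (fun r => √(b r)) r ^ 2 * r ^ 2 * slice (angularSq f) r)
      (by have := i3.sub i2; exact (intervalIntegrable_iff_integrableOn_Ioc_of_le hR).1 this)
      (hI.mono_set hsub2) measurableSet_Ioc fun r hr => ?_)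
      (setIntegral_mono_set hI (Filter.Eventually.of_forall fun r =>
        mul_nonneg (by positivity) (hnn r)) hsub2.eventuallyLE)
    have hr0 : 0 < r := hsub2 hr
    have m1 := hf.rapidR_mixedMul.rapid
    have m2 := hf.rapidR_mixedSq.rapid
    have m3 := hf.rapidR_angularSq.rapid
    obtain ⟨c2, c1, c3⟩ := hf.continuous_mixed
    have hA2 : deriv b r * A r - b r * slice (mixedSq f) r
        = slice (fun p => -(deriv b r * r) * mixedMul f p + -(b r) * mixedSq f p) r := by
      rw [slice_add (m1.const_mul _) (continuous_const.mul c1) (m2.const_mul _)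
        (continuous_const.mul c2), slice_const_mul, slice_const_mul]
      simp only [A, hf.slice_crossX]
      ring
    rw [hA2, ← slice_const_mul]
    refine slice_mono ((m1.const_mul _).add (m2.const_mul _))
      ((continuous_const.mul c1).add (continuous_const.mul c2)) (m3.const_mul _)
      (continuous_const.mul c3) r fun p => ?_
    have hsum : -(deriv b r * r) * (∑ k, der (fL k) (der fX (logF f)) p * der (fL k) (logF f) p)
        + -(b r) * (∑ k, der (fL k) (der fX (logF f)) p ^ 2)
        ≤ deriv (fun r => √(b r)) r ^ 2 * r ^ 2 * ∑ k, der (fL k) (logF f) p ^ 2 := by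
      rw [Finset.mul_sum, Finset.mul_sum, Finset.mul_sum, ← Finset.sum_add_distrib]
      refine Finset.sum_le_sum fun k _ => ?_
      have := hb.young hr0 (der (fL k) (der fX (logF f)) p) (der (fL k) (logF f) p)
      linarith
    have := mul_le_mul_of_nonneg_left hsum (liftF_pos (f := f) p).le
    simp only [mixedMul, mixedSq, angularSq]
    linarith
  have hbd1 := neg_abs_le (b R * A R)
  have hbd2 := le_abs_self (b ε * A ε)
  rw [e1, hibp]
  simp only [A] at hbd1 hbd2 e2 ⊢
  linarith

/-- The radial estimate: the boundary terms vanish along suitable radii. -/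
lemma radial_le (hf : IsTame f) (hb : IsWeight b)
    (hI : IntegrableOn (fun r => deriv (fun r => √(b r)) r ^ 2 * r ^ 2 * slice (angularSq f) r)
      (Ioi 0)) :
    -∫ r in Ioi (0 : ℝ), b r * slice (termX (logF f)) r
      ≤ 2 * ∫ r in Ioi (0 : ℝ),
          deriv (fun r => √(b r)) r ^ 2 * r ^ 2 * slice (angularSq f) r := by
  have hint := (hf.rapidR_termX.integral_coord hb hf.continuous_termX).1
  obtain ⟨D, M, hgrow⟩ := hb.growth
  obtain ⟨C₀, hC₀, h₀⟩ := slice_norm_le hf.rapidR_crossX 0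
  obtain ⟨C₁, hC₁, h₁⟩ := slice_norm_le hf.rapidR_crossX (M + 6)
  -- inner radii `ε n`, along which the boundary term at zero tends to zero
  have hex : ∀ n : ℕ, ∃ ε, 0 < ε ∧ ε < 1 / ((n : ℝ) + 1) ∧ b ε * ε ^ 5 ≤ 1 / ((n : ℝ) + 1) :=
    fun n => hb.exists_small (by positivity) (by positivity)
  choose ε hε0 hε1 hε2 using hex
  let R : ℕ → ℝ := fun n => (n : ℝ) + 1
  have hR1 : ∀ n, 1 ≤ R n := fun n => by simp [R]
  have hεR : ∀ n, ε n ≤ R n := fun n => by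
    have : 1 / ((n : ℝ) + 1) ≤ 1 := by
      rw [div_le_one (by positivity)]; linarith [(Nat.cast_nonneg n : (0 : ℝ) ≤ n)]
    linarith [hε1 n, hR1 n]
  have hlim0 : Filter.Tendsto (fun n : ℕ => 1 / ((n : ℝ) + 1)) Filter.atTop (nhds 0) :=
    tendsto_one_div_add_atTop_nhds_zero_nat
  have hεlim : Filter.Tendsto ε Filter.atTop (nhds 0) :=
    squeeze_zero (fun n => (hε0 n).le) (fun n => (hε1 n).le) hlim0
  have hRlim : Filter.Tendsto R Filter.atTop Filter.atTop :=
    Filter.tendsto_atTop_add_const_right _ _ tendsto_natCast_atTop_atTop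
  have hb1 : Filter.Tendsto (fun n => |b (ε n) * (ε n * slice (crossX f) (ε n))|)
      Filter.atTop (nhds 0) := by
    have : Filter.Tendsto (fun n : ℕ => C₀ * (1 / ((n : ℝ) + 1))) Filter.atTop (nhds 0) := by
      simpa using hlim0.const_mul C₀
    refine squeeze_zero (fun n => abs_nonneg _) (fun n => ?_) this
    have hp := hε0 n
    have hbn := hb.nonneg _ hp
    have h2 := h₀ _ hp
    simp only [pow_zero, div_one] at h2
    rw [abs_mul, abs_mul, abs_of_nonneg hbn, abs_of_pos hp]
    calc b (ε n) * (ε n * |slice (crossX f) (ε n)|) ≤ b (ε n) * (ε n * (C₀ * ε n ^ 4)) := by gcongr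
      _ = C₀ * (b (ε n) * ε n ^ 5) := by ring
      _ ≤ _ := by gcongr; exact hε2 n
  have hb2 : Filter.Tendsto (fun n => |b (R n) * (R n * slice (crossX f) (R n))|)
      Filter.atTop (nhds 0) := by
    have : Filter.Tendsto (fun n : ℕ => |D| * C₁ * (1 / ((n : ℝ) + 1))) Filter.atTop (nhds 0) := by
      simpa using hlim0.const_mul (|D| * C₁)
    refine squeeze_zero (fun n => abs_nonneg _) (fun n => ?_) this
    have h1 := hR1 n
    have hp : 0 < R n := by linarith
    have hbn := hb.nonneg _ hp
    have h2 := h₁ _ hp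
    have h3 : b (R n) ≤ |D| * R n ^ M :=
      (hgrow _ h1).trans (by gcongr; exact le_abs_self D)
    rw [abs_mul, abs_mul, abs_of_nonneg hbn, abs_of_pos hp]
    have h4 : R n ^ (M + 6) ≤ (1 + R n) ^ (M + 6) := by gcongr; linarith
    calc b (R n) * (R n * |slice (crossX f) (R n)|)
        ≤ (|D| * R n ^ M) * (R n * (C₁ * (R n ^ 4 / (1 + R n) ^ (M + 6)))) := by gcongr
      _ ≤ (|D| * R n ^ M) * (R n * (C₁ * (R n ^ 4 / R n ^ (M + 6)))) := by gcongr
      _ = |D| * C₁ * (1 / R n) := by field_simp; ring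
  have hcov : AECover ((volume : Measure ℝ).restrict (Ioi 0)) Filter.atTop
      (fun n => Ioc (ε n) (R n)) :=
    ⟨by
      filter_upwards [ae_restrict_mem measurableSet_Ioi] with x hx
      filter_upwards [hεlim.eventually (gt_mem_nhds hx), hRlim.eventually_ge_atTop x] with n h1 h2
      exact ⟨h1, h2⟩, fun n => measurableSet_Ioc⟩
  have hlimI := hcov.integral_tendsto_of_countably_generated hint
  have hEq : ∀ n, ∫ x in Ioc (ε n) (R n), b x * slice (termX (logF f)) x
      ∂((volume : Measure ℝ).restrict (Ioi 0))
      = ∫ r in ε n..R n, b r * slice (termX (logF f)) r := fun n => by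
    have hss : Ioc (ε n) (R n) ⊆ Ioi 0 := fun x hx => (hε0 n).trans hx.1
    rw [intervalIntegral.integral_of_le (hεR n), Measure.restrict_restrict measurableSet_Ioc,
      inter_eq_self_of_subset_left hss]
  simp only [hEq] at hlimI
  have hlimR := (((hb2.add hb1).const_mul 2).const_add (2 * ∫ r in Ioi (0 : ℝ),
          deriv (fun r => √(b r)) r ^ 2 * r ^ 2 * slice (angularSq f) r))
  rw [add_zero, mul_zero, add_zero] at hlimR
  exact le_of_tendsto_of_tendsto' hlimI.neg hlimR fun n =>
    radial_interval hf hb hI (hε0 n) (hεR n)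

end

section

/-! ### The dissipation inequality in the coordinates `(z, r, σ)` -/

variable {b : ℝ → ℝ} {f : E3 → ℝ}

lemma IsTame.log_bar (hf : IsTame f) (z : E3) (r : ℝ) :
    (fun σ => Real.log (bar (tensorSq f) z r σ)) = fun σ => logF f (z, r • σ) := by
  funext σ
  rw [bar, tensorSq, Real.log_mul (hf.pos _).ne' (hf.pos _).ne']
  rfl

lemma IsTame.bar_eq (hf : IsTame f) (z : E3) (r : ℝ) (σ : E3) :
    bar (tensorSq f) z r σ = liftF f (z, r • σ) :=
  (congrFun hf.exp_logF (z, r • σ)).symm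

/-- The integrand `β Γ₂(ln F̄) F̄`, written through rotations. -/
lemma IsTame.gammaDensity_eq (hf : IsTame f) (q : E3 × ℝ × S2) :
    gammaDensity b (tensorSq f) q = b q.2.1 * gammaF f (q.1, q.2.1 • (q.2.2 : E3)) := by
  have hu := hf.contDiff_logF
  have hU : ContDiff ℝ ∞ fun y => logF f (q.1, y) := hu.comp (contDiff_const.prodMk contDiff_id)
  rw [gammaDensity, hf.log_bar, hf.bar_eq, Gamma2_eq (U := fun y => logF f (q.1, y)) hU, gammaF]
  simp only [rot_slice hu, rot_slice (contDiff_der (contDiff_fL _) hu)]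
  rw [Finset.sum_comm]
  ring

/-- The integrand `((√β)')² |∇_σ ln F̄|² F̄ r²`, written through rotations. -/
lemma IsTame.radialDensity_eq (hf : IsTame f) (q : E3 × ℝ × S2) :
    radialDensity b (tensorSq f) q
      = deriv (fun r => √(b r)) q.2.1 ^ 2 * q.2.1 ^ 2
        * angularSq f (q.1, q.2.1 • (q.2.2 : E3)) := by
  have hu := hf.contDiff_logF
  have hU : ContDiff ℝ ∞ fun y => logF f (q.1, y) := hu.comp (contDiff_const.prodMk contDiff_id)
  rw [radialDensity, hf.log_bar, hf.bar_eq,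
    (norm_sphGrad_sq (U := fun y => logF f (q.1, y)) hU _ _).1, angularSq]
  simp only [rot_slice hu]
  ring

lemma IsTame.integrable_gammaDensity (hf : IsTame f) (hb : IsWeight b) :
    Integrable (gammaDensity b (tensorSq f)) coordMeasure :=
  (hf.rapidR_gammaF.integrable_coord hb hf.continuous_gammaF).congr
    (Filter.Eventually.of_forall fun q => (hf.gammaDensity_eq q).symm)

/-- The sum of the three directional terms is controlled by the `Γ₂` term and the radial term. -/
lemma dissipation_le (hf : IsTame f) (hb : IsWeight b) :
    ((-2 * ∫ q, b q.2.1 * (termZ (logF f) (q.1, q.2.1 • (q.2.2 : E3))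
        + termX (logF f) (q.1, q.2.1 • (q.2.2 : E3))
        + termL (logF f) (q.1, q.2.1 • (q.2.2 : E3))) ∂coordMeasure : ℝ) : EReal)
      ≤ 4 * (-((∫ p, gammaDensity b (tensorSq f) p ∂coordMeasure : ℝ) : EReal)
        + ((∫⁻ p, ENNReal.ofReal (radialDensity b (tensorSq f) p) ∂coordMeasure : ℝ≥0∞)
          : EReal)) := by
  obtain ⟨-, iZ⟩ := hf.rapidR_termZ.integral_coord hb hf.continuous_termZ
  obtain ⟨-, iX⟩ := hf.rapidR_termX.integral_coord hb hf.continuous_termX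
  obtain ⟨-, iL⟩ := hf.rapidR_termL.integral_coord hb hf.continuous_termL
  obtain ⟨-, iG⟩ := hf.rapidR_gammaF.integral_coord hb hf.continuous_gammaF
  have hsum : ∫ q, b q.2.1 * (termZ (logF f) (q.1, q.2.1 • (q.2.2 : E3))
        + termX (logF f) (q.1, q.2.1 • (q.2.2 : E3))
        + termL (logF f) (q.1, q.2.1 • (q.2.2 : E3))) ∂coordMeasure
      = (∫ r in Ioi (0 : ℝ), b r * slice (termZ (logF f)) r)
        + (∫ r in Ioi (0 : ℝ), b r * slice (termX (logF f)) r)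
        + 2 * ∫ p, gammaDensity b (tensorSq f) p ∂coordMeasure := by
    have jZ := hf.rapidR_termZ.integrable_coord hb hf.continuous_termZ
    have jX := hf.rapidR_termX.integrable_coord hb hf.continuous_termX
    have jL := hf.rapidR_termL.integrable_coord hb hf.continuous_termL
    have jZX : Integrable (fun q : E3 × ℝ × S2 =>
        b q.2.1 * termZ (logF f) (q.1, q.2.1 • (q.2.2 : E3))
          + b q.2.1 * termX (logF f) (q.1, q.2.1 • (q.2.2 : E3))) coordMeasure := jZ.add jX
    simp only [mul_add]
    rw [integral_add jZX jL, integral_add jZ jX, iZ, iX, iL]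
    simp only [hf.gammaDensity_eq, iG]
    rw [← integral_const_mul]
    simp only [hf.slice_termL]
    congr 1
    exact integral_congr_ae (Filter.Eventually.of_forall fun r => by ring)
  have hZ : 0 ≤ ∫ r in Ioi (0 : ℝ), b r * slice (termZ (logF f)) r :=
    setIntegral_nonneg measurableSet_Ioi fun r hr =>
      mul_nonneg (hb.nonneg r hr) (hf.slice_termZ_nonneg r)
  have h4 : (4 : EReal) = ((4 : ℝ) : EReal) := rfl
  by_cases htop : ∫⁻ p, ENNReal.ofReal (radialDensity b (tensorSq f) p) ∂coordMeasure = ⊤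
  · rw [htop, EReal.coe_ennreal_top, ← EReal.coe_neg, EReal.coe_add_top, h4,
      EReal.coe_mul_top_of_pos (by norm_num)]
    exact le_top
  · have hnn : ∀ q, 0 ≤ radialDensity b (tensorSq f) q := fun q => by
      rw [hf.radialDensity_eq]
      exact mul_nonneg (by positivity) (mul_nonneg (liftF_pos _).le
        (Finset.sum_nonneg fun k _ => sq_nonneg _))
    have hmeas : AEStronglyMeasurable (radialDensity b (tensorSq f)) coordMeasure := by
      have h1 : Measurable (deriv fun r => √(b r)) := measurable_deriv _
      have h2 : Measurable fun q : E3 × ℝ × S2 => angularSq f (q.1, q.2.1 • (q.2.2 : E3)) := by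
        have := hf.continuous_mixed.2.2
        exact (by fun_prop : Continuous fun q : E3 × ℝ × S2 =>
          angularSq f (q.1, q.2.1 • (q.2.2 : E3))).measurable
      have h3 : radialDensity b (tensorSq f) = fun q => deriv (fun r => √(b r)) q.2.1 ^ 2
          * q.2.1 ^ 2 * angularSq f (q.1, q.2.1 • (q.2.2 : E3)) := funext hf.radialDensity_eq
      rw [h3]
      exact (by fun_prop : Measurable _).aestronglyMeasurable
    have hint : Integrable (radialDensity b (tensorSq f)) coordMeasure :=
      ⟨hmeas, (hasFiniteIntegral_iff_ofReal (Filter.Eventually.of_forall hnn)).2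
        (lt_top_iff_ne_top.2 htop)⟩
    obtain ⟨hI, hE⟩ := integral_coord_radial hint
    simp only [hf.radialDensity_eq, integral_const_mul] at hI hE
    have hrad := radial_le hf hb hI
    rw [← ofReal_integral_eq_lintegral_ofReal hint (Filter.Eventually.of_forall hnn),
      EReal.coe_ennreal_ofReal, max_eq_left (integral_nonneg hnn), h4, ← EReal.coe_neg,
      ← EReal.coe_add, ← EReal.coe_mul, EReal.coe_le_coe_iff, hsum]
    simp only [hf.radialDensity_eq, hE]
    simp only [slice] at hrad hZ ⊢
    linarith

end

section

/-! ### Families with uniform decay, and convolution with tempered kernels -/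

/-- The partial derivative `∂_j`. -/
def pd (j : Fin 3) (g : E3 → ℝ) (v : E3) : ℝ := fderiv ℝ g v (bv j)

variable {ι : Type*} {g h : ι → E3 → ℝ} {κ : E3 → ℝ}

/-- A family of functions decaying faster than any power, uniformly in the index. -/
def RapFam (g : ι → E3 → ℝ) : Prop := ∀ k : ℕ, ∃ C : ℝ, 0 ≤ C ∧ ∀ i v, |g i v| * (1 + ‖v‖) ^ k ≤ C

/-- A family that is bounded in Schwartz space. -/
structure SchwFam (g : ι → E3 → ℝ) : Prop where
  smooth : ∀ i, ContDiff ℝ ∞ (g i)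
  decay : ∀ k n : ℕ, ∃ C : ℝ, ∀ i v, ‖v‖ ^ k * ‖iteratedFDeriv ℝ n (g i) v‖ ≤ C

lemma SchwFam.pd (hg : SchwFam g) (j : Fin 3) : SchwFam fun i => pd j (g i) := by
  refine ⟨fun i => contDiff_fderiv_apply (hg.smooth i) _, fun k n => ?_⟩
  obtain ⟨C, hC⟩ := hg.decay k (n + 1)
  refine ⟨C * ‖ContinuousLinearMap.apply ℝ ℝ (bv j)‖, fun i v => ?_⟩
  have h1 := (ContinuousLinearMap.apply ℝ ℝ (bv j)).norm_iteratedFDeriv_comp_left (x := v) (n := n)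
    (((hg.smooth i).fderiv_right (m := ∞) (by simp)).contDiffAt) (by exact_mod_cast le_top)
  rw [norm_iteratedFDeriv_fderiv] at h1
  calc ‖v‖ ^ k * ‖iteratedFDeriv ℝ n (Landau.pd j (g i)) v‖
      ≤ ‖v‖ ^ k * (‖ContinuousLinearMap.apply ℝ ℝ (bv j)‖ * ‖iteratedFDeriv ℝ (n + 1) (g i) v‖) :=
        mul_le_mul_of_nonneg_left h1 (by positivity)
    _ = (‖v‖ ^ k * ‖iteratedFDeriv ℝ (n + 1) (g i) v‖)
        * ‖ContinuousLinearMap.apply ℝ ℝ (bv j)‖ := by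
        ring
    _ ≤ _ := mul_le_mul_of_nonneg_right (hC i v) (by positivity)

lemma SchwFam.norm_decay (hg : SchwFam g) (n k : ℕ) :
    ∃ C : ℝ, 0 ≤ C ∧ ∀ i v, ‖iteratedFDeriv ℝ n (g i) v‖ * (1 + ‖v‖) ^ k ≤ C := by
  obtain ⟨C, hC⟩ := hg.decay 0 n
  obtain ⟨D, hD⟩ := hg.decay k n
  refine ⟨2 ^ k * (|C| + |D|), by positivity, fun i v => ?_⟩
  have h1 : (1 + ‖v‖) ^ k ≤ 2 ^ k * (1 + ‖v‖ ^ k) := by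
    have h2 : 1 + ‖v‖ ≤ 2 * max 1 ‖v‖ := by
      linarith [le_max_left 1 ‖v‖, le_max_right 1 ‖v‖]
    calc (1 + ‖v‖) ^ k ≤ (2 * max 1 ‖v‖) ^ k := by gcongr
      _ = 2 ^ k * max 1 ‖v‖ ^ k := mul_pow _ _ _
      _ ≤ _ := by
        gcongr
        rcases max_choice 1 ‖v‖ with h | h <;> rw [h]
        · simp
        · linarith
  calc _ ≤ ‖iteratedFDeriv ℝ n (g i) v‖ * (2 ^ k * (1 + ‖v‖ ^ k)) := by gcongr
    _ = 2 ^ k * (‖v‖ ^ 0 * ‖iteratedFDeriv ℝ n (g i) v‖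
        + ‖v‖ ^ k * ‖iteratedFDeriv ℝ n (g i) v‖) := by ring
    _ ≤ _ := by
      gcongr
      · exact (hC i v).trans (le_abs_self _)
      · exact (hD i v).trans (le_abs_self _)

lemma SchwFam.rap (hg : SchwFam g) : RapFam g := by
  intro k
  obtain ⟨C, hC, h⟩ := hg.norm_decay 0 k
  refine ⟨C, hC, fun i v => ?_⟩
  simpa using h i v

lemma RapFam.add (hg : RapFam g) (hh : RapFam h) : RapFam fun i v => g i v + h i v := by
  intro k
  obtain ⟨C, hC, h1⟩ := hg k
  obtain ⟨D, hD, h2⟩ := hh k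
  refine ⟨C + D, by positivity, fun i v => ?_⟩
  calc _ ≤ (|g i v| + |h i v|) * (1 + ‖v‖) ^ k := by gcongr; exact abs_add_le _ _
    _ = |g i v| * (1 + ‖v‖) ^ k + |h i v| * (1 + ‖v‖) ^ k := by ring
    _ ≤ _ := add_le_add (h1 i v) (h2 i v)

lemma RapFam.neg (hg : RapFam g) : RapFam fun i v => -g i v := by
  intro k
  obtain ⟨C, hC, h1⟩ := hg k
  exact ⟨C, hC, fun i v => by simpa using h1 i v⟩

lemma RapFam.sub (hg : RapFam g) (hh : RapFam h) : RapFam fun i v => g i v - h i v := by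
  simpa only [sub_eq_add_neg] using hg.add hh.neg

lemma RapFam.sum {τ : Type*} (s : Finset τ) {g : τ → ι → E3 → ℝ} (hg : ∀ j, RapFam (g j)) :
    RapFam fun i v => ∑ j ∈ s, g j i v := by
  classical
  induction s using Finset.induction_on with
  | empty => exact fun k => ⟨0, le_rfl, fun i v => by simp⟩
  | insert a s ha ih =>
    simp only [Finset.sum_insert ha]
    exact (hg a).add ih

/-- The product of a rapidly decaying family with a uniformly polynomially growing one. -/
lemma RapFam.mul_poly (hg : RapFam g) {C : ℝ} {N : ℕ} (hh : ∀ i v, |h i v| ≤ C * (1 + ‖v‖) ^ N) :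
    RapFam fun i v => g i v * h i v := by
  intro k
  obtain ⟨D, hD, h1⟩ := hg (k + N)
  refine ⟨D * |C|, by positivity, fun i v => ?_⟩
  rw [abs_mul]
  calc |g i v| * |h i v| * (1 + ‖v‖) ^ k
      ≤ |g i v| * (|C| * (1 + ‖v‖) ^ N) * (1 + ‖v‖) ^ k := by
        gcongr
        exact (hh i v).trans (by gcongr; exact le_abs_self C)
    _ = (|g i v| * (1 + ‖v‖) ^ (k + N)) * |C| := by ring
    _ ≤ _ := mul_le_mul_of_nonneg_right (h1 i v) (abs_nonneg _)

/-- A common integrable majorant of a rapidly decaying family. -/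
lemma RapFam.le_majorant (hg : RapFam g) :
    ∃ C : ℝ, ∀ i v, |g i v| ≤ C * ((1 + ‖v‖) ^ 4)⁻¹ := by
  obtain ⟨C, -, h1⟩ := hg 4
  refine ⟨C, fun i v => ?_⟩
  rw [← div_eq_mul_inv, le_div_iff₀ (by positivity)]
  exact h1 i v

lemma RapFam.integrable (hg : RapFam g) (i : ι) (hm : AEStronglyMeasurable (g i) volume) :
    Integrable (g i) := by
  obtain ⟨C, h⟩ := hg.le_majorant
  exact (integrable_inv_one_add_norm.const_mul C).mono' hm (Filter.Eventually.of_forall (h i))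

/-- A kernel that is integrable against some negative power of `1 + |Y|`. -/
structure IsKernel (κ : E3 → ℝ) : Prop where
  measurable : Measurable κ
  integrable : ∃ K : ℕ, Integrable fun Y => |κ Y| * ((1 + ‖Y‖) ^ K)⁻¹

/-- The convolution `κ * g`. -/
def conv (κ g : E3 → ℝ) (v : E3) : ℝ := ∫ Y, κ Y * g (v - Y)

/-- Peetre's inequality. -/
lemma inv_pow_shift (v Y : E3) (K : ℕ) :
    ((1 + ‖v - Y‖) ^ K)⁻¹ ≤ (1 + ‖v‖) ^ K * ((1 + ‖Y‖) ^ K)⁻¹ := by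
  have h1 : 1 + ‖Y‖ ≤ (1 + ‖v‖) * (1 + ‖v - Y‖) := by
    have h2 : ‖Y‖ ≤ ‖v‖ + ‖v - Y‖ := by
      have := norm_sub_le v (v - Y); rwa [sub_sub_cancel] at this
    nlinarith [mul_nonneg (norm_nonneg v) (norm_nonneg (v - Y))]
  rw [← div_eq_mul_inv, le_div_iff₀ (by positivity), inv_mul_le_iff₀ (by positivity), mul_comm,
    ← mul_pow]
  gcongr

lemma IsKernel.bound (hg : RapFam g) (K : ℕ) : ∃ C : ℝ, 0 ≤ C ∧ ∀ i v Y,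
    ‖κ Y * g i (v - Y)‖ ≤ C * (1 + ‖v‖) ^ K * (|κ Y| * ((1 + ‖Y‖) ^ K)⁻¹) := by
  obtain ⟨C, hC, h⟩ := hg K
  refine ⟨C, hC, fun i v Y => ?_⟩
  rw [norm_mul, Real.norm_eq_abs, Real.norm_eq_abs]
  have h1 : |g i (v - Y)| ≤ C * ((1 + ‖v - Y‖) ^ K)⁻¹ := by
    rw [← div_eq_mul_inv, le_div_iff₀ (by positivity)]
    exact h i _
  calc |κ Y| * |g i (v - Y)| ≤ |κ Y| * (C * ((1 + ‖v‖) ^ K * ((1 + ‖Y‖) ^ K)⁻¹)) := by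
        gcongr
        exact h1.trans (by gcongr; exact inv_pow_shift v Y K)
    _ = _ := by ring

lemma IsKernel.integrable_conv (hκ : IsKernel κ) (hg : SchwFam g) (i : ι) (v : E3) :
    Integrable fun Y => κ Y * g i (v - Y) := by
  obtain ⟨K, hK⟩ := hκ.integrable
  obtain ⟨C, hC, h⟩ := IsKernel.bound (κ := κ) hg.rap K
  have hc := (hg.smooth i).continuous
  have hm := hκ.measurable
  exact (hK.const_mul (C * (1 + ‖v‖) ^ K)).mono'
    (hm.mul (by fun_prop : Continuous fun Y => g i (v - Y)).measurable).aestronglyMeasurable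
    (Filter.Eventually.of_forall (h i v))

lemma IsKernel.conv_bound (hκ : IsKernel κ) (hg : SchwFam g) :
    ∃ (C : ℝ) (K : ℕ), ∀ i v, |conv κ (g i) v| ≤ C * (1 + ‖v‖) ^ K := by
  obtain ⟨K, hK⟩ := hκ.integrable
  obtain ⟨C, hC, h⟩ := IsKernel.bound (κ := κ) hg.rap K
  refine ⟨C * ∫ Y, |κ Y| * ((1 + ‖Y‖) ^ K)⁻¹, K, fun i v => ?_⟩
  have := norm_integral_le_of_norm_le (hK.const_mul (C * (1 + ‖v‖) ^ K))
    (Filter.Eventually.of_forall (h i v))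
  rw [integral_const_mul] at this
  rw [← Real.norm_eq_abs]
  exact this.trans_eq (by ring)

lemma IsKernel.hasFDerivAt_conv (hκ : IsKernel κ) (hg : SchwFam g) (i : ι) (v : E3) :
    HasFDerivAt (conv κ (g i)) (∫ Y, κ Y • fderiv ℝ (g i) (v - Y)) v ∧
      Integrable fun Y => κ Y • fderiv ℝ (g i) (v - Y) := by
  obtain ⟨K, hK⟩ := hκ.integrable
  obtain ⟨C, hC, h⟩ := hg.norm_decay 1 K
  have hm := hκ.measurable
  have hd := (hg.smooth i).fderiv_right (m := ∞) (by simp)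
  have hdc := hd.continuous
  have hb : ∀ v Y, ‖κ Y • fderiv ℝ (g i) (v - Y)‖
      ≤ C * (1 + ‖v‖) ^ K * (|κ Y| * ((1 + ‖Y‖) ^ K)⁻¹) := by
    intro v Y
    have h1 := h i (v - Y)
    rw [← norm_iteratedFDeriv_fderiv, norm_iteratedFDeriv_zero, ← le_div_iff₀ (by positivity),
      div_eq_mul_inv] at h1
    rw [norm_smul, Real.norm_eq_abs]
    calc |κ Y| * ‖fderiv ℝ (g i) (v - Y)‖
        ≤ |κ Y| * (C * ((1 + ‖v‖) ^ K * ((1 + ‖Y‖) ^ K)⁻¹)) := by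
          gcongr
          exact h1.trans (by gcongr; exact inv_pow_shift v Y K)
      _ = _ := by ring
  have hmeas : ∀ v, AEStronglyMeasurable (fun Y => κ Y • fderiv ℝ (g i) (v - Y)) volume := fun v =>
    hm.aestronglyMeasurable.smul
      (by fun_prop : Continuous fun Y => fderiv ℝ (g i) (v - Y)).aestronglyMeasurable
  refine ⟨?_, (hK.const_mul _).mono' (hmeas v) (Filter.Eventually.of_forall (hb v))⟩
  refine hasFDerivAt_integral_of_dominated_of_fderiv_le
    (bound := fun Y => C * (2 + ‖v‖) ^ K * (|κ Y| * ((1 + ‖Y‖) ^ K)⁻¹))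
    (Metric.ball_mem_nhds v one_pos)
    (Filter.Eventually.of_forall fun x => (hκ.integrable_conv hg i x).aestronglyMeasurable)
    (hκ.integrable_conv hg i v)
    (F' := fun v Y => κ Y • fderiv ℝ (g i) (v - Y)) (hmeas v) ?_ (hK.const_mul _) ?_
  · refine Filter.Eventually.of_forall fun Y x hx => (hb x Y).trans ?_
    have hx' : 1 + ‖x‖ ≤ 2 + ‖v‖ := by
      have h1 := norm_sub_norm_le x v
      rw [← dist_eq_norm] at h1
      have h2 : dist x v < 1 := hx
      linarith
    gcongr
  · refine Filter.Eventually.of_forall fun Y x _ => ?_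
    have h1 : HasFDerivAt (fun x => g i (x - Y)) (fderiv ℝ (g i) (x - Y)) x :=
      (((hg.smooth i).diffAt (x - Y)).hasFDerivAt.comp x
        ((hasFDerivAt_id x).sub_const Y))
    exact h1.const_smul (κ Y)

lemma IsKernel.differentiableAt_conv (hκ : IsKernel κ) (hg : SchwFam g) (i : ι) (v : E3) :
    DifferentiableAt ℝ (conv κ (g i)) v :=
  (hκ.hasFDerivAt_conv hg i v).1.differentiableAt

lemma IsKernel.pd_conv (hκ : IsKernel κ) (hg : SchwFam g) (i : ι) (j : Fin 3) :
    pd j (conv κ (g i)) = conv κ (pd j (g i)) := by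
  funext v
  obtain ⟨h1, h2⟩ := hκ.hasFDerivAt_conv hg i v
  rw [pd, h1.fderiv, ContinuousLinearMap.integral_apply h2]
  rfl

lemma pd_mul {a c : E3 → ℝ} {v : E3} (ha : DifferentiableAt ℝ a v) (hc : DifferentiableAt ℝ c v)
    (j : Fin 3) : pd j (fun v => a v * c v) v = pd j a v * c v + a v * pd j c v := by
  rw [pd, fderiv_fun_mul ha hc]
  simp [pd, smul_eq_mul]; ring

lemma pd_sub {a c : E3 → ℝ} {v : E3} (ha : DifferentiableAt ℝ a v) (hc : DifferentiableAt ℝ c v)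
    (j : Fin 3) : pd j (fun v => a v - c v) v = pd j a v - pd j c v := by
  rw [pd, fderiv_fun_sub ha hc]; rfl

lemma pd_sum {a : Fin 3 → E3 → ℝ} {v : E3} (ha : ∀ i, DifferentiableAt ℝ (a i) v) (j : Fin 3) :
    pd j (fun v => ∑ i, a i v) v = ∑ i, pd j (a i) v := by
  rw [pd, fderiv_fun_sum fun i _ => ha i, sum_apply]; rfl

/-! ### The collision operator in non-divergence form -/

/-- The entries `a_{ij}(Y)` of the Landau matrix. -/
def landauKernel (α : ℝ → ℝ) (i j : Fin 3) (Y : E3) : ℝ :=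
  α ‖Y‖ * (‖Y‖ ^ 2 * (if i = j then 1 else 0) - Y i * Y j)

variable {α : ℝ → ℝ}

lemma landauKernel_comm (i j : Fin 3) : landauKernel α i j = landauKernel α j i := by
  funext Y
  simp only [landauKernel, eq_comm (a := i)]; ring

lemma landauMatrix_apply (Y ξ : E3) (i : Fin 3) :
    landauMatrix α Y ξ i = ∑ j, landauKernel α i j Y * ξ j := by
  simp only [landauMatrix, landauKernel, inner_E3, PiLp.smul_apply, PiLp.sub_apply, smul_eq_mul,
    Fin.sum_univ_three]
  fin_cases i <;> simp <;> ring

lemma IsWeight.integrable_norm (hα : IsWeight α) :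
    ∃ K : ℕ, Integrable fun Y : E3 => α ‖Y‖ * (‖Y‖ ^ 2 / (1 + ‖Y‖) ^ K) := by
  obtain ⟨K, hK⟩ := hα.integrableOn
  refine ⟨K, (integrable_fun_norm_addHaar volume
    (f := fun r => α r * (r ^ 2 / (1 + r) ^ K))).2 ?_⟩
  refine hK.congr_fun (fun r _ => ?_) measurableSet_Ioi
  simp only [finrank_euclideanSpace_fin, smul_eq_mul]
  ring

lemma IsWeight.isKernel (hα : IsWeight α) (i j : Fin 3) : IsKernel (landauKernel α i j) := by
  have hm := hα.measurable
  have hmeas : Measurable (landauKernel α i j) := by unfold landauKernel; fun_prop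
  refine ⟨hmeas, ?_⟩
  obtain ⟨K, h1⟩ := hα.integrable_norm
  refine ⟨K, (h1.norm.const_mul 2).mono' (by fun_prop) (Filter.Eventually.of_forall fun Y => ?_)⟩
  have h2 : |‖Y‖ ^ 2 * (if i = j then 1 else 0) - Y i * Y j| ≤ 2 * ‖Y‖ ^ 2 := by
    have e1 := PiLp.norm_apply_le Y i
    have e2 := PiLp.norm_apply_le Y j
    rw [Real.norm_eq_abs] at e1 e2
    have e3 : |Y i * Y j| ≤ ‖Y‖ ^ 2 := by
      rw [abs_mul, sq]; gcongr
    refine (abs_sub _ _).trans ?_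
    have e4 : |‖Y‖ ^ 2 * (if i = j then (1 : ℝ) else 0)| ≤ ‖Y‖ ^ 2 := by
      split_ifs <;> simp
    linarith
  rw [norm_mul, norm_inv, Real.norm_eq_abs, abs_abs, landauKernel, abs_mul, norm_mul, norm_div]
  simp only [Real.norm_eq_abs, abs_pow, abs_norm]
  rw [abs_of_pos (by positivity : 0 < 1 + ‖Y‖)]
  calc |α ‖Y‖| * |‖Y‖ ^ 2 * (if i = j then 1 else 0) - Y i * Y j| * ((1 + ‖Y‖) ^ K)⁻¹
      ≤ |α ‖Y‖| * (2 * ‖Y‖ ^ 2) * ((1 + ‖Y‖) ^ K)⁻¹ := by gcongr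
    _ = _ := by ring

lemma gradient_apply (a : E3 → ℝ) (v : E3) (j : Fin 3) : ∇ a v j = pd j a v := by
  rw [pd, ← inner_gradient_left, inner_E3]
  simp

/-- The flux in terms of convolutions. -/
lemma landauFlux_apply (hα : IsWeight α) (hg : SchwFam g) (s : ι) (v : E3) (i : Fin 3) :
    landauFlux α (g s) v i = ∑ j, (pd j (g s) v * conv (landauKernel α i j) (g s) v
      - g s v * conv (landauKernel α i j) (pd j (g s)) v) := by
  have e1 : landauFlux α (g s) v
      = ∫ Y, landauMatrix α Y (g s (v - Y) • ∇ (g s) v - g s v • ∇ (g s) (v - Y)) := by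
    rw [landauFlux, ← integral_sub_left_eq_self _ volume v]
    simp only [sub_sub_cancel]
  have e2 : ∀ i Y, landauMatrix α Y (g s (v - Y) • ∇ (g s) v - g s v • ∇ (g s) (v - Y)) i
      = ∑ j, (pd j (g s) v * (landauKernel α i j Y * g s (v - Y))
        - g s v * (landauKernel α i j Y * pd j (g s) (v - Y))) := by
    intro i Y
    rw [landauMatrix_apply]
    refine Finset.sum_congr rfl fun j _ => ?_
    simp only [PiLp.sub_apply, PiLp.smul_apply, gradient_apply, smul_eq_mul]
    ring
  have h1 : ∀ i j, Integrable fun Y => pd j (g s) v * (landauKernel α i j Y * g s (v - Y)) :=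
    fun i j => ((hα.isKernel i j).integrable_conv hg s v).const_mul _
  have h2 : ∀ i j, Integrable fun Y => g s v * (landauKernel α i j Y * pd j (g s) (v - Y)) :=
    fun i j => ((hα.isKernel i j).integrable_conv (hg.pd j) s v).const_mul _
  rw [e1, eval_integral_piLp]
  · simp only [e2]
    have h3 : ∀ i j, Integrable fun Y => pd j (g s) v * (landauKernel α i j Y * g s (v - Y))
        - g s v * (landauKernel α i j Y * pd j (g s) (v - Y)) := fun i j => (h1 i j).sub (h2 i j)
    rw [integral_finsetSum _ fun j _ => h3 i j]
    refine Finset.sum_congr rfl fun j _ => ?_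
    rw [integral_sub (h1 i j) (h2 i j), integral_const_mul, integral_const_mul]
    rfl
  · intro i
    simp only [e2]
    exact integrable_finsetSum _ fun j _ => (h1 i j).sub (h2 i j)

/-- `q(f) = ∑ᵢⱼ (aᵢⱼ * f) ∂ᵢⱼf - f (aᵢⱼ * ∂ᵢⱼf)`: the terms with two first derivatives cancel by
symmetry of the matrix. -/
lemma landauOperator_eq (hα : IsWeight α) (hg : SchwFam g) (s : ι) :
    landauOperator α (g s) = fun v => ∑ i, ∑ j,
      (pd i (pd j (g s)) v * conv (landauKernel α i j) (g s) v
        - g s v * conv (landauKernel α i j) (pd i (pd j (g s))) v) := by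
  funext v
  have hk := fun i j => hα.isKernel i j
  have d1 : ∀ i j, DifferentiableAt ℝ
      (fun v => pd j (g s) v * conv (landauKernel α i j) (g s) v) v :=
    fun i j => (((hg.pd j).smooth s).diffAt v).mul ((hk i j).differentiableAt_conv hg s v)
  have d2 : ∀ i j, DifferentiableAt ℝ
      (fun v => g s v * conv (landauKernel α i j) (pd j (g s)) v) v :=
    fun i j => ((hg.smooth s).diffAt v).mul ((hk i j).differentiableAt_conv (hg.pd j) s v)
  have hcomp : ∀ i, (fun v => landauFlux α (g s) v i) = fun v =>
      ∑ j, (pd j (g s) v * conv (landauKernel α i j) (g s) v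
      - g s v * conv (landauKernel α i j) (pd j (g s)) v) :=
    fun i => funext fun v => landauFlux_apply hα hg s v i
  have hd : DifferentiableAt ℝ (landauFlux α (g s)) v := by
    refine differentiableAt_euclidean.2 fun i => ?_
    rw [hcomp]
    exact DifferentiableAt.fun_sum fun j _ => (d1 i j).sub (d2 i j)
  have key : ∀ i, fderiv ℝ (landauFlux α (g s)) v (bv i) i = ∑ j,
      ((pd i (pd j (g s)) v * conv (landauKernel α i j) (g s) v
          - g s v * conv (landauKernel α i j) (pd i (pd j (g s))) v)
        + (pd j (g s) v * conv (landauKernel α i j) (pd i (g s)) v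
          - pd i (g s) v * conv (landauKernel α j i) (pd j (g s)) v)) := by
    intro i
    have e1 : fderiv ℝ (landauFlux α (g s)) v (bv i) i
        = pd i (fun v => landauFlux α (g s) v i) v := by
      have : HasFDerivAt (fun v => landauFlux α (g s) v i)
          ((EuclideanSpace.proj i : E3 →L[ℝ] ℝ).comp (fderiv ℝ (landauFlux α (g s)) v)) v :=
        (EuclideanSpace.proj i : E3 →L[ℝ] ℝ).hasFDerivAt.comp v hd.hasFDerivAt
      rw [pd, this.fderiv]; rfl
    rw [e1, hcomp, pd_sum fun j => (d1 i j).fun_sub (d2 i j)]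
    refine Finset.sum_congr rfl fun j _ => ?_
    rw [pd_sub (d1 i j) (d2 i j)]
    have e2 := pd_mul (((hg.pd j).smooth s).diffAt v) ((hk i j).differentiableAt_conv hg s v) i
    have e3 := pd_mul ((hg.smooth s).diffAt v) ((hk i j).differentiableAt_conv (hg.pd j) s v) i
    rw [(hk i j).pd_conv hg s] at e2
    rw [(hk i j).pd_conv (hg.pd j) s] at e3
    rw [e2, e3, landauKernel_comm j i]
    ring
  rw [landauOperator, divergence]
  simp only [key, Finset.sum_add_distrib]
  rw [add_eq_left]
  simp only [Finset.sum_sub_distrib]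
  rw [sub_eq_zero, Finset.sum_comm]

lemma SchwFam.rap_mul_conv (hκ : IsKernel κ) (hg : SchwFam g) (hh : SchwFam h) :
    RapFam fun s v => g s v * conv κ (h s) v := by
  obtain ⟨C, K, hC⟩ := hκ.conv_bound hh
  exact hg.rap.mul_poly hC

lemma landauOperator_differentiableAt (hα : IsWeight α) (hg : SchwFam g) (s : ι) (v : E3) :
    DifferentiableAt ℝ (landauOperator α (g s)) v := by
  rw [landauOperator_eq hα hg]
  refine DifferentiableAt.fun_sum fun i _ => DifferentiableAt.fun_sum fun j _ => ?_
  have hk := hα.isKernel i j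
  exact ((((hg.pd j).pd i).smooth s).diffAt v |>.mul (hk.differentiableAt_conv hg s v)).sub
    (((hg.smooth s).diffAt v).mul (hk.differentiableAt_conv ((hg.pd j).pd i) s v))

/-- The collision operator decays rapidly, uniformly over bounded families. -/
lemma landauOperator_rap (hα : IsWeight α) (hg : SchwFam g) :
    RapFam fun s => landauOperator α (g s) := by
  simp only [landauOperator_eq hα hg]
  exact RapFam.sum _ fun i => RapFam.sum _ fun j =>
    (SchwFam.rap_mul_conv (hα.isKernel i j) ((hg.pd j).pd i) hg).sub
      (SchwFam.rap_mul_conv (hα.isKernel i j) hg ((hg.pd j).pd i))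

lemma pd_landauOperator_rap (hα : IsWeight α) (hg : SchwFam g) (l : Fin 3) :
    RapFam fun s => pd l (landauOperator α (g s)) := by
  have hk := fun i j => hα.isKernel i j
  have key : ∀ s, pd l (landauOperator α (g s)) = fun v => ∑ i, ∑ j,
      ((pd l (pd i (pd j (g s))) v * conv (landauKernel α i j) (g s) v
        + pd i (pd j (g s)) v * conv (landauKernel α i j) (pd l (g s)) v)
      - (pd l (g s) v * conv (landauKernel α i j) (pd i (pd j (g s))) v
        + g s v * conv (landauKernel α i j) (pd l (pd i (pd j (g s)))) v)) := by
    intro s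
    funext v
    have d1 : ∀ i j, DifferentiableAt ℝ
        (fun v => pd i (pd j (g s)) v * conv (landauKernel α i j) (g s) v) v := fun i j =>
      ((((hg.pd j).pd i).smooth s).diffAt v).mul ((hk i j).differentiableAt_conv hg s v)
    have d2 : ∀ i j, DifferentiableAt ℝ
        (fun v => g s v * conv (landauKernel α i j) (pd i (pd j (g s))) v) v := fun i j =>
      ((hg.smooth s).diffAt v).mul ((hk i j).differentiableAt_conv ((hg.pd j).pd i) s v)
    rw [landauOperator_eq hα hg, pd_sum fun i => DifferentiableAt.fun_sum fun j _ =>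
      (d1 i j).fun_sub (d2 i j)]
    refine Finset.sum_congr rfl fun i _ => ?_
    rw [pd_sum fun j => (d1 i j).fun_sub (d2 i j)]
    refine Finset.sum_congr rfl fun j _ => ?_
    rw [pd_sub (d1 i j) (d2 i j)]
    have e2 := pd_mul ((((hg.pd j).pd i).smooth s).diffAt v)
      ((hk i j).differentiableAt_conv hg s v) l
    have e3 := pd_mul ((hg.smooth s).diffAt v)
      ((hk i j).differentiableAt_conv ((hg.pd j).pd i) s v) l
    rw [(hk i j).pd_conv hg s] at e2
    rw [(hk i j).pd_conv ((hg.pd j).pd i) s] at e3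
    rw [e2, e3]
  simp only [key]
  exact RapFam.sum _ fun i => RapFam.sum _ fun j =>
    ((SchwFam.rap_mul_conv (hk i j) (((hg.pd j).pd i).pd l) hg).add
      (SchwFam.rap_mul_conv (hk i j) ((hg.pd j).pd i) (hg.pd l))).sub
    ((SchwFam.rap_mul_conv (hk i j) (hg.pd l) ((hg.pd j).pd i)).add
      (SchwFam.rap_mul_conv (hk i j) hg (((hg.pd j).pd i).pd l)))

end

section

/-! ### The time derivative of the Fisher information -/

variable {α : ℝ → ℝ} {T : ℝ} {f : ℝ → E3 → ℝ} {g : E3 → ℝ} {s : ℝ}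

/-- `∑ᵢ (2 ∂ᵢ(ln g) ∂ᵢq - (∂ᵢ ln g)² q)`, the derivative of `|∇g|² / g` when `g` moves with
velocity `q`. -/
def fisherRate (g q : E3 → ℝ) (v : E3) : ℝ :=
  ∑ i, (pd i q v * (2 * pd i (logf g) v) - q v * pd i (logf g) v ^ 2)

/-- `2 Δ ln g + |∇ ln g|²`; its negative is the first variation of the Fisher information. -/
def scoreCurv (g : E3 → ℝ) (v : E3) : ℝ :=
  ∑ i, (2 * pd i (pd i (logf g)) v + pd i (logf g) v ^ 2)

lemma IsSmoothSolution.contDiffAt (hf : IsSmoothSolution α T f) (hs : s ∈ Ioo 0 T) (v : E3) :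
    ContDiffAt ℝ ∞ (fun p : ℝ × E3 => f p.1 p.2) (s, v) :=
  hf.smooth.contDiffAt ((isOpen_Ioo.prod isOpen_univ).mem_nhds ⟨hs, mem_univ _⟩)

lemma IsSmoothSolution.isTame (hf : IsSmoothSolution α T f) (hs : s ∈ Ioo 0 T) :
    IsTame (f s) where
  smooth := contDiff_iff_contDiffAt.2 fun v =>
    (hf.contDiffAt hs v).comp v (contDiffAt_const.prodMk contDiffAt_id)
  pos := hf.pos s hs
  decay k n := by
    obtain ⟨C, hC⟩ := hf.decay s s hs.1 hs.2 k n
    exact ⟨C, hC s (by simp)⟩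
  log_growth := by
    obtain ⟨C, N, hC⟩ := hf.log_growth s s hs.1 hs.2
    exact ⟨C, N, hC s (by simp)⟩

/-- Time and velocity derivatives commute. -/
lemma IsSmoothSolution.hasDerivAt_pd (hf : IsSmoothSolution α T f) (hs : s ∈ Ioo 0 T)
    (j : Fin 3) (v : E3) :
    HasDerivAt (fun τ => pd j (f τ) v) (pd j (landauOperator α (f s)) v) s := by
  set G : ℝ × E3 → ℝ := fun p => f p.1 p.2 with hG
  have hd : ∀ τ ∈ Ioo 0 T, ∀ w, DifferentiableAt ℝ G (τ, w) := fun τ hτ w =>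
    (hf.contDiffAt hτ w).differentiableAt (by simp)
  have e1 : ∀ τ ∈ Ioo 0 T, ∀ w, pd j (f τ) w = fderiv ℝ G (τ, w) (0, bv j) := by
    intro τ hτ w
    have : HasFDerivAt (f τ) ((fderiv ℝ G (τ, w)).comp (ContinuousLinearMap.inr ℝ ℝ E3)) w :=
      (hd τ hτ w).hasFDerivAt.comp w (hasFDerivAt_prodMk_right τ w)
    rw [pd, this.fderiv]; simp
  have e2 : ∀ τ ∈ Ioo 0 T, ∀ w, landauOperator α (f τ) w = fderiv ℝ G (τ, w) (1, 0) := by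
    intro τ hτ w
    have : HasDerivAt (fun σ => f σ w) (fderiv ℝ G (τ, w) (1, 0)) τ :=
      (hd τ hτ w).hasFDerivAt.comp_hasDerivAt_of_eq τ
        ((hasDerivAt_id' τ).prodMk (hasDerivAt_const τ w)) rfl
    exact (hf.equation τ hτ w).unique this
  have h2 : DifferentiableAt ℝ (fderiv ℝ G) (s, v) :=
    ((hf.contDiffAt hs v).fderiv_right (m := ∞) (by simp)).differentiableAt (by simp)
  have hsym : IsSymmSndFDerivAt ℝ G (s, v) :=
    (hf.contDiffAt hs v).isSymmSndFDerivAt (by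
      simpa using WithTop.coe_le_coe.2 (le_top : (2 : ℕ∞) ≤ ⊤))
  have k1 : HasFDerivAt (fun τ => fderiv ℝ G (τ, v) (0, bv j))
      ((ContinuousLinearMap.apply ℝ ℝ ((0 : ℝ), bv j)).comp
        ((fderiv ℝ (fderiv ℝ G) (s, v)).comp (ContinuousLinearMap.inl ℝ ℝ E3))) s :=
    (ContinuousLinearMap.apply ℝ ℝ ((0 : ℝ), bv j)).hasFDerivAt.comp s
      (h2.hasFDerivAt.comp s (hasFDerivAt_prodMk_left s v))
  have k2 : HasFDerivAt (fun w => fderiv ℝ G (s, w) (1, 0))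
      ((ContinuousLinearMap.apply ℝ ℝ ((1 : ℝ), (0 : E3))).comp
        ((fderiv ℝ (fderiv ℝ G) (s, v)).comp (ContinuousLinearMap.inr ℝ ℝ E3))) v :=
    (ContinuousLinearMap.apply ℝ ℝ ((1 : ℝ), (0 : E3))).hasFDerivAt.comp v
      (h2.hasFDerivAt.comp v (hasFDerivAt_prodMk_right s v))
  have k3 : pd j (landauOperator α (f s)) v
      = fderiv ℝ (fderiv ℝ G) (s, v) (1, 0) (0, bv j) := by
    rw [funext (e2 s hs), pd, k2.fderiv, hsym.eq]; simp
  have k4 : HasDerivAt (fun τ => fderiv ℝ G (τ, v) (0, bv j))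
      (fderiv ℝ (fderiv ℝ G) (s, v) (1, 0) (0, bv j)) s := by
    simpa using k1.hasDerivAt
  rw [k3]
  refine k4.congr_of_eventuallyEq ?_
  filter_upwards [isOpen_Ioo.mem_nhds hs] with τ hτ using e1 τ hτ v

lemma IsTame.pd_logf (hg : IsTame g) (i : Fin 3) (v : E3) : pd i (logf g) v = pd i g v / g v := by
  have h : HasFDerivAt (logf g) _ v := (hg.smooth.diffAt v).hasFDerivAt.log (hg.pos v).ne'
  rw [pd, h.fderiv]
  simp [pd, div_eq_inv_mul]

lemma normSq_gradient (g : E3 → ℝ) (v : E3) : ‖∇ g v‖ ^ 2 = ∑ i, pd i g v ^ 2 := by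
  simp only [normSq_E3, gradient_apply]

lemma IsTame.fisherDensity_eq (hg : IsTame g) :
    fisherDensity g = fun v => ∑ i, g v * pd i (logf g) v ^ 2 := by
  funext v
  rw [fisherDensity, normSq_gradient, Finset.sum_div]
  refine Finset.sum_congr rfl fun i _ => ?_
  have := (hg.pos v).ne'
  rw [hg.pd_logf]; field_simp

lemma IsSmoothSolution.hasDerivAt_fisherDensity (hf : IsSmoothSolution α T f) (hs : s ∈ Ioo 0 T)
    (v : E3) : HasDerivAt (fun τ => fisherDensity (f τ) v)
      (fisherRate (f s) (landauOperator α (f s)) v) s := by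
  simp only [fisherDensity, normSq_gradient, Finset.sum_div]
  refine HasDerivAt.fun_sum fun i _ => ?_
  have h := ((hf.hasDerivAt_pd hs i v).fun_pow 2).fun_div (hf.equation s hs v) (hf.pos s hs v).ne'
  refine h.congr_deriv ?_
  have := (hf.pos s hs v).ne'
  rw [(hf.isTame hs).pd_logf]
  field_simp
  simp
  ring

lemma abs_pd_le (g : E3 → ℝ) (i : Fin 3) (v : E3) : |pd i g v| ≤ ‖fderiv ℝ g v‖ := by
  have := (fderiv ℝ g v).le_opNorm (bv i)
  simpa [pd] using this

lemma sq_poly_bound {ι : Type*} {h : ι → E3 → ℝ} {C : ℝ} {N : ℕ}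
    (hh : ∀ i v, |h i v| ≤ C * (1 + ‖v‖) ^ N) :
    ∀ i v, |h i v ^ 2| ≤ C ^ 2 * (1 + ‖v‖) ^ (2 * N) := fun i v => by
  rw [abs_pow]
  calc |h i v| ^ 2 ≤ (C * (1 + ‖v‖) ^ N) ^ 2 := by gcongr; exact hh i v
    _ = _ := by ring

lemma two_mul_poly_bound {ι : Type*} {h : ι → E3 → ℝ} {C : ℝ} {N : ℕ}
    (hh : ∀ i v, |h i v| ≤ C * (1 + ‖v‖) ^ N) :
    ∀ i v, |2 * h i v| ≤ (2 * C) * (1 + ‖v‖) ^ N := fun i v => by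
  rw [abs_mul, abs_two]
  linarith [hh i v]

/-- The Fisher information is finite, and may be differentiated under the integral. -/
lemma IsSmoothSolution.hasDerivAt_fisherInfo (hf : IsSmoothSolution α T f) (hα : IsWeight α)
    {t : ℝ} (ht : t ∈ Ioo 0 T) :
    Integrable (fisherDensity (f t)) ∧ HasDerivAt (fun s => fisherInfo (f s))
      (∫ v, fisherRate (f t) (landauOperator α (f t)) v) t := by
  obtain ⟨ht0, htT⟩ := ht
  set a := t / 2
  set b := (t + T) / 2
  have ha : 0 < a := half_pos ht0
  have hb : b < T := by simp only [b]; linarith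
  have hab : ∀ τ ∈ Icc a b, τ ∈ Ioo 0 T := fun τ hτ => ⟨ha.trans_le hτ.1, hτ.2.trans_lt hb⟩
  have hmem : t ∈ Icc a b := ⟨by simp only [a]; linarith, by simp only [b]; linarith⟩
  have hnhds : Icc a b ∈ nhds t :=
    Icc_mem_nhds (by simp only [a]; linarith) (by simp only [b]; linarith)
  have hS : SchwFam fun τ : Icc a b => f τ :=
    ⟨fun τ => (hf.isTame (hab τ τ.2)).smooth, fun k n => by
    obtain ⟨C, hC⟩ := hf.decay a b ha hb k n
    exact ⟨C, fun τ v => hC τ τ.2 v⟩⟩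
  obtain ⟨C, N, hC⟩ := hf.log_growth a b ha hb
  have hlog : ∀ i, ∀ (τ : Icc a b) v, |pd i (logf (f τ)) v| ≤ C * (1 + ‖v‖) ^ N := by
    intro i τ v
    refine le_trans ?_ (hC τ τ.2 v)
    rw [← norm_iteratedFDeriv_fderiv (n := 0), norm_iteratedFDeriv_zero]
    exact (abs_pd_le _ _ _).trans (le_add_of_nonneg_right (norm_nonneg _))
  have hrate : RapFam fun τ : Icc a b => fisherRate (f τ) (landauOperator α (f τ)) :=
    RapFam.sum _ fun i =>
      ((pd_landauOperator_rap hα hS i).mul_poly (two_mul_poly_bound (hlog i))).sub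
        ((landauOperator_rap hα hS).mul_poly (sq_poly_bound (hlog i)))
  have hfish : RapFam fun τ : Icc a b => fisherDensity (f τ) := by
    have : (fun τ : Icc a b => fisherDensity (f τ))
        = fun τ : Icc a b => fun v => ∑ i, f τ v * pd i (logf (f τ)) v ^ 2 :=
      funext fun τ => (hf.isTame (hab τ τ.2)).fisherDensity_eq
    rw [this]
    exact RapFam.sum _ fun i => hS.rap.mul_poly (sq_poly_bound (hlog i))
  have hlogm : ∀ i τ, Measurable (pd i (logf (f τ))) := fun i τ =>
    measurable_fderiv_apply_const _ _ _
  have hmF : ∀ τ ∈ Icc a b, AEStronglyMeasurable (fisherDensity (f τ)) volume := by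
    intro τ hτ
    have hc := (hf.isTame (hab τ hτ)).smooth.continuous.measurable
    rw [(hf.isTame (hab τ hτ)).fisherDensity_eq]
    exact (Finset.measurable_fun_sum _ fun i _ =>
      hc.mul ((hlogm i τ).pow_const 2)).aestronglyMeasurable
  have hint : Integrable (fisherDensity (f t)) := hfish.integrable ⟨t, hmem⟩ (hmF t hmem)
  refine ⟨hint, ?_⟩
  obtain ⟨D, hD⟩ := hrate.le_majorant
  refine (hasDerivAt_integral_of_dominated_loc_of_deriv_le (F := fun τ v => fisherDensity (f τ) v)
    (F' := fun τ v => fisherRate (f τ) (landauOperator α (f τ)) v) hnhds ?_ hint ?_ ?_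
    (integrable_inv_one_add_norm.const_mul D) ?_).2
  · filter_upwards [hnhds] with τ hτ using hmF τ hτ
  · have hq : Measurable (landauOperator α (f t)) :=
      (continuous_iff_continuousAt.2 fun v =>
        (landauOperator_differentiableAt hα hS ⟨t, hmem⟩ v).continuousAt).measurable
    have hpq : ∀ i, Measurable (pd i (landauOperator α (f t))) :=
      fun i => measurable_fderiv_apply_const _ _ _
    exact (Finset.measurable_fun_sum _ fun i _ => ((hpq i).mul ((hlogm i t).const_mul 2)).sub
      (hq.mul ((hlogm i t).pow_const 2))).aestronglyMeasurable
  · exact Filter.Eventually.of_forall fun v τ hτ => hD ⟨τ, hτ⟩ v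
  · exact Filter.Eventually.of_forall fun v τ hτ => hf.hasDerivAt_fisherDensity (hab τ hτ) v

lemma IsTame.schwFam (hg : IsTame g) : SchwFam fun _ : Unit => g :=
  ⟨fun _ => hg.smooth, fun k n => by
    obtain ⟨C, hC⟩ := hg.decay k n
    exact ⟨C, fun _ v => hC v⟩⟩

lemma IsTame.pd_log_bound (hg : IsTame g) : ∃ (C : ℝ) (N : ℕ), ∀ i v,
    |pd i (logf g) v| ≤ C * (1 + ‖v‖) ^ N ∧ |pd i (pd i (logf g)) v| ≤ C * (1 + ‖v‖) ^ N := by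
  obtain ⟨C, N, -, h⟩ := hg.log_bound
  refine ⟨C, N, fun i v => ⟨(abs_pd_le _ _ _).trans (h v).1, ?_⟩⟩
  have h1 : pd i (pd i (logf g)) v = fderiv ℝ (fderiv ℝ (logf g)) v (bv i) (bv i) :=
    (fderiv_fderiv_apply hg.contDiff_logf v (bv i) (bv i)).symm
  have h2 := (fderiv ℝ (fderiv ℝ (logf g)) v).le_opNorm₂ (bv i) (bv i)
  rw [← h1] at h2
  simp at h2
  exact h2.trans (h v).2

/-- Integration by parts moves the velocity derivatives off the collision operator. -/
lemma IsTame.integral_fisherRate (hg : IsTame g) (hα : IsWeight α) :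
    ∫ v, fisherRate g (landauOperator α g) v = -∫ v, scoreCurv g v * landauOperator α g v := by
  have hS := hg.schwFam
  have hqd : ∀ v, DifferentiableAt ℝ (landauOperator α g) v :=
    landauOperator_differentiableAt hα hS ()
  have hq := landauOperator_rap hα hS
  have hpq := pd_landauOperator_rap hα hS
  obtain ⟨C, N, hC⟩ := hg.pd_log_bound
  have hl : ∀ i, ContDiff ℝ ∞ (pd i (logf g)) := fun i => contDiff_fderiv_apply hg.contDiff_logf _
  have hll : ∀ i, ContDiff ℝ ∞ (pd i (pd i (logf g))) := fun i => contDiff_fderiv_apply (hl i) _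
  have mq : Measurable (landauOperator α g) :=
    (continuous_iff_continuousAt.2 fun v => (hqd v).continuousAt).measurable
  have mpq : ∀ i, Measurable (pd i (landauOperator α g)) :=
    fun i => measurable_fderiv_apply_const _ _ _
  have ml : ∀ i, Measurable (pd i (logf g)) := fun i => (hl i).continuous.measurable
  have mll : ∀ i, Measurable (pd i (pd i (logf g))) := fun i => (hll i).continuous.measurable
  have b1 : ∀ i, ∀ (_ : Unit) v, |pd i (logf g) v| ≤ C * (1 + ‖v‖) ^ N := fun i _ v => (hC i v).1
  have b2 : ∀ i, ∀ (_ : Unit) v, |pd i (pd i (logf g)) v| ≤ C * (1 + ‖v‖) ^ N :=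
    fun i _ v => (hC i v).2
  have i1 : ∀ i, Integrable fun v => pd i (landauOperator α g) v * (2 * pd i (logf g) v) := fun i =>
    ((hpq i).mul_poly (two_mul_poly_bound (b1 i))).integrable ()
      ((mpq i).mul ((ml i).const_mul 2)).aestronglyMeasurable
  have i2 : ∀ i, Integrable fun v => landauOperator α g v * pd i (logf g) v ^ 2 := fun i =>
    (hq.mul_poly (sq_poly_bound (b1 i))).integrable ()
      (mq.mul ((ml i).pow_const 2)).aestronglyMeasurable
  have i3 : ∀ i, Integrable fun v => landauOperator α g v * (2 * pd i (pd i (logf g)) v) := fun i =>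
    (hq.mul_poly (two_mul_poly_bound (b2 i))).integrable ()
      (mq.mul ((mll i).const_mul 2)).aestronglyMeasurable
  have i4 : ∀ i, Integrable fun v => landauOperator α g v * (2 * pd i (logf g) v) := fun i =>
    (hq.mul_poly (two_mul_poly_bound (b1 i))).integrable ()
      (mq.mul ((ml i).const_mul 2)).aestronglyMeasurable
  have ibp : ∀ i, ∫ v, pd i (landauOperator α g) v * (2 * pd i (logf g) v)
      = -∫ v, landauOperator α g v * (2 * pd i (pd i (logf g)) v) := by
    intro i
    have hd : ∀ v, fderiv ℝ (fun v => 2 * pd i (logf g) v) v (bv i)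
        = 2 * pd i (pd i (logf g)) v := fun v => by
      rw [fderiv_const_mul ((hl i).diffAt v)]; rfl
    have := integral_mul_fderiv_eq_neg_fderiv_mul_of_integrable (μ := volume)
      (f := landauOperator α g) (g := fun v => 2 * pd i (logf g) v) (v := bv i) (i1 i)
      (by simpa only [hd] using i3 i) (i4 i) (fun v _ => hqd v)
      (fun v _ => ((hl i).diffAt v).const_mul 2)
    simp only [hd] at this
    rw [this, neg_neg]; rfl
  simp only [fisherRate, scoreCurv, Finset.sum_mul]
  have i12 : ∀ i, Integrable fun v => pd i (landauOperator α g) v * (2 * pd i (logf g) v)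
      - landauOperator α g v * pd i (logf g) v ^ 2 := fun i => (i1 i).sub (i2 i)
  have e : ∀ i v, (2 * pd i (pd i (logf g)) v + pd i (logf g) v ^ 2) * landauOperator α g v
      = landauOperator α g v * (2 * pd i (pd i (logf g)) v)
        + landauOperator α g v * pd i (logf g) v ^ 2 := fun i v => by ring
  have i32 : ∀ i, Integrable fun v =>
      (2 * pd i (pd i (logf g)) v + pd i (logf g) v ^ 2) * landauOperator α g v := fun i => by
    simp only [e]; exact (i3 i).add (i2 i)
  rw [integral_finsetSum _ fun i _ => i12 i, integral_finsetSum _ fun i _ => i32 i,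
    ← Finset.sum_neg_distrib]
  refine Finset.sum_congr rfl fun i _ => ?_
  rw [integral_sub (i1 i) (i2 i), ibp]
  simp only [e]
  rw [integral_add (i3 i) (i2 i)]
  ring

end

section

/-! ### The collision operator as a marginal of the lifted operator -/

variable {α b : ℝ → ℝ} {g : E3 → ℝ}

/-- `∑ᵢⱼ (|y|² δᵢⱼ - yᵢyⱼ) (g(w) ∂ᵢⱼg(v) - g(v) ∂ᵢⱼg(w))` with `w = v - 2y`. -/
def collision (g : E3 → ℝ) (v y : E3) : ℝ :=
  ∑ i, ∑ j, (‖y‖ ^ 2 * (if i = j then 1 else 0) - y i * y j)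
    * (pd i (pd j g) v * g (v - (2 : ℝ) • y) - g v * pd i (pd j g) (v - (2 : ℝ) • y))

lemma IsTame.fderiv_liftF (hg : IsTame g) (p x : PS) : fderiv ℝ (liftF g) p x
    = fderiv ℝ g (p.1 + p.2) (x.1 + x.2) * g (p.1 - p.2)
      + g (p.1 + p.2) * fderiv ℝ g (p.1 - p.2) (x.1 - x.2) := by
  have h0 : liftF g = fun p => g (addMap p) * g (subMap p) := hg.exp_logF
  have h1 : ContDiff ℝ ∞ fun p => g (addMap p) := hg.smooth.comp addMap.contDiff
  have h2 : ContDiff ℝ ∞ fun p => g (subMap p) := hg.smooth.comp subMap.contDiff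
  rw [h0, fderiv_fun_mul (h1.diffAt p) (h2.diffAt p)]
  simp only [add_apply, smul_apply, smul_eq_mul, fderiv_comp_clm hg.smooth]
  simp only [addMap_apply, subMap_apply]
  ring

/-- In the mixed second derivative `∂_{z;c} ∂_{y;c}` of `F` the products of first derivatives
cancel. -/
lemma IsTame.fderiv_fderiv_liftF (hg : IsTame g) (p : PS) (c : E3) :
    fderiv ℝ (fderiv ℝ (liftF g)) p (c, 0) (0, c)
      = fderiv ℝ (fderiv ℝ g) (p.1 + p.2) c c * g (p.1 - p.2)
        - g (p.1 + p.2) * fderiv ℝ (fderiv ℝ g) (p.1 - p.2) c c := by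
  have hD := fun x => contDiff_fderiv_apply hg.smooth x
  have h1 : ContDiff ℝ ∞ fun p => g (addMap p) := hg.smooth.comp addMap.contDiff
  have h2 : ContDiff ℝ ∞ fun p => g (subMap p) := hg.smooth.comp subMap.contDiff
  have h3 : ContDiff ℝ ∞ fun p => fderiv ℝ g (addMap p) c := (hD c).comp addMap.contDiff
  have h4 : ContDiff ℝ ∞ fun p => fderiv ℝ g (subMap p) (-c) := (hD (-c)).comp subMap.contDiff
  have h0 : (fun q => fderiv ℝ (liftF g) q (0, c)) = fun q =>
      fderiv ℝ g (addMap q) c * g (subMap q) + g (addMap q) * fderiv ℝ g (subMap q) (-c) := by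
    funext q
    rw [hg.fderiv_liftF]
    simp only [zero_add, zero_sub]; rfl
  rw [fderiv_fderiv_apply hg.contDiff_liftF, h0,
    fderiv_fun_add ((h3.mul h2).diffAt p) ((h1.mul h4).diffAt p),
    fderiv_fun_mul (h3.diffAt p) (h2.diffAt p), fderiv_fun_mul (h1.diffAt p) (h4.diffAt p)]
  simp only [add_apply, smul_apply, smul_eq_mul]
  rw [fderiv_comp_clm (hD c), fderiv_comp_clm (hD (-c)), fderiv_comp_clm hg.smooth,
    fderiv_comp_clm hg.smooth, fderiv_fderiv_apply hg.smooth, fderiv_fderiv_apply hg.smooth]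
  have h5 : (fun q => fderiv ℝ g q (-c)) = fun q => -fderiv ℝ g q c := by
    funext q; rw [map_neg]
  rw [h5, fderiv_fun_neg]
  simp only [addMap_apply, subMap_apply, add_zero, sub_zero, map_neg, neg_apply]
  ring

/-- The contraction of `g(w) D²g(v) - g(v) D²g(w)` with `|y|² Id - y ⊗ y = ∑ₖ (J k y) ⊗ (J k y)`. -/
lemma sum_second_J (hg : ContDiff ℝ ∞ g) (v w y : E3) :
    ∑ k, (fderiv ℝ (fderiv ℝ g) v (J k y) (J k y) * g w
        - g v * fderiv ℝ (fderiv ℝ g) w (J k y) (J k y))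
      = ∑ i, ∑ j, (‖y‖ ^ 2 * (if i = j then 1 else 0) - y i * y j)
        * (pd i (pd j g) v * g w - g v * pd i (pd j g) w) := by
  have e : ∀ i j u, pd i (pd j g) u = fderiv ℝ (fderiv ℝ g) u (bv i) (bv j) := fun i j u =>
    (fderiv_fderiv_apply hg u (bv i) (bv j)).symm
  rw [Finset.sum_sub_distrib, ← Finset.sum_mul, ← Finset.mul_sum, sum_map₂_J, sum_map₂_J,
    map₂_E3 _ y y, map₂_E3 _ y y]
  simp only [e, Fin.sum_univ_three]
  simp
  ring

/-- With `v` fixed and `w = v - 2y`, the lifted operator is the integrand of the collision operator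
up to rotation derivatives in `y`. -/
lemma IsTame.lap_liftF_shear (hg : IsTame g) (v y : E3) :
    lap (liftF g) (v - y, y)
      = (∑ k, rot k (fun y => der (fL k) (liftF g) (v - y, y)) y) + collision g v y := by
  have hG : ∀ k, ContDiff ℝ ∞ (der (fL k) (liftF g)) := fun k =>
    contDiff_der (contDiff_fL k) hg.contDiff_liftF
  have e1 : ∀ k, rot k (fun y => der (fL k) (liftF g) (v - y, y)) y
      = fderiv ℝ (der (fL k) (liftF g)) (v - y, y) (-J k y, J k y) := by
    intro k
    have h0 : HasFDerivAt (𝕜 := ℝ) (fun y : E3 => (v - y, y)) _ y :=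
      ((hasFDerivAt_id y).const_sub v).prodMk (hasFDerivAt_id y)
    have h : HasFDerivAt (fun y => der (fL k) (liftF g) (v - y, y)) _ y :=
      ((hG k).diffAt (v - y, y)).hasFDerivAt.comp (f := fun y : E3 => (v - y, y)) y h0
    rw [rot, der, h.fderiv]
    simp
  have e2 : ∀ k, fderiv ℝ (der (fL k) (liftF g)) (v - y, y) (J k y, 0)
      = fderiv ℝ (fderiv ℝ g) v (J k y) (J k y) * g (v - (2 : ℝ) • y)
        - g v * fderiv ℝ (fderiv ℝ g) (v - (2 : ℝ) • y) (J k y) (J k y) := by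
    intro k
    rw [fderiv_der (contDiff_fL k) hg.contDiff_liftF, fderiv_fL]
    have : fL k (v - y, y) = (0, J k y) := rfl
    simp only [this, hg.fderiv_fderiv_liftF, sub_add_cancel, map_zero]
    rw [two_smul, sub_sub, ← Prod.zero_eq_mk, map_zero, add_zero]
  have e3 : lap (liftF g) (v - y, y)
      = ∑ k, (rot k (fun y => der (fL k) (liftF g) (v - y, y)) y
        + fderiv ℝ (der (fL k) (liftF g)) (v - y, y) (J k y, 0)) := by
    refine Finset.sum_congr rfl fun k _ => ?_
    rw [e1, ← map_add, der]
    congr 1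
    simp [fL]
  rw [e3, Finset.sum_add_distrib, collision, ← sum_second_J hg.smooth]
  simp only [e2]

/-- Integrability in `y` at fixed first velocity `v = z + y`. -/
lemma RapidR.integrable_shear {G : PS → ℝ} (hb : IsWeight b) (hG : RapidR 2 G) (hc : Continuous G)
    (v : E3) : Integrable fun y => b ‖y‖ * G (v - y, y) := by
  obtain ⟨K, hK⟩ := hb.integrable_norm
  obtain ⟨C, hC, h⟩ := hG.norm_le K
  have hm := hb.measurable
  have hm2 : Measurable fun y : E3 => G (v - y, y) :=
    (by fun_prop : Continuous fun y : E3 => G (v - y, y)).measurable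
  refine (hK.norm.const_mul C).mono' (by fun_prop : Measurable _).aestronglyMeasurable
    (Filter.Eventually.of_forall fun y => ?_)
  have h1 : ((1 + ‖v - y‖) ^ 4)⁻¹ ≤ 1 :=
    inv_le_one_of_one_le₀ (one_le_pow₀ (by linarith [norm_nonneg (v - y)]))
  have h2 : (0 : ℝ) ≤ ‖y‖ ^ 2 / (1 + ‖y‖) ^ K := by positivity
  rw [norm_mul, norm_mul, Real.norm_of_nonneg h2]
  calc ‖b ‖y‖‖ * ‖G (v - y, y)‖ ≤ ‖b ‖y‖‖ * (C * 1 * (‖y‖ ^ 2 / (1 + ‖y‖) ^ K)) := by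
        gcongr
        exact (h (v - y, y)).trans (by gcongr)
    _ = _ := by ring

/-- Integrals of rotation derivatives against radial weights vanish. -/
lemma integral_radial_mul_rot {U : Fin 3 → E3 → ℝ} (hU : ∀ k, ContDiff ℝ ∞ (U k))
    (hb : Measurable b) : ∫ y, b ‖y‖ * ∑ k, rot k (U k) y = 0 := by
  have hc : ∀ k, Continuous (rot k (U k)) := fun k =>
    (contDiff_der (J k).contDiff (hU k)).continuous
  have hm : Measurable fun y => ∑ k, rot k (U k) y :=
    Finset.measurable_fun_sum _ fun k _ => (hc k).measurable
  rw [integral_polar _ (by fun_prop)]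
  -- without integrability the integral is zero by convention
  by_cases hi : Integrable (fun q : ℝ × S2 => q.1 ^ 2 * (b ‖q.1 • (q.2 : E3)‖
      * ∑ k, rot k (U k) (q.1 • (q.2 : E3)))) polarMeasure
  · rw [polarMeasure, integral_prod _ hi]
    refine integral_eq_zero_of_ae (Filter.Eventually.of_forall fun r => ?_)
    simp only [norm_smul, norm_S2, mul_one]
    rw [integral_const_mul, integral_const_mul, integral_finsetSum]
    · have h0 : ∀ k, ∫ σ : S2, rot k (U k) (r • (σ : E3)) ∂sphereMeasure = 0 := fun k =>
        integral_sphere_fderiv_J (hU k) r k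
      simp [h0]
    · exact fun k _ => integrable_sphere (by have := hc k; fun_prop)
  · exact integral_undef hi

/-- The potential at the distance `|v - w| = 2r`, with the factor from `(∂_v - ∂_w)²`, has the
properties of the potential. -/
lemma IsWeight.lift (hα : IsWeight α) : IsWeight (liftedPotential α) where
  measurable := by
    have := hα.measurable
    unfold liftedPotential; fun_prop
  nonneg r hr := mul_nonneg (by norm_num) (hα.nonneg _ (by linarith))
  contDiffOn := contDiffOn_const.mul (hα.contDiffOn.comp (contDiff_const.mul contDiff_id).contDiffOn
    fun r (hr : 0 < r) => mul_pos two_pos hr)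
  integrableOn := by
    obtain ⟨k, hk⟩ := hα.integrableOn
    have hm := hα.measurable
    have h1 : IntegrableOn (fun r => α (2 * r) * ((2 * r) ^ 4 / (1 + 2 * r) ^ k)) (Ioi 0) := by
      rw [integrableOn_Ioi_comp_mul_left_iff (fun r => α r * (r ^ 4 / (1 + r) ^ k)) 0 two_pos,
        mul_zero]
      exact hk
    refine ⟨k, (h1.const_mul (2 ^ k)).mono'
      (by unfold liftedPotential; fun_prop : Measurable _).aestronglyMeasurable ?_⟩
    filter_upwards [ae_restrict_mem measurableSet_Ioi] with r hr
    have hr' : 0 < r := hr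
    have h2 : 0 ≤ α (2 * r) := hα.nonneg _ (by linarith)
    rw [Real.norm_of_nonneg (by unfold liftedPotential; positivity), liftedPotential]
    have h3 : (1 + 2 * r) ^ k ≤ 2 ^ k * (1 + r) ^ k := by
      rw [← mul_pow]; gcongr; linarith
    have h4 : ((1 + r) ^ k)⁻¹ ≤ 2 ^ k * ((1 + 2 * r) ^ k)⁻¹ := by
      rw [← div_eq_mul_inv, le_div_iff₀ (by positivity), inv_mul_le_iff₀ (by positivity),
        mul_comm ((1 + r) ^ k)]
      exact h3
    calc 4 * α (2 * r) * (r ^ 4 / (1 + r) ^ k) = 4 * α (2 * r) * (r ^ 4 * ((1 + r) ^ k)⁻¹) := rfl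
      _ ≤ 4 * α (2 * r) * (r ^ 4 * (2 ^ k * ((1 + 2 * r) ^ k)⁻¹)) := by gcongr
      _ ≤ 16 * (α (2 * r) * (r ^ 4 * (2 ^ k * ((1 + 2 * r) ^ k)⁻¹))) := by
        have : 0 ≤ α (2 * r) * (r ^ 4 * (2 ^ k * ((1 + 2 * r) ^ k)⁻¹)) := by positivity
        linarith
      _ = _ := by rw [div_eq_mul_inv]; ring
  growth := by
    obtain ⟨C, m, h⟩ := hα.growth
    refine ⟨4 * C * 2 ^ m, m, fun r hr => ?_⟩
    have := h (2 * r) (by linarith)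
    rw [mul_pow] at this
    rw [liftedPotential]
    linarith

/-- `q(g)(v) = 8 ∫ β(|y|) Δ_σ F(v - y, y) dy`: the collision operator is a marginal of the lifted
operator. The factor `8` is the Jacobian of `Y = 2y`. -/
lemma IsTame.landauOperator_eq_lap (hg : IsTame g) (hα : IsWeight α) (v : E3) :
    landauOperator α g v = 8 * ∫ y, liftedPotential α ‖y‖ * lap (liftF g) (v - y, y) := by
  have hS := hg.schwFam
  set R : E3 → ℝ := fun Y => ∑ i, ∑ j, (pd i (pd j g) v * (landauKernel α i j Y * g (v - Y))
    - g v * (landauKernel α i j Y * pd i (pd j g) (v - Y))) with hR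
  have i1 : ∀ i j, Integrable fun Y => pd i (pd j g) v * (landauKernel α i j Y * g (v - Y)) :=
    fun i j => ((hα.isKernel i j).integrable_conv hS () v).const_mul _
  have i2 : ∀ i j, Integrable fun Y => g v * (landauKernel α i j Y * pd i (pd j g) (v - Y)) :=
    fun i j => ((hα.isKernel i j).integrable_conv ((hS.pd j).pd i) () v).const_mul _
  have i3 : ∀ i j, Integrable fun Y => pd i (pd j g) v * (landauKernel α i j Y * g (v - Y))
      - g v * (landauKernel α i j Y * pd i (pd j g) (v - Y)) := fun i j => (i1 i j).sub (i2 i j)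
  have i4 : ∀ i, Integrable fun Y => ∑ j, (pd i (pd j g) v * (landauKernel α i j Y * g (v - Y))
      - g v * (landauKernel α i j Y * pd i (pd j g) (v - Y))) := fun i =>
    integrable_finsetSum _ fun j _ => i3 i j
  have iR : Integrable R := integrable_finsetSum _ fun i _ => i4 i
  have e1 : landauOperator α g v = ∫ Y, R Y := by
    rw [landauOperator_eq hα hS ()]
    simp only [hR]
    rw [integral_finsetSum _ fun i _ => i4 i]
    refine Finset.sum_congr rfl fun i _ => ?_
    rw [integral_finsetSum _ fun j _ => i3 i j]
    refine Finset.sum_congr rfl fun j _ => ?_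
    rw [integral_sub (i1 i j) (i2 i j), integral_const_mul, integral_const_mul]
    rfl
  have e2 : ∀ y, R ((2 : ℝ) • y) = liftedPotential α ‖y‖ * collision g v y := by
    intro y
    simp only [hR, collision, liftedPotential, landauKernel, Finset.mul_sum, norm_smul,
      Real.norm_ofNat, PiLp.smul_apply, smul_eq_mul]
    exact Finset.sum_congr rfl fun i _ => Finset.sum_congr rfl fun j _ => by ring
  have e3 : ∫ Y, R Y = 8 * ∫ y, R ((2 : ℝ) • y) := by
    rw [Measure.integral_comp_smul, finrank_euclideanSpace_fin, abs_of_pos (by positivity),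
      smul_eq_mul]
    ring
  have hint := hg.rapidR_lap.integrable_shear hα.lift
    (contDiff_lap hg.contDiff_liftF).continuous v
  have hcol : Integrable fun y => liftedPotential α ‖y‖ * collision g v y := by
    simpa only [e2] using iR.comp_smul (two_ne_zero (α := ℝ))
  have hsm : ∀ k, ContDiff ℝ ∞ fun y => der (fL k) (liftF g) (v - y, y) := fun k =>
    (contDiff_der (contDiff_fL k) hg.contDiff_liftF).comp
      ((contDiff_const.sub contDiff_id).prodMk contDiff_id)
  have hzero := integral_radial_mul_rot hsm hα.lift.measurable
  have hdiff : (fun y => liftedPotential α ‖y‖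
      * ∑ k, rot k (fun y => der (fL k) (liftF g) (v - y, y)) y)
      = fun y => liftedPotential α ‖y‖ * lap (liftF g) (v - y, y)
        - liftedPotential α ‖y‖ * collision g v y := by
    funext y
    rw [hg.lap_liftF_shear]; ring
  rw [hdiff, integral_sub hint hcol, sub_eq_zero] at hzero
  rw [e1, e3, hzero]
  simp only [e2]

/-! ### The dissipation of the Fisher information in lifted coordinates -/

lemma der_fL_comp_reflect {G : PS → ℝ} (hG : ContDiff ℝ ∞ G) (k : Fin 3) :
    der (fL k) (fun p => G (p.1, -p.2)) = fun p => der (fL k) G (p.1, -p.2) := by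
  funext p
  have := fderiv_comp_clm hG ((ContinuousLinearMap.fst ℝ E3 E3).prod
    (-ContinuousLinearMap.snd ℝ E3 E3)) p (fL k p)
  rw [der, der]
  refine this.trans ?_
  simp [fL]

/-- The spherical Laplacian preserves symmetry under the exchange of the two velocities. -/
lemma lap_reflect {G : PS → ℝ} (hG : ContDiff ℝ ∞ G) (h : ∀ p : PS, G (p.1, -p.2) = G p) (p : PS) :
    lap G (p.1, -p.2) = lap G p := by
  have h1 : (fun p : PS => G (p.1, -p.2)) = G := funext h
  refine Finset.sum_congr rfl fun k _ => ?_
  have h2 := der_fL_comp_reflect hG k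
  rw [h1] at h2
  have h3 := der_fL_comp_reflect (contDiff_der (contDiff_fL k) hG) k
  rw [← h2] at h3
  exact (congrFun h3 p).symm

/-- As `ln F` is `ln g(v) + ln g(w)`, the six-dimensional `2 Δ ln F + |∇ ln F|²` is twice the sum of
the values of `scoreCurv g` at the two velocities. -/
lemma IsTame.terms_eq (hg : IsTame g) (p : PS) :
    termZ (logF g) p + termX (logF g) p + termL (logF g) p
      = 2 * (‖p.2‖ ^ 2 *
        ((scoreCurv g (p.1 + p.2) + scoreCurv g (p.1 - p.2)) * lap (liftF g) p)) := by
  have e : ∀ i u, pd i (pd i (logf g)) u = fderiv ℝ (fderiv ℝ (logf g)) u (bv i) (bv i) :=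
    fun i u => (fderiv_fderiv_apply hg.contDiff_logf u (bv i) (bv i)).symm
  rw [termZ_add_termX_add_termL hg.contDiff_logF]
  simp only [hg.fderiv_logF, hg.fderiv_fderiv_logF, add_zero, zero_add, sub_zero, zero_sub, map_neg,
    neg_apply, neg_neg]
  have h2 : (∑ i, (2 * (fderiv ℝ (fderiv ℝ (logf g)) (p.1 + p.2) (bv i) (bv i)
        + fderiv ℝ (fderiv ℝ (logf g)) (p.1 - p.2) (bv i) (bv i)
      + (fderiv ℝ (fderiv ℝ (logf g)) (p.1 + p.2) (bv i) (bv i)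
        + fderiv ℝ (fderiv ℝ (logf g)) (p.1 - p.2) (bv i) (bv i)))
      + ((fderiv ℝ (logf g) (p.1 + p.2) (bv i) + fderiv ℝ (logf g) (p.1 - p.2) (bv i)) ^ 2
        + (fderiv ℝ (logf g) (p.1 + p.2) (bv i) + -fderiv ℝ (logf g) (p.1 - p.2) (bv i)) ^ 2)))
      = 2 * (scoreCurv g (p.1 + p.2) + scoreCurv g (p.1 - p.2)) := by
    rw [scoreCurv, scoreCurv, ← Finset.sum_add_distrib, Finset.mul_sum]
    refine Finset.sum_congr rfl fun i _ => ?_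
    rw [e, e, pd, pd]
    ring
  rw [h2, show (fun q => Real.exp (logF g q)) = liftF g from rfl]
  ring

lemma IsTame.polyR_scoreCurv (hg : IsTame g) : PolyR 0 fun p => scoreCurv g (p.1 + p.2) := by
  obtain ⟨C, N, h⟩ := hg.pd_log_bound
  have hC : 0 ≤ C := by
    have := (abs_nonneg _).trans (h 0 0).1
    simpa using this
  refine PolyR.sum _ fun i => PolyR.add (m := 0) (PolyR.const_mul 2 ⟨C, N, hC, fun p => ?_⟩)
    (PolyR.pow_two (m := 0) ⟨C, N, hC, fun p => ?_⟩)
  all_goals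
    have h1 : (1 + ‖p.1 + p.2‖) ^ N ≤ wt p ^ N :=
      pow_le_pow_left₀ (by positivity) (one_add_norm_le_wt (norm_add_le _ _)) _
    rw [pow_zero, mul_one]
  · exact ((h i _).2).trans (by gcongr)
  · exact ((h i _).1).trans (by gcongr)

lemma IsTame.continuous_scoreCurv (hg : IsTame g) : Continuous (scoreCurv g) := by
  have hl : ∀ i, ContDiff ℝ ∞ (pd i (logf g)) := fun i => contDiff_fderiv_apply hg.contDiff_logf _
  have hll : ∀ i, ContDiff ℝ ∞ (pd i (pd i (logf g))) := fun i => contDiff_fderiv_apply (hl i) _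
  exact continuous_finsetSum _ fun i _ =>
    ((hll i).continuous.const_mul 2).add ((hl i).continuous.pow 2)

/-- The derivative of the Fisher information in the coordinates `(z, r, σ)`. -/
lemma IsTame.integral_fisherRate_eq (hg : IsTame g) (hα : IsWeight α) :
    ∫ v, fisherRate g (landauOperator α g) v
      = -2 * ∫ q, liftedPotential α q.2.1 * (termZ (logF g) (q.1, q.2.1 • (q.2.2 : E3))
        + termX (logF g) (q.1, q.2.1 • (q.2.2 : E3))
        + termL (logF g) (q.1, q.2.1 • (q.2.2 : E3))) ∂coordMeasure := by
  set β := liftedPotential α with hβ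
  have hb : IsWeight β := hα.lift
  have hs := hg.continuous_scoreCurv
  have hlap : Continuous (lap (liftF g)) := (contDiff_lap hg.contDiff_liftF).continuous
  set Φ : PS → ℝ := fun p => β ‖p.2‖ * (lap (liftF g) p * scoreCurv g (p.1 + p.2)) with hΦ
  have iΦ : Integrable Φ :=
    (hg.rapidR_lap.mul_polyR hg.polyR_scoreCurv).integrable_pair hb (by fun_prop)
  have hmp : ∀ S : PS → PS, MeasurePreserving S volume volume →
      ∫ p, Φ (S p) = ∫ p, Φ p := fun S hS => by
    conv_rhs => rw [← hS.map_eq]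
    rw [integral_map hS.aemeasurable (by rw [hS.map_eq]; exact iΦ.aestronglyMeasurable)]
  -- pass from the pair `(v, y)` to `(z, y) = (v - y, y)`
  have hshear : MeasurePreserving (fun p : PS => (p.1 - p.2, p.2)) volume volume :=
    measurePreserving_sub_prod volume volume
  have e1 : ∫ v, scoreCurv g v * landauOperator α g v = 8 * ∫ p, Φ p := by
    have iS : Integrable (fun p : PS => Φ (p.1 - p.2, p.2)) (volume.prod volume) :=
      hshear.integrable_comp_of_integrable iΦ
    rw [← hmp _ hshear]
    have h1 := integral_prod _ iS
    rw [← Measure.volume_eq_prod] at h1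
    rw [h1, ← integral_const_mul]
    refine integral_congr_ae (Filter.Eventually.of_forall fun v => ?_)
    simp only [hΦ, sub_add_cancel]
    rw [hg.landauOperator_eq_lap hα, mul_left_comm, ← integral_const_mul]
    congr 1
    exact integral_congr_ae (Filter.Eventually.of_forall fun y => by ring)
  -- the reflection `y ↦ -y` exchanges the two velocities
  have hrefl : MeasurePreserving (fun p : PS => (p.1, -p.2)) volume volume :=
    (MeasurePreserving.id volume).prod (Measure.measurePreserving_neg volume)
  have hF : ∀ p : PS, liftF g (p.1, -p.2) = liftF g p := fun p => by
    simp only [liftF, logF, sub_neg_eq_add, ← sub_eq_add_neg]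
    rw [add_comm]
  have hΦr : (fun p : PS => Φ (p.1, -p.2))
      = fun p => β ‖p.2‖ * (lap (liftF g) p * scoreCurv g (p.1 - p.2)) := by
    funext p
    simp only [hΦ, norm_neg, lap_reflect hg.contDiff_liftF hF, ← sub_eq_add_neg]
  have e2 := hmp _ hrefl
  have iΦr : Integrable fun p : PS => Φ (p.1, -p.2) := hrefl.integrable_comp_of_integrable iΦ
  have iΦs : Integrable fun p : PS => Φ p + Φ (p.1, -p.2) := iΦ.add iΦr
  have e3 : 2 * ∫ p, Φ p = ∫ p, (Φ p + Φ (p.1, -p.2)) := by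
    rw [integral_add iΦ iΦr, e2]; ring
  rw [hg.integral_fisherRate hα, e1,
    show -(8 * ∫ p, Φ p) = -2 * (2 * (2 * ∫ p, Φ p)) by ring, e3,
    integral_polar_prod _ iΦs.aestronglyMeasurable, ← integral_const_mul 2]
  congr 1
  refine integral_congr_ae ?_
  filter_upwards [ae_coordMeasure_pos] with q hq
  have hn : ‖q.2.1 • (q.2.2 : E3)‖ = q.2.1 := by
    rw [norm_smul, norm_S2, mul_one, Real.norm_of_nonneg hq.le]
  have h1 := congrFun hΦr (q.1, q.2.1 • (q.2.2 : E3))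
  simp only at h1
  rw [h1, hg.terms_eq]
  simp only [hΦ, hn]
  ring

end

/-! ### Reduction to a measurable potential -/

section Restrict

variable {α : ℝ → ℝ}

/-- Setting an admissible potential to zero on `(-∞, 0]`, where its values are irrelevant but need
not be measurable, gives a weight. -/
lemma IsPotential.isWeight (hα : IsPotential α) : IsWeight ((Ioi 0).indicator α) where
  measurable := by
    classical
    rw [← piecewise_eq_indicator]
    exact hα.contDiffOn.continuousOn.measurable_piecewise continuousOn_const measurableSet_Ioi
  nonneg r hr := by rw [indicator_of_mem (mem_Ioi.2 hr)]; exact hα.nonneg r hr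
  contDiffOn := hα.contDiffOn.congr fun r hr => indicator_of_mem hr α
  integrableOn := by
    obtain ⟨C, m, hC⟩ := hα.growth
    refine ⟨m + 6, ?_⟩
    have hcont : ContinuousOn (fun r => α r * (r ^ 4 / (1 + r) ^ (m + 6))) (Ioi 0) := by
      refine hα.contDiffOn.continuousOn.mul (ContinuousOn.div (by fun_prop) (by fun_prop) ?_)
      intro r (hr : 0 < r)
      positivity
    have hmeas := hcont.aestronglyMeasurable (μ := volume) measurableSet_Ioi
    have h1 : IntegrableOn (fun r => α r * (r ^ 4 / (1 + r) ^ (m + 6))) (Ioc 0 1) := by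
      refine hα.integrableOn.mono' (hmeas.mono_measure
        (Measure.restrict_mono Ioc_subset_Ioi_self le_rfl)) ?_
      filter_upwards [ae_restrict_mem measurableSet_Ioc] with r hr
      have hr0 := hr.1
      have ha := hα.nonneg r hr.1
      rw [Real.norm_of_nonneg (by positivity), mul_comm]
      gcongr
      exact div_le_self (by positivity) (one_le_pow₀ (by linarith))
    have h2 : IntegrableOn (fun r => α r * (r ^ 4 / (1 + r) ^ (m + 6))) (Ioi 1) := by
      have h3 : IntegrableOn (fun r : ℝ => |C| * r ^ (-2 : ℝ)) (Ioi 1) :=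
        (integrableOn_Ioi_rpow_of_lt (by norm_num) one_pos).const_mul _
      refine h3.mono' (hmeas.mono_measure
        (Measure.restrict_mono (Ioi_subset_Ioi zero_le_one) le_rfl)) ?_
      filter_upwards [ae_restrict_mem measurableSet_Ioi] with r hr
      have hr1 : 1 < r := hr
      have hr0 : 0 < r := one_pos.trans hr1
      have ha := hα.nonneg r hr0
      rw [Real.norm_of_nonneg (by positivity), Real.rpow_neg hr0.le, Real.rpow_ofNat]
      calc α r * (r ^ 4 / (1 + r) ^ (m + 6)) ≤ (|C| * r ^ m) * (r ^ 4 / r ^ (m + 6)) := by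
            gcongr
            · exact (hC r hr1.le).trans (by gcongr; exact le_abs_self C)
            · linarith
        _ = |C| * (r ^ 2)⁻¹ := by field_simp; ring
    have h3 := h1.union h2
    rw [Ioc_union_Ioi_eq_Ioi zero_le_one] at h3
    exact h3.congr_fun (fun r hr => by rw [indicator_of_mem hr]) measurableSet_Ioi
  growth := by
    obtain ⟨C, m, hC⟩ := hα.growth
    refine ⟨C, m, fun r hr => ?_⟩
    rw [indicator_of_mem (mem_Ioi.2 (by linarith))]
    exact hC r hr

lemma landauOperator_indicator (α : ℝ → ℝ) :
    landauOperator ((Ioi 0).indicator α) = landauOperator α := by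
  have h : landauMatrix ((Ioi 0).indicator α) = landauMatrix α := by
    funext y ξ
    rcases eq_or_ne y 0 with rfl | hy
    · simp [landauMatrix]
    · rw [landauMatrix, landauMatrix, indicator_of_mem (mem_Ioi.2 (norm_pos_iff.2 hy))]
  have h' : landauFlux ((Ioi 0).indicator α) = landauFlux α := by
    funext f v; simp only [landauFlux, h]
  funext f v
  rw [landauOperator, landauOperator, h']

lemma IsSmoothSolution.indicator {T : ℝ} {f : ℝ → E3 → ℝ} (hf : IsSmoothSolution α T f) :
    IsSmoothSolution ((Ioi 0).indicator α) T f :=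
  { hf with equation := by rw [landauOperator_indicator]; exact hf.equation }

lemma liftedPotential_indicator {r : ℝ} (hr : 0 < r) :
    liftedPotential ((Ioi 0).indicator α) r = liftedPotential α r := by
  rw [liftedPotential, liftedPotential, indicator_of_mem (mem_Ioi.2 (by linarith))]

lemma gammaDensity_indicator (F : E3 → E3 → ℝ) :
    gammaDensity (liftedPotential ((Ioi 0).indicator α)) F
      =ᵐ[coordMeasure] gammaDensity (liftedPotential α) F := by
  filter_upwards [ae_coordMeasure_pos] with q hq
  rw [gammaDensity, gammaDensity, liftedPotential_indicator hq]

lemma radialDensity_indicator (F : E3 → E3 → ℝ) :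
    radialDensity (liftedPotential ((Ioi 0).indicator α)) F
      =ᵐ[coordMeasure] radialDensity (liftedPotential α) F := by
  filter_upwards [ae_coordMeasure_pos] with q hq
  have h : (fun r => √(liftedPotential ((Ioi 0).indicator α) r))
      =ᶠ[nhds q.2.1] fun r => √(liftedPotential α r) := by
    filter_upwards [Ioi_mem_nhds hq] with r hr
    rw [liftedPotential_indicator hr]
  rw [radialDensity, radialDensity, h.deriv_eq]

end Restrict

end Landau

end

theorem mainTheorem1 (α : ℝ → ℝ) (hα : Landau.IsPotential α) (T : ℝ)
    (f : ℝ → Landau.E3 → ℝ) (hf : Landau.IsSmoothSolution α T f) (t : ℝ) (ht : t ∈ Ioo 0 T) :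
    Integrable (Landau.fisherDensity (f t)) ∧
    DifferentiableAt ℝ (fun s => Landau.fisherInfo (f s)) t ∧
    Integrable (Landau.gammaDensity (Landau.liftedPotential α) (Landau.tensorSq (f t)))
      Landau.coordMeasure ∧
    ((deriv (fun s => Landau.fisherInfo (f s)) t : ℝ) : EReal) ≤
      4 * (-((∫ p, Landau.gammaDensity (Landau.liftedPotential α) (Landau.tensorSq (f t)) p
              ∂Landau.coordMeasure : ℝ) : EReal)
          + ((∫⁻ p, ENNReal.ofReal
              (Landau.radialDensity (Landau.liftedPotential α) (Landau.tensorSq (f t)) p)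
              ∂Landau.coordMeasure : ℝ≥0∞) : EReal)) := by
  have hw := hα.isWeight
  have hf' := hf.indicator
  have htame := hf'.isTame ht
  have hγ := Landau.gammaDensity_indicator (α := α) (Landau.tensorSq (f t))
  have hρ : ∀ᵐ p ∂Landau.coordMeasure, ENNReal.ofReal (Landau.radialDensity
      (Landau.liftedPotential ((Ioi 0).indicator α)) (Landau.tensorSq (f t)) p)
      = ENNReal.ofReal (Landau.radialDensity (Landau.liftedPotential α)
        (Landau.tensorSq (f t)) p) := by
    filter_upwards [Landau.radialDensity_indicator (α := α) (Landau.tensorSq (f t))] with p hp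
    rw [hp]
  obtain ⟨hint, hderiv⟩ := hf'.hasDerivAt_fisherInfo hw ht
  refine ⟨hint, hderiv.differentiableAt,
    (htame.integrable_gammaDensity hw.lift).congr hγ, ?_⟩
  have h := Landau.dissipation_le htame hw.lift
  rw [← htame.integral_fisherRate_eq hw, ← hderiv.deriv, integral_congr_ae hγ,
    lintegral_congr_ae hρ] at h
  exact h
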